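/- Let $N\ge 1$, $p\in[1,\infty)$, and let $\underline d$ be a metric on $\mathbb R$ inducing the usual topology. Put $d(x,y)=\big(\sum_{t=1}^N\underline d(x_t,y_t)^p\big)^{1/p}$ on $\mathbb R^N$. For a metric space $(R,\rho)$ let $\mathcal P^p(R)$ be the set of Borel probability measures $\mu$ on $R$ with $\int\rho(x,x_0)^p\,\mu(\mathrm dx)<\infty$ for some $x_0\in R$, and let $W_{\rho,p}(\mu,\nu)=\big(\inf_{\gamma\in\Pi(\mu,\nu)}\int\rho(x,y)^p\,\mathrm d\gamma\big)^{1/p}$, where $\Pi(\mu,\nu)$ is the set of couplings of $\mu$ and $\nu$. Call a coupling $\gamma$ of $\mu,\nu\in\mathcal P^p(\mathbb R^N)$ bicausal, $\gamma\in\Pi_{bc}(\mu,\nu)$, if for every $t<N$ and every $B$ in the $\sigma$-algebra $\mathcal F_t$ generated by the first $t$ coordinates, the maps $x\mapsto\gamma^x(B)$ and $y\mapsto\gamma^y(B)$ given by the disintegrations of $\gamma$ with respect to its first and its second marginal are, up to null sets, $\mathcal F_t$-measurable. The nested distance is $$d_p^{\mathrm{nd}}(\mu,\nu)=\Big(\inf_{\gamma\in\Pi_{bc}(\mu,\nu)}\int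 d(x,y)^p\,\gamma(\mathrm dx,\mathrm dy)\Big)^{1/p}.$$ Define recursively $R_{N:N}=(\mathbb R,\underline d)$, $d_{(N:N)}=\underline d$, and, for $t=N,\dots,2$, $R_{t-1:N}=\mathbb R\times\mathcal P^p(R_{t:N})$ with $d_{(t-1:N)}=\big[\underline d^p+W_{d_{(t:N)},p}^p\big]^{1/p}$. For $\mu\in\mathcal P^p(\mathbb R^N)$ let $X=(X_1,\dots,X_N)$ have law $\mu$ and put $$I[\mu]=\mathcal L\Big(X_1,\mathcal L^{X_1}\big(X_2,\dots,\mathcal L^{X_{1:N-2}}(X_{N-1},\mathcal L^{X_{1:N-1}}(X_N))\big)\Big),$$ where $\mathcal L^{X_{1:k}}$ denotes the conditional law given $(X_1,\dots,X_k)$. **Theorem.** $I$ is a well-defined map from $\mathcal P^p(\mathbb R^N)$ to $\mathcal P^p(R_{1:N})$. Both $d_p^{\mathrm{nd}}$ on $\mathcal P^p(\mathbb R^N)$ and $W_{d_{(1:N)},p}$ on $\mathcal P^p(R_{1:N})$ are (finite) metrics, and $I$ is an isometric embedding of $(\mathcal P^p(\mathbb R^N),d_p^{\mathrm{nd}})$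 into $(\mathcal P^p(R_{1:N}),W_{d_{(1:N)},p})$. The latter space is separable, and it is complete whenever $\underline d$ is complete. In particular $(\mathcal P^p(\mathbb R^N),d_p^{\mathrm{nd}})$ is separable. -/

import Mathlib

open MeasureTheory ProbabilityTheory
open scoped ENNReal

noncomputable section

namespace NestedDistance

/-! ### Wasserstein distances for a distance function `d : X → X → [0, ∞]` -/

/-- The topology of a distance function: `U` is open iff it contains a ball around each of its
points. -/
@[reducible] def metricTopology {X : Type} (d : X → X → ℝ≥0∞) : TopologicalSpace X where
  IsOpen U := ∀ x ∈ U, ∃ ε > 0, ∀ y, d y x < ε → y ∈ U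
  isOpen_univ := fun _ _ => ⟨1, one_pos, fun _ _ => Set.mem_univ _⟩
  isOpen_inter := by
    rintro U V hU hV x ⟨hxU, hxV⟩
    obtain ⟨ε, hε, h⟩ := hU x hxU
    obtain ⟨η, hη, h'⟩ := hV x hxV
    exact ⟨min ε η, lt_min hε hη, fun y hy =>
      ⟨h y (hy.trans_le (min_le_left _ _)), h' y (hy.trans_le (min_le_right _ _))⟩⟩
  isOpen_sUnion := by
    rintro s hs x ⟨U, hU, hxU⟩
    obtain ⟨ε, hε, h⟩ := hs U hU x hxU
    exact ⟨ε, hε, fun y hy => ⟨U, hU, h y hy⟩⟩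

/-- The couplings (transport plans) `Π(μ, ν)`. -/
def couplings {X Y : Type} [MeasurableSpace X] [MeasurableSpace Y]
    (μ : Measure X) (ν : Measure Y) : Set (Measure (X × Y)) :=
  {γ | γ.map Prod.fst = μ ∧ γ.map Prod.snd = ν}

/-- The `p`-Wasserstein distance with respect to `d`. -/
def wasserstein {X : Type} [MeasurableSpace X] (p : ℝ) (d : X → X → ℝ≥0∞)
    (μ ν : Measure X) : ℝ≥0∞ :=
  (⨅ γ ∈ couplings μ ν, ∫⁻ z, d z.1 z.2 ^ p ∂γ) ^ (1 / p)

/-- `𝒫ᵖ(X, d)`: probability measures with finite `p`-th moment. -/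
def PMoment {X : Type} [MeasurableSpace X] (p : ℝ) (d : X → X → ℝ≥0∞) : Type :=
  {μ : Measure X // IsProbabilityMeasure μ ∧ ∃ x₀, ∫⁻ x, d x x₀ ^ p ∂μ < ∞}

/-- The underlying measure. -/
def PMoment.toMeasure {X : Type} [MeasurableSpace X] {p : ℝ} {d : X → X → ℝ≥0∞}
    (μ : PMoment p d) : Measure X := μ.1

instance PMoment.isProbabilityMeasure {X : Type} [MeasurableSpace X] {p : ℝ}
    {d : X → X → ℝ≥0∞} (μ : PMoment p d) : IsProbabilityMeasure μ.toMeasure := μ.2.1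

theorem wasserstein_self {X : Type} [MeasurableSpace X] {p : ℝ} (hp : 1 ≤ p)
    {d : X → X → ℝ≥0∞} (hd : ∀ x, d x x = 0) (μ : Measure X) : wasserstein p d μ μ = 0 := by
  have hp0 : 0 < p := by linarith
  have hm : Measurable (fun x : X => (x, x)) := by fun_prop
  have hc : μ.map (fun x : X => (x, x)) ∈ couplings μ μ := by
    constructor
    · rw [Measure.map_map measurable_fst hm]
      exact Measure.map_id
    · rw [Measure.map_map measurable_snd hm]
      exact Measure.map_id
  have h0 : (⨅ γ ∈ couplings μ μ, ∫⁻ z, d z.1 z.2 ^ p ∂γ) = 0 := by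
    refine le_antisymm ((iInf₂_le _ hc).trans ((lintegral_map_le _ _).trans ?_)) bot_le
    simp [hd, ENNReal.zero_rpow_of_pos hp0]
  rw [wasserstein, h0, ENNReal.zero_rpow_of_pos (by positivity)]

/-! ### Nested distributions -/

/-- A set with a distance function and a base point (the base point only serves as a default). -/
structure DistSpace where
  carrier : Type
  d : carrier → carrier → ℝ≥0∞
  base : carrier
  d_self : ∀ x, d x x = 0

/-- Every such space carries the Borel `σ`-algebra of the topology of its distance. -/
instance DistSpace.measurableSpace (X : DistSpace) : MeasurableSpace X.carrier :=
  @borel X.carrier (metricTopology X.d)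

/-- The Dirac measure at the base point. -/
def DistSpace.diracBase (X : DistSpace) {p : ℝ} (hp : 1 ≤ p) : PMoment p X.d :=
  ⟨Measure.dirac X.base, inferInstance, X.base, by
    have h : Measure.dirac X.base = (Measure.dirac ()).map (fun _ : Unit => X.base) := by
      rw [Measure.map_dirac' measurable_const]
    rw [h]
    refine (lintegral_map_le _ _).trans_lt ?_
    simp [X.d_self, ENNReal.zero_rpow_of_pos (show 0 < p by linarith)]⟩

open Classical in
/-- A measure regarded as an element of `𝒫ᵖ(X)` (with a default value if it is not one). -/
def DistSpace.ofMeasure (X : DistSpace) {p : ℝ} (hp : 1 ≤ p) (μ : Measure X.carrier) :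
    PMoment p X.d :=
  if h : IsProbabilityMeasure μ ∧ ∃ x₀, ∫⁻ x, X.d x x₀ ^ p ∂μ < ∞ then ⟨μ, h⟩
  else X.diracBase hp

/-- The base distance on the real line given by a metric `ρ`. -/
def baseDist (ρ : MetricSpace ℝ) : ℝ → ℝ → ℝ≥0∞ := fun x y => @edist ℝ ρ.toEDist x y

theorem baseDist_self (ρ : MetricSpace ℝ) (x : ℝ) : baseDist ρ x x = 0 :=
  @edist_self ℝ ρ.toPseudoMetricSpace.toPseudoEMetricSpace x

/-- The metric `ρ` induces the usual topology of the real line. -/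
def IsCompatible (ρ : MetricSpace ℝ) : Prop :=
  ρ.toPseudoMetricSpace.toUniformSpace.toTopologicalSpace
    = Real.pseudoMetricSpace.toUniformSpace.toTopologicalSpace

/-- One step of the recursion: `ℝ × 𝒫ᵖ(X)` with the distance `[ρᵖ + W_{X,p}ᵖ]^{1/p}`. -/
def DistSpace.next {p : ℝ} (hp : 1 ≤ p) (ρ : MetricSpace ℝ) (X : DistSpace) : DistSpace where
  carrier := ℝ × PMoment p X.d
  d a b := (baseDist ρ a.1 b.1 ^ p + wasserstein p X.d a.2.toMeasure b.2.toMeasure ^ p) ^ (1 / p)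
  base := (0, X.diracBase hp)
  d_self a := by
    have hp0 : 0 < p := by linarith
    simp only [baseDist_self, wasserstein_self hp X.d_self, ENNReal.zero_rpow_of_pos hp0, add_zero]
    exact ENNReal.zero_rpow_of_pos (by positivity)

/-- `nestedSpace hp ρ k` is `R_{N-k:N}`, the space with `k + 1` time steps:
`R_{N:N} = (ℝ, ρ)` and `R_{t-1:N} = ℝ × 𝒫ᵖ(R_{t:N})`. -/
def nestedSpace {p : ℝ} (hp : 1 ≤ p) (ρ : MetricSpace ℝ) : ℕ → DistSpace
  | 0 => ⟨ℝ, baseDist ρ, 0, baseDist_self ρ⟩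
  | k + 1 => (nestedSpace hp ρ k).next hp ρ

/-- `𝒫ᵖ(R_{1:N})` with `N = n + 1`: the nested distributions of depth `N`. -/
abbrev NestedLaw {p : ℝ} (hp : 1 ≤ p) (ρ : MetricSpace ℝ) (n : ℕ) : Type :=
  PMoment p (nestedSpace hp ρ n).d

/-- The distance `W_{d_{(1:N)},p}` on `𝒫ᵖ(R_{1:N})`. -/
def nestedLawDist {p : ℝ} (hp : 1 ≤ p) (ρ : MetricSpace ℝ) (n : ℕ) (P Q : NestedLaw hp ρ n) :
    ℝ≥0∞ :=
  wasserstein p (nestedSpace hp ρ n).d P.toMeasure Q.toMeasure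

/-! ### The nested distance on `𝒫ᵖ(ℝᴺ)`, `N = n + 1` -/

/-- The `ℓᵖ`-product distance `d_p` on `ℝᴺ`. -/
def pathDist (p : ℝ) (ρ : MetricSpace ℝ) (n : ℕ) (x y : Fin (n + 1) → ℝ) : ℝ≥0∞ :=
  (∑ i, baseDist ρ (x i) (y i) ^ p) ^ (1 / p)

/-- `𝒫ᵖ(ℝᴺ)`. -/
abbrev PathLaw (p : ℝ) (ρ : MetricSpace ℝ) (n : ℕ) : Type :=
  PMoment p (pathDist p ρ n)

/-- The canonical filtration: `past n t` is generated by the first `t` coordinates. -/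
@[reducible] def past (n t : ℕ) : MeasurableSpace (Fin (n + 1) → ℝ) :=
  MeasurableSpace.comap (fun (x : Fin (n + 1) → ℝ) (i : {i : Fin (n + 1) // i.val < t}) => x i)
    inferInstance

/-- The disintegration `x ↦ γˣ` of `γ` is adapted: for `t < N` and `B ∈ ℱ_t`, `x ↦ γˣ(B)` is
`ℱ_t`-measurable modulo a null set. -/
def IsCausal {n : ℕ} (γ : Measure ((Fin (n + 1) → ℝ) × (Fin (n + 1) → ℝ)))
    [IsFiniteMeasure γ] : Prop :=
  ∀ t < n + 1, ∀ B : Set (Fin (n + 1) → ℝ), MeasurableSet[past n t] B →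
    ∃ g : (Fin (n + 1) → ℝ) → ℝ≥0∞, Measurable[past n t] g ∧
      (fun x => γ.condKernel x B) =ᵐ[γ.fst] g

/-- The bicausal plans `Π_bc(μ, ν)`. -/
def bicausal {n : ℕ} (μ ν : Measure (Fin (n + 1) → ℝ)) :
    Set (Measure ((Fin (n + 1) → ℝ) × (Fin (n + 1) → ℝ))) :=
  {γ | γ ∈ couplings μ ν ∧ ∃ _ : IsFiniteMeasure γ, IsCausal γ ∧ IsCausal (γ.map Prod.swap)}

/-- The `p`-nested distance. -/
def nestedDist (p : ℝ) (ρ : MetricSpace ℝ) (n : ℕ) (μ ν : PathLaw p ρ n) : ℝ≥0∞ :=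
  (⨅ γ ∈ bicausal (PMoment.toMeasure μ) (PMoment.toMeasure ν),
    ∫⁻ z, pathDist p ρ n z.1 z.2 ^ p ∂γ) ^ (1 / p)

/-! ### The map `I` -/

/-- The conditional law under `μ` of a random element `Z` of `X`, given the first `t` coordinates,
evaluated at `ω`: the image under `Z` of the regular conditional probability. -/
def condLaw {n : ℕ} (μ : Measure (Fin (n + 1) → ℝ)) [IsFiniteMeasure μ] {X : DistSpace}
    (t : ℕ) (Z : (Fin (n + 1) → ℝ) → X.carrier) (ω : Fin (n + 1) → ℝ) : Measure X.carrier :=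
  Measure.map Z (condExpKernel μ (past n t) ω)

/-- The random elements
`X_N`, `(X_{N-1}, ℒ^{X_{1:N-1}}(X_N))`, `(X_{N-2}, ℒ^{X_{1:N-2}}(X_{N-1}, ℒ^{X_{1:N-1}}(X_N)))`, …
of `R_{N:N}`, `R_{N-1:N}`, `R_{N-2:N}`, …, where `X` is the coordinate process on `ℝᴺ` under `μ`.
Here `N = n + 1`, and `X_t` is the coordinate number `t - 1` of `Fin (n + 1)`; the index `k ≤ n`
belongs to time `t = N - k`. -/
def iterated {n : ℕ} {p : ℝ} (hp : 1 ≤ p) (ρ : MetricSpace ℝ) (μ : Measure (Fin (n + 1) → ℝ))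
    [IsFiniteMeasure μ] : (k : ℕ) → (Fin (n + 1) → ℝ) → (nestedSpace hp ρ k).carrier
  | 0 => fun ω => ω ⟨n, by omega⟩
  | k + 1 => fun ω =>
      ((ω ⟨n - (k + 1), by omega⟩,
        (nestedSpace hp ρ k).ofMeasure hp (condLaw μ (n - k) (iterated hp ρ μ k) ω)) :
        ℝ × PMoment p (nestedSpace hp ρ k).d)

/-- The second component of a point of `R_{N-k-1:N} = ℝ × 𝒫ᵖ(R_{N-k:N})`. -/
def tail {p : ℝ} {hp : 1 ≤ p} {ρ : MetricSpace ℝ} {k : ℕ}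
    (a : (nestedSpace hp ρ (k + 1)).carrier) : PMoment p (nestedSpace hp ρ k).d :=
  Prod.snd (α := ℝ) (β := PMoment p (nestedSpace hp ρ k).d) a

/-- The map `I`: `I[μ] = ℒ(X_1, ℒ^{X_1}(X_2, …, ℒ^{X_{1:N-1}}(X_N)))`. -/
def iteratedLaw {p : ℝ} (hp : 1 ≤ p) (ρ : MetricSpace ℝ) (n : ℕ) (μ : PathLaw p ρ n) :
    NestedLaw hp ρ n :=
  (nestedSpace hp ρ n).ofMeasure hp
    (Measure.map (iterated hp ρ (PMoment.toMeasure μ) n) (PMoment.toMeasure μ))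

/-- `I[μ]` is well defined as an element of `𝒫ᵖ(R_{1:N})`: the iterated random elements are
measurable, almost surely their second components are the conditional laws (no default value
occurs), and `I[μ]` is the law of the last of them. -/
def IteratedLawWellDefined {p : ℝ} (hp : 1 ≤ p) (ρ : MetricSpace ℝ) (n : ℕ)
    (μ : PathLaw p ρ n) : Prop :=
  (∀ k ≤ n, Measurable (iterated hp ρ (PMoment.toMeasure μ) k)) ∧
  (∀ k < n, ∀ᵐ ω ∂μ.toMeasure,
    (tail (iterated hp ρ (PMoment.toMeasure μ) (k + 1) ω)).toMeasure
      = condLaw (PMoment.toMeasure μ) (n - k) (iterated hp ρ (PMoment.toMeasure μ) k) ω) ∧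
  (iteratedLaw hp ρ n μ).toMeasure
    = Measure.map (iterated hp ρ (PMoment.toMeasure μ) n) (PMoment.toMeasure μ)

end NestedDistance

end

/-!
The theorem reduces to two facts. First, if `d` is a separable (and complete) metric on `X`, then
so is the Wasserstein distance on `𝒫ᵖ(X)`; applied along the recursion `R_{t-1:N} = ℝ ×
𝒫ᵖ(R_{t:N})`, this gives the properties of the nested spaces. Second, the nested distance of `μ`
and `ν` is the Wasserstein distance of `I[μ]` and `I[ν]`; the metric axioms and the separability of
the nested distance follow, the separation of points being inherited from the ordinary Wasserstein
distance on `𝒫ᵖ(ℝᴺ)`.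

The nested spaces carry a distance function and its Borel `σ`-algebra (`IsSepDist`). Instead of
showing that they are standard Borel spaces, the proof avoids disintegration of measures on them:
the couplings used there have densities with respect to the product of their marginals. The space is
partitioned into countably many cells of small diameter, and a plan is determined by a matrix of
finitely many rational cell masses: inside a product of cells it is a multiple of the product
measure, and the mass missing to the marginals is distributed independently. There are only
countably many such matrices, and their plans come arbitrarily close to the optimal cost
(`exists_gridPlan`). So the Wasserstein distance is a measurable function of its marginals
(`IsSepDist.exists_measurable_eq_wasserstein`), which makes the iterated conditional laws
measurable, and taking the first almost optimal matrix in an enumeration gives almost optimal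
couplings whose densities are jointly measurable in the points and the marginals
(`IsSepDist.exists_density_selection`). Densities are easily composed: products of two of them give
the triangle inequality (`IsSepDist.wasserstein_triangle`), and a sequence of them defines a Markov
chain, which converges almost surely if consecutive laws are close enough, and the law of whose
limit is the limit in `𝒫ᵖ(X)` (`IsSepDist.isCompleteDist_pMoment`). Measures with rational masses
on a dense sequence give separability (`IsSepDist.isSepDist_pMoment`).

For `W(I[μ], I[ν]) ≤ d^nd(μ, ν)` (`nestedLawDist_iteratedLaw_le`), let `γ` be bicausal. Causality
says that, given the past of the first coordinate, the first coordinate is independent of the past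
of the second one (`setLIntegral_fst_of_causal`). Hence the conditional joint law under `γ`, given
the past of both coordinates, couples the conditional laws of `μ` and `ν`, and the conditional
expectation of the cost bounds their Wasserstein distance. Backward induction in time concludes.

For the converse (`nestedDist_rpow_le`), take `ε`-optimal coupling densities of the conditional
laws of the iterated random elements at each time, given the past, and multiply them. Each factor
depends only on the past and the present and has conditional expectation one given the past, in
either coordinate; therefore the product is the density of a bicausal plan with respect to `μ ⊗ ν`
(`IsBicausalDensity.densityPlan_mem_bicausal`). Its cost in each coordinate is computed from the
recursive definition of the distances, and the total exceeds `W(I[μ], I[ν])ᵖ` by at most `N ε`.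
-/

open MeasureTheory ProbabilityTheory
open scoped ENNReal

namespace NestedDistance

open Filter Topology

/-! ### Separable distances -/

/-- `d` is a finite separable metric on `X`, and the `σ`-algebra of `X` is the Borel `σ`-algebra
of `d`. -/
structure IsSepDist {X : Type} [mX : MeasurableSpace X] (d : X → X → ℝ≥0∞) : Prop where
  self : ∀ x, d x x = 0
  comm : ∀ x y, d x y = d y x
  triangle : ∀ x y z, d x z ≤ d x y + d y z
  ne_top : ∀ x y, d x y ≠ ∞
  eq_of_zero : ∀ x y, d x y = 0 → x = y
  dense : ∃ s : ℕ → X, ∀ x, ∀ ε, 0 < ε → ∃ n, d x (s n) < ε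
  borel : mX = @borel X (metricTopology d)

/-- Completeness of `d`: sequences with summable increments converge. For metrics this is equivalent
to the convergence of Cauchy sequences, and it avoids passing to subsequences in
`IsSepDist.isCompleteDist_pMoment`. -/
def IsCompleteDist {X : Type} (d : X → X → ℝ≥0∞) : Prop :=
  ∀ u : ℕ → X, ∑' n, d (u n) (u (n + 1)) ≠ ∞ → ∃ x, Tendsto (fun n => d (u n) x) atTop (𝓝 0)

namespace IsSepDist

variable {X : Type} [mX : MeasurableSpace X] {d : X → X → ℝ≥0∞}

/-- The extended metric space structure given by `d`; its topology is `metricTopology d`. -/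
@[reducible] noncomputable def emetricSpace (h : IsSepDist d) : EMetricSpace X where
  edist := d
  edist_self := h.self
  edist_comm := h.comm
  edist_triangle := h.triangle
  eq_of_edist_eq_zero := h.eq_of_zero _ _

/-- The metric space structure given by `d`. -/
@[reducible] noncomputable def metricSpace (h : IsSepDist d) : MetricSpace X :=
  @EMetricSpace.toMetricSpace X h.emetricSpace h.ne_top

theorem topology_eq {X : Type} (E : PseudoEMetricSpace X) :
    E.toUniformSpace.toTopologicalSpace = metricTopology (fun x y => E.toEDist.edist x y) := by
  ext U
  exact EMetric.isOpen_iff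

theorem emetricSpace_topology (h : IsSepDist d) :
    h.emetricSpace.toUniformSpace.toTopologicalSpace = metricTopology d :=
  topology_eq h.emetricSpace.toPseudoEMetricSpace

theorem borelSpace (h : IsSepDist d) :
    @BorelSpace X h.emetricSpace.toUniformSpace.toTopologicalSpace mX := by
  refine @BorelSpace.mk X h.emetricSpace.toUniformSpace.toTopologicalSpace mX ?_
  rw [emetricSpace_topology]
  exact h.borel

theorem separableSpace_of_dense {X : Type} (E : PseudoEMetricSpace X) (s : ℕ → X)
    (hs : ∀ x, ∀ ε, 0 < ε → ∃ n, edist x (s n) < ε) : TopologicalSpace.SeparableSpace X := by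
  refine ⟨Set.range s, Set.countable_range s, ?_⟩
  rw [EMetric.dense_iff]
  intro x r hr
  obtain ⟨n, hn⟩ := hs x r hr
  exact ⟨s n, by rwa [Metric.mem_eball, edist_comm], n, rfl⟩

theorem secondCountable (h : IsSepDist d) :
    @SecondCountableTopology X h.emetricSpace.toUniformSpace.toTopologicalSpace := by
  let := h.emetricSpace
  obtain ⟨s, hs⟩ := h.dense
  have : TopologicalSpace.SeparableSpace X := separableSpace_of_dense inferInstance s hs
  exact UniformSpace.secondCountable_of_separable X

theorem measurable (h : IsSepDist d) : Measurable (fun z : X × X => d z.1 z.2) := by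
  let := h.emetricSpace
  have := h.borelSpace
  have := h.secondCountable
  exact measurable_edist

theorem measurable_comp (h : IsSepDist d) {Ω : Type*} [MeasurableSpace Ω] {f g : Ω → X}
    (hf : Measurable f) (hg : Measurable g) : Measurable (fun ω => d (f ω) (g ω)) :=
  h.measurable.comp (hf.prodMk hg)

/-- An open set of a separable metric space is a countable union of balls, hence a map is measurable
as soon as its distances to all points are. -/
theorem measurable_of_dist (h : IsSepDist d) {Ω : Type*} [mΩ : MeasurableSpace Ω] {f : Ω → X}
    (hf : ∀ y, Measurable fun ω => d (f ω) y) : Measurable f := by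
  let := h.emetricSpace
  have := h.borelSpace
  refine measurable_of_isOpen fun U hU => ?_
  obtain ⟨s, hs⟩ := h.dense
  have : U = ⋃ q : {q : ℕ × ℕ // Metric.eball (s q.1) ((q.2 : ℝ≥0∞)⁻¹) ⊆ U},
      Metric.eball (s q.1.1) ((q.1.2 : ℝ≥0∞)⁻¹) := by
    refine Set.Subset.antisymm (fun x hx => ?_) (Set.iUnion_subset fun q => q.2)
    obtain ⟨ε, hε, hb⟩ := EMetric.isOpen_iff.1 hU x hx
    obtain ⟨m, hm⟩ := ENNReal.exists_inv_nat_lt (ENNReal.half_pos hε.ne').ne'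
    obtain ⟨n, hn⟩ := hs x ((m : ℝ≥0∞)⁻¹) (by simp)
    refine Set.mem_iUnion.2 ⟨⟨(n, m), fun y hy => hb ?_⟩, hn⟩
    have h1 : edist y (s n) < (m : ℝ≥0∞)⁻¹ := hy
    have h2 : edist (s n) x < (m : ℝ≥0∞)⁻¹ := by rw [edist_comm]; exact hn
    calc edist y x ≤ edist y (s n) + edist (s n) x := edist_triangle _ _ _
      _ < ε / 2 + ε / 2 := ENNReal.add_lt_add (h1.trans hm) (h2.trans hm)
      _ = ε := ENNReal.add_halves ε
  rw [this, Set.preimage_iUnion]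
  exact MeasurableSet.iUnion fun q => measurableSet_lt (hf _) measurable_const

end IsSepDist

/-! ### Powers and moments -/

section Powers

variable {X : Type} {p : ℝ}

theorem rpow_inv_rpow' (hp : 1 ≤ p) (a : ℝ≥0∞) : (a ^ (1 / p)) ^ p = a := by
  rw [← ENNReal.rpow_mul, one_div, inv_mul_cancel₀ (by linarith), ENNReal.rpow_one]

theorem rpow_rpow_inv' (hp : 1 ≤ p) (a : ℝ≥0∞) : (a ^ p) ^ (1 / p) = a := by
  rw [← ENNReal.rpow_mul, one_div, mul_inv_cancel₀ (by linarith), ENNReal.rpow_one]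

theorem rpow_le_rpow' (hp : 1 ≤ p) {a b : ℝ≥0∞} (h : a ≤ b) : a ^ p ≤ b ^ p :=
  ENNReal.rpow_le_rpow h (by linarith)

theorem rpow_add_le' (hp : 1 ≤ p) (a b : ℝ≥0∞) :
    (a + b) ^ p ≤ 2 ^ (p - 1) * (a ^ p + b ^ p) := by
  rw [mul_add]
  exact (ENNReal.rpow_add_le_mul_rpow_add_rpow a b hp).trans_eq (by rw [mul_add])

theorem two_rpow_ne_top (p : ℝ) : (2 : ℝ≥0∞) ^ (p - 1) ≠ ∞ := by
  apply ENNReal.rpow_ne_top_of_ne_zero <;> simp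

variable [mX : MeasurableSpace X] {d : X → X → ℝ≥0∞}

/-- The moment is finite for every choice of the reference point once it is for one. -/
theorem IsSepDist.moment_lt_top (h : IsSepDist d) (hp : 1 ≤ p) {P : Measure X}
    [IsFiniteMeasure P] {x₀ : X} (hx : ∫⁻ x, d x x₀ ^ p ∂P < ∞) (y : X) :
    ∫⁻ x, d x y ^ p ∂P < ∞ := by
  have hp0 : 0 ≤ p := by linarith
  calc ∫⁻ x, d x y ^ p ∂P
      ≤ ∫⁻ x, 2 ^ (p - 1) * (d x x₀ ^ p + d x₀ y ^ p) ∂P :=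
        lintegral_mono fun x => (rpow_le_rpow' hp (h.triangle x x₀ y)).trans (rpow_add_le' hp _ _)
    _ = 2 ^ (p - 1) * (∫⁻ x, d x x₀ ^ p ∂P + d x₀ y ^ p * P Set.univ) := by
        rw [lintegral_const_mul', lintegral_add_right _ measurable_const, lintegral_const]
        exact two_rpow_ne_top p
    _ < ∞ := by
        refine ENNReal.mul_lt_top (two_rpow_ne_top p).lt_top (ENNReal.add_lt_top.2 ⟨hx, ?_⟩)
        exact ENNReal.mul_lt_top (ENNReal.rpow_lt_top_of_nonneg hp0 (h.ne_top _ _))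
          (measure_lt_top _ _)

theorem wasserstein_rpow (hp : 1 ≤ p) (P Q : Measure X) :
    wasserstein p d P Q ^ p = ⨅ γ ∈ couplings P Q, ∫⁻ z, d z.1 z.2 ^ p ∂γ :=
  rpow_inv_rpow' hp _

theorem wasserstein_rpow_le (hp : 1 ≤ p) {P Q : Measure X} {γ : Measure (X × X)}
    (hγ : γ ∈ couplings P Q) : wasserstein p d P Q ^ p ≤ ∫⁻ z, d z.1 z.2 ^ p ∂γ := by
  rw [wasserstein_rpow hp]
  exact iInf₂_le γ hγ

theorem wasserstein_le (hp : 1 ≤ p) {P Q : Measure X} {γ : Measure (X × X)}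
    (hγ : γ ∈ couplings P Q) : wasserstein p d P Q ≤ (∫⁻ z, d z.1 z.2 ^ p ∂γ) ^ (1 / p) := by
  rw [← rpow_rpow_inv' hp (wasserstein p d P Q)]
  exact ENNReal.rpow_le_rpow (wasserstein_rpow_le hp hγ) (by positivity)

theorem rpow_le_rpow_iff' (hp : 1 ≤ p) {a b : ℝ≥0∞} : a ^ p ≤ b ^ p ↔ a ≤ b :=
  ENNReal.rpow_le_rpow_iff (by linarith)

theorem le_of_forall_rpow_le_add (hp : 1 ≤ p) {a b : ℝ≥0∞}
    (h : ∀ ε : ℝ≥0∞, 0 < ε → ε ≠ ∞ → a ^ p ≤ b ^ p + ε) : a ≤ b := by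
  rw [← rpow_le_rpow_iff' hp]
  refine ENNReal.le_of_forall_pos_le_add fun ε hε _ => ?_
  exact h ε (by exact_mod_cast hε) ENNReal.coe_ne_top

end Powers

/-! ### Weights on a countable grid -/

/-- Given marginal weights `u`, `v` of mass one and a matrix `c` whose row and column sums are
dominated by `u` and `v`, the missing mass is distributed independently; the result has marginals
`u` and `v`. -/
noncomputable def completion (c : ℕ → ℕ → ℝ≥0∞) (u v : ℕ → ℝ≥0∞) (i j : ℕ) : ℝ≥0∞ :=
  c i j + (u i - ∑' j, c i j) * (v j - ∑' i, c i j) / (1 - ∑' i, ∑' j, c i j)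

theorem completion_swap (c : ℕ → ℕ → ℝ≥0∞) (u v : ℕ → ℝ≥0∞) (i j : ℕ) :
    completion c u v i j = completion (fun i j => c j i) v u j i := by
  simp only [completion]
  rw [mul_comm (u i - _), ENNReal.tsum_comm]

theorem tsum_residual {c : ℕ → ℕ → ℝ≥0∞} {v : ℕ → ℝ≥0∞} (hv : ∑' j, v j = 1)
    (hc : ∀ j, ∑' i, c i j ≤ v j) :
    ∑' j, (v j - ∑' i, c i j) = 1 - ∑' i, ∑' j, c i j := by
  have h : ∑' j, ∑' i, c i j ≤ 1 := hv ▸ ENNReal.tsum_le_tsum hc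
  rw [ENNReal.tsum_sub (ne_top_of_le_ne_top ENNReal.one_ne_top h) hc, hv, ENNReal.tsum_comm]

/-- If the total mass `∑ c` is one, then the division by zero yields zero, which is the right value
since then no mass is missing. -/
theorem tsum_residual_product {c : ℕ → ℕ → ℝ≥0∞} {u v : ℕ → ℝ≥0∞} (hu : ∑' i, u i = 1)
    (hv : ∑' j, v j = 1) (hr : ∀ i, ∑' j, c i j ≤ u i) (hc : ∀ j, ∑' i, c i j ≤ v j) (i : ℕ) :
    ∑' j, (u i - ∑' j, c i j) * (v j - ∑' i, c i j) / (1 - ∑' i, ∑' j, c i j)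
      = u i - ∑' j, c i j := by
  simp only [div_eq_mul_inv]
  rw [ENNReal.tsum_mul_right, ENNReal.tsum_mul_left, tsum_residual hv hc]
  have hru : ∑' i, (u i - ∑' j, c i j) = 1 - ∑' i, ∑' j, c i j := by
    rw [tsum_residual (c := fun i j => c j i) hu hr, ENNReal.tsum_comm]
  by_cases h0 : 1 - ∑' i, ∑' j, c i j = 0
  · rw [h0, ENNReal.tsum_eq_zero] at hru
    rw [hru i]
    simp
  · rw [mul_assoc, ENNReal.mul_inv_cancel h0 (ne_top_of_le_ne_top ENNReal.one_ne_top tsub_le_self),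
      mul_one]

theorem tsum_completion_right {c : ℕ → ℕ → ℝ≥0∞} {u v : ℕ → ℝ≥0∞} (hu : ∑' i, u i = 1)
    (hv : ∑' j, v j = 1) (hr : ∀ i, ∑' j, c i j ≤ u i) (hc : ∀ j, ∑' i, c i j ≤ v j) (i : ℕ) :
    ∑' j, completion c u v i j = u i := by
  simp only [completion]
  rw [ENNReal.tsum_add, tsum_residual_product hu hv hr hc, add_tsub_cancel_of_le (hr i)]

theorem tsum_completion_left {c : ℕ → ℕ → ℝ≥0∞} {u v : ℕ → ℝ≥0∞} (hu : ∑' i, u i = 1)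
    (hv : ∑' j, v j = 1) (hr : ∀ i, ∑' j, c i j ≤ u i) (hc : ∀ j, ∑' i, c i j ≤ v j) (j : ℕ) :
    ∑' i, completion c u v i j = v j := by
  simp only [completion_swap c u v]
  exact tsum_completion_right hv hu hc hr j

/-- A countable family of weights with `∑ w M < ∞` is approximated from below, in this weighted
sense, by finitely many rational weights. -/
theorem exists_finsupp_rat_approx {ι : Type*} [Countable ι] {w M : ι → ℝ≥0∞}
    (hwM : ∑' i, w i * M i ≠ ∞) (hw : ∀ i, w i ≠ ∞) {η : ℝ≥0∞} (hη : 0 < η) :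
    ∃ c : ι →₀ ℚ, (∀ i, ENNReal.ofReal (c i) ≤ w i) ∧
      ∑' i, (w i - ENNReal.ofReal (c i)) * M i ≤ η := by
  classical
  have hη2 : η / 2 ≠ 0 := (ENNReal.half_pos hη.ne').ne'
  obtain ⟨δ, hδ0, hδ⟩ := ENNReal.exists_pos_sum_of_countable' hη2 ι
  have hpt : ∀ i, ∃ q : ℚ, ENNReal.ofReal q ≤ w i ∧ (w i - ENNReal.ofReal q) * M i ≤ δ i := by
    intro i
    rcases eq_or_ne (w i) 0 with h0 | h0
    · exact ⟨0, by simp, by simp [h0]⟩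
    rcases eq_or_ne (M i) 0 with hM | hM
    · exact ⟨0, by simp, by simp [hM]⟩
    have hMt : M i ≠ ∞ := by
      intro h
      refine ENNReal.ne_top_of_tsum_ne_top hwM i ?_
      rw [h, ENNReal.mul_top h0]
    have hlt : w i - δ i / M i < w i :=
      ENNReal.sub_lt_self (hw i) h0 (ENNReal.div_pos (hδ0 i).ne' hMt).ne'
    obtain ⟨q, -, hq1, hq2⟩ := ENNReal.lt_iff_exists_rat_btwn.1 hlt
    refine ⟨q, hq2.le, ?_⟩
    have h1 : w i - ENNReal.ofReal q ≤ δ i / M i := tsub_le_iff_tsub_le.1 hq1.le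
    calc (w i - ENNReal.ofReal q) * M i ≤ δ i / M i * M i := by gcongr
      _ ≤ δ i := (ENNReal.div_mul_cancel hM hMt).le
  choose q hq1 hq2 using hpt
  have htail := ENNReal.tendsto_tsum_compl_atTop_zero hwM
  obtain ⟨s, hs⟩ := (htail.eventually (gt_mem_nhds (pos_iff_ne_zero.2 hη2))).exists
  refine ⟨Finsupp.onFinset s (fun i => if i ∈ s then q i else 0) (by simp; tauto), fun i => ?_, ?_⟩
  · by_cases hi : i ∈ s <;> simp [hi, hq1 i]
  have hle : ∀ i, (w i - ENNReal.ofReal ((if i ∈ s then q i else 0 : ℚ) : ℝ)) * M i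
      ≤ δ i + (↑s : Set ι)ᶜ.indicator (fun i => w i * M i) i := by
    intro i
    by_cases hi : i ∈ s
    · simp [hi, hq2 i]
    · simp [hi]
  calc _ ≤ ∑' i, (δ i + (↑s : Set ι)ᶜ.indicator (fun i => w i * M i) i) :=
        ENNReal.tsum_le_tsum hle
    _ = ∑' i, δ i + ∑' i, (↑s : Set ι)ᶜ.indicator (fun i => w i * M i) i := ENNReal.tsum_add
    _ ≤ η / 2 + η / 2 := by
        refine add_le_add hδ.le ?_
        rw [← tsum_subtype]
        exact hs.le
    _ = η := ENNReal.add_halves η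

/-! ### Block densities -/

section Block

variable {X : Type} [MeasurableSpace X] {Y : Type} [MeasurableSpace Y]

/-- The density with respect to `P ⊗ Q` of the measure that is a multiple of the product measure
on each cell `{ι = i} × {κ = j}` and has mass `w i j` there. -/
noncomputable def blockDensity (ι : X → ℕ) (κ : Y → ℕ) (w : ℕ → ℕ → ℝ≥0∞) (P : Measure X)
    (Q : Measure Y) (a : X) (b : Y) : ℝ≥0∞ :=
  w (ι a) (κ b) / (P (ι ⁻¹' {ι a}) * Q (κ ⁻¹' {κ b}))

theorem lintegral_comp_nat {κ : Y → ℕ} (hκ : Measurable κ) (Q : Measure Y) (F : ℕ → ℝ≥0∞) :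
    ∫⁻ b, F (κ b) ∂Q = ∑' j, F j * Q (κ ⁻¹' {j}) := by
  rw [← lintegral_map (μ := Q) (f := F) (g := κ) (by fun_prop) hκ, lintegral_countable']
  simp_rw [Measure.map_apply hκ (measurableSet_singleton _)]

theorem tsum_measure_fiber {κ : Y → ℕ} (hκ : Measurable κ) (Q : Measure Y)
    [IsProbabilityMeasure Q] : ∑' j, Q (κ ⁻¹' {j}) = 1 := by
  have := lintegral_comp_nat hκ Q (fun _ => 1)
  simpa using this.symm

theorem ae_measure_fiber_ne_zero (ι : X → ℕ) (P : Measure X) :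
    ∀ᵐ a ∂P, P (ι ⁻¹' {ι a}) ≠ 0 := by
  have h : ∀ i : ℕ, ∀ᵐ a ∂P, ι a = i → P (ι ⁻¹' {ι a}) ≠ 0 := by
    intro i
    by_cases h0 : P (ι ⁻¹' {i}) = 0
    · filter_upwards [compl_mem_ae_iff.2 h0] with a ha hai
      exact absurd hai ha
    · exact Eventually.of_forall fun a ha => by rwa [ha]
  filter_upwards [ae_all_iff.2 h] with a ha using ha _ rfl

/-- The bounds on `w` take care of the convention `0 / 0 = 0`: if a cell is a null set, then its
weight vanishes. -/
theorem mul_div_cancel_of_le {w u v : ℝ≥0∞} (hu : u ≠ ∞) (hv : v ≠ ∞) (hwu : w ≤ u)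
    (hwv : w ≤ v) : w / (u * v) * v * u = w := by
  rcases eq_or_ne u 0 with h | hu0
  · have : w = 0 := le_antisymm (h ▸ hwu) bot_le
    simp [this]
  rcases eq_or_ne v 0 with h | hv0
  · have : w = 0 := le_antisymm (h ▸ hwv) bot_le
    simp [this]
  rw [mul_assoc, mul_comm v u]
  exact ENNReal.div_mul_cancel (mul_ne_zero hu0 hv0) (ENNReal.mul_ne_top hu hv)

variable {ι : X → ℕ} {κ : Y → ℕ} {w : ℕ → ℕ → ℝ≥0∞} {P : Measure X} {Q : Measure Y}

theorem blockDensity_swap (a : X) (b : Y) :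
    blockDensity ι κ w P Q a b = blockDensity κ ι (fun i j => w j i) Q P b a := by
  simp only [blockDensity]
  rw [mul_comm]

variable [IsProbabilityMeasure P] [IsProbabilityMeasure Q]

/-- The block density has the marginal `P` because the weights have the row sums `P {ι = i}`. -/
theorem lintegral_blockDensity_right (hκ : Measurable κ)
    (hr : ∀ i, ∑' j, w i j = P (ι ⁻¹' {i})) (hc : ∀ j, ∑' i, w i j = Q (κ ⁻¹' {j})) {a : X}
    (ha : P (ι ⁻¹' {ι a}) ≠ 0) : ∫⁻ b, blockDensity ι κ w P Q a b ∂Q = 1 := by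
  have h1 := lintegral_comp_nat hκ Q
    (fun j => w (ι a) j / (P (ι ⁻¹' {ι a}) * Q (κ ⁻¹' {j})))
  have h2 : ∀ j, w (ι a) j / (P (ι ⁻¹' {ι a}) * Q (κ ⁻¹' {j})) * Q (κ ⁻¹' {j})
      = w (ι a) j / P (ι ⁻¹' {ι a}) := by
    intro j
    rw [ENNReal.eq_div_iff ha (measure_ne_top _ _), mul_comm]
    exact mul_div_cancel_of_le (measure_ne_top _ _) (measure_ne_top _ _)
      (hr (ι a) ▸ ENNReal.le_tsum j) (hc j ▸ ENNReal.le_tsum (f := fun i => w i j) (ι a))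
  unfold blockDensity
  rw [h1]
  simp_rw [h2, div_eq_mul_inv]
  rw [ENNReal.tsum_mul_right, hr, ENNReal.mul_inv_cancel ha (measure_ne_top _ _)]

theorem lintegral_blockDensity_left (hι : Measurable ι)
    (hr : ∀ i, ∑' j, w i j = P (ι ⁻¹' {i})) (hc : ∀ j, ∑' i, w i j = Q (κ ⁻¹' {j})) {b : Y}
    (hb : Q (κ ⁻¹' {κ b}) ≠ 0) : ∫⁻ a, blockDensity ι κ w P Q a b ∂P = 1 := by
  simp only [blockDensity_swap _ b]
  exact lintegral_blockDensity_right hι hc hr hb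

theorem lintegral_lintegral_blockDensity_mul (hι : Measurable ι) (hκ : Measurable κ)
    (hr : ∀ i, ∑' j, w i j = P (ι ⁻¹' {i})) (hc : ∀ j, ∑' i, w i j = Q (κ ⁻¹' {j}))
    (D : ℕ → ℕ → ℝ≥0∞) :
    ∫⁻ a, ∫⁻ b, blockDensity ι κ w P Q a b * D (ι a) (κ b) ∂Q ∂P = ∑' i, ∑' j, w i j * D i j := by
  unfold blockDensity
  have h1 := fun a => lintegral_comp_nat hκ Q
    (fun j => w (ι a) j / (P (ι ⁻¹' {ι a}) * Q (κ ⁻¹' {j})) * D (ι a) j)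
  simp_rw [h1]
  have h2 := lintegral_comp_nat hι P (fun i => ∑' j,
    w i j / (P (ι ⁻¹' {i}) * Q (κ ⁻¹' {j})) * D i j * Q (κ ⁻¹' {j}))
  rw [h2]
  refine tsum_congr fun i => ?_
  rw [← ENNReal.tsum_mul_right]
  refine tsum_congr fun j => ?_
  have h3 := mul_div_cancel_of_le (measure_ne_top P (ι ⁻¹' {i})) (measure_ne_top Q (κ ⁻¹' {j}))
    (hr i ▸ ENNReal.le_tsum j) (hc j ▸ ENNReal.le_tsum (f := fun i => w i j) i)
  calc _ = w i j / (P (ι ⁻¹' {i}) * Q (κ ⁻¹' {j})) * Q (κ ⁻¹' {j}) * P (ι ⁻¹' {i}) * D i j := by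
        rw [mul_right_comm]; simp only [mul_comm, mul_left_comm]
    _ = w i j * D i j := by rw [h3]

end Block

/-! ### Couplings given by densities -/

section Density

variable {X Y : Type} [MeasurableSpace X] [MeasurableSpace Y]

/-- The measure with density `h` with respect to `P ⊗ Q` is a coupling as soon as both partial
integrals of `h` are one. -/
theorem withDensity_mem_couplings {P : Measure X} {Q : Measure Y} [SFinite P] [SFinite Q]
    {h : X → Y → ℝ≥0∞} (hm : Measurable (Function.uncurry h))
    (h₁ : ∀ᵐ a ∂P, ∫⁻ b, h a b ∂Q = 1) (h₂ : ∀ᵐ b ∂Q, ∫⁻ a, h a b ∂P = 1) :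
    (P.prod Q).withDensity (Function.uncurry h) ∈ couplings P Q := by
  constructor
  · ext A hA
    rw [Measure.map_apply measurable_fst hA, withDensity_apply _ (measurable_fst hA),
      ← lintegral_indicator (measurable_fst hA),
      lintegral_prod _ (hm.indicator (measurable_fst hA)).aemeasurable,
      ← lintegral_indicator_one hA]
    refine lintegral_congr_ae ?_
    filter_upwards [h₁] with a ha
    by_cases haA : a ∈ A
    · simp [Set.indicator, haA, Function.uncurry, ha]
    · simp [Set.indicator, haA]
  · ext A hA
    rw [Measure.map_apply measurable_snd hA, withDensity_apply _ (measurable_snd hA),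
      ← lintegral_indicator (measurable_snd hA),
      lintegral_prod_symm _ (hm.indicator (measurable_snd hA)).aemeasurable,
      ← lintegral_indicator_one hA]
    refine lintegral_congr_ae ?_
    filter_upwards [h₂] with a ha
    by_cases haA : a ∈ A
    · simp [Set.indicator, haA, Function.uncurry, ha]
    · simp [Set.indicator, haA]

theorem lintegral_withDensity_prod {P : Measure X} {Q : Measure Y} [SFinite P] [SFinite Q]
    {h f : X → Y → ℝ≥0∞} (hm : Measurable (Function.uncurry h))
    (hf : Measurable (Function.uncurry f)) :
    ∫⁻ z, f z.1 z.2 ∂(P.prod Q).withDensity (Function.uncurry h)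
      = ∫⁻ a, ∫⁻ b, h a b * f a b ∂Q ∂P := by
  change ∫⁻ z, Function.uncurry f z ∂(P.prod Q).withDensity (Function.uncurry h) = _
  rw [lintegral_withDensity_eq_lintegral_mul _ hm hf, lintegral_prod _ (hm.mul hf).aemeasurable]
  rfl

end Density

/-- Block densities are jointly measurable in the marginals and the points if their weights are
measurable in the marginals. -/
theorem measurable_blockDensity {X Y : Type} [MeasurableSpace X] [MeasurableSpace Y] {ι : X → ℕ}
    {κ : Y → ℕ} (hι : Measurable ι) (hκ : Measurable κ)
    {w : Measure X → Measure Y → ℕ → ℕ → ℝ≥0∞}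
    (hw : ∀ i j, Measurable fun z : Measure X × Measure Y => w z.1 z.2 i j) :
    Measurable fun z : (Measure X × Measure Y) × X × Y =>
      blockDensity ι κ (w z.1.1 z.1.2) z.1.1 z.1.2 z.2.1 z.2.2 := by
  let F : (ℕ × ℕ) × Measure X × Measure Y → ℝ≥0∞ := fun z =>
    w z.2.1 z.2.2 z.1.1 z.1.2 / (z.2.1 (ι ⁻¹' {z.1.1}) * z.2.2 (κ ⁻¹' {z.1.2}))
  have hF : Measurable F := by
    refine measurable_from_prod_countable_right fun q => ?_
    have hP : Measurable fun z : Measure X × Measure Y => z.1 (ι ⁻¹' {q.1}) :=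
      (Measure.measurable_coe (hι (measurableSet_singleton _))).comp measurable_fst
    have hQ : Measurable fun z : Measure X × Measure Y => z.2 (κ ⁻¹' {q.2}) :=
      (Measure.measurable_coe (hκ (measurableSet_singleton _))).comp measurable_snd
    exact (hw q.1 q.2).div (hP.mul hQ)
  let G : (Measure X × Measure Y) × X × Y → (ℕ × ℕ) × Measure X × Measure Y := fun z =>
    ((ι z.2.1, κ z.2.2), z.1)
  have hG : Measurable G := by
    refine (Measurable.prodMk ?_ ?_).prodMk measurable_fst
    · exact hι.comp (measurable_fst.comp measurable_snd)
    · exact hκ.comp (measurable_snd.comp measurable_snd)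
  exact hF.comp hG

/-! ### Transport plans on a grid -/

section Grid

variable {X : Type} [mX : MeasurableSpace X] {d : X → X → ℝ≥0∞}

/-- The first index `n` such that `x` has distance less than `r` to `s n`. -/
noncomputable def cellIndex (d : X → X → ℝ≥0∞) (s : ℕ → X) (r : ℝ≥0∞) (x : X) : ℕ :=
  sInf {n | d x (s n) < r}

theorem dist_cellIndex_lt {X : Type} {d : X → X → ℝ≥0∞} {s : ℕ → X}
    (hs : ∀ x, ∀ ε, 0 < ε → ∃ n, d x (s n) < ε) {r : ℝ≥0∞} (hr : 0 < r) (x : X) :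
    d x (s (cellIndex d s r x)) < r :=
  Nat.sInf_mem (s := {n | d x (s n) < r}) (hs x r hr)

theorem measurable_cellIndex (h : IsSepDist d) {s : ℕ → X}
    (hs : ∀ x, ∀ ε, 0 < ε → ∃ n, d x (s n) < ε) {r : ℝ≥0∞} (hr : 0 < r) :
    Measurable (cellIndex d s r) := by
  classical
  have : cellIndex d s r = fun x => Nat.find (hs x r hr) := by
    ext x
    rw [cellIndex, Nat.sInf_def (s := {n | d x (s n) < r}) (hs x r hr)]
    congr
  rw [this]
  refine measurable_find _ fun k => ?_
  exact measurableSet_lt (h.measurable_comp measurable_id measurable_const) measurable_const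

/-- A candidate transport plan: a mesh and a matrix with finitely many nonzero rational entries. The
candidates form a countable set. -/
abbrev GridPlan : Type := ℕ × (ℕ × ℕ →₀ ℚ)

/-- The mesh size of a candidate. -/
noncomputable def GridPlan.radius (κ : GridPlan) : ℝ≥0∞ := ((κ.1 : ℝ≥0∞) + 1)⁻¹

theorem GridPlan.radius_pos (κ : GridPlan) : 0 < κ.radius :=
  ENNReal.inv_pos.2 (ENNReal.add_ne_top.2 ⟨ENNReal.natCast_ne_top _, ENNReal.one_ne_top⟩)

/-- The entries of the matrix of a candidate. -/
noncomputable def GridPlan.entry (κ : GridPlan) (i j : ℕ) : ℝ≥0∞ := ENNReal.ofReal (κ.2 (i, j))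

/-- The cell of a point in the partition belonging to a candidate. -/
noncomputable def GridPlan.index (d : X → X → ℝ≥0∞) (s : ℕ → X) (κ : GridPlan) : X → ℕ :=
  cellIndex d s κ.radius

/-- The matrix of the candidate `κ` is dominated by the marginals `P` and `Q`. -/
def GridPlan.Feasible (d : X → X → ℝ≥0∞) (s : ℕ → X) (κ : GridPlan) (P Q : Measure X) : Prop :=
  (∀ i, ∑' j, κ.entry i j ≤ P (κ.index d s ⁻¹' {i})) ∧
  (∀ j, ∑' i, κ.entry i j ≤ Q (κ.index d s ⁻¹' {j}))

/-- The weights of the cells in the plan given by `κ`. -/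
noncomputable def GridPlan.weight (d : X → X → ℝ≥0∞) (s : ℕ → X) (κ : GridPlan)
    (P Q : Measure X) : ℕ → ℕ → ℝ≥0∞ :=
  completion κ.entry (fun i => P (κ.index d s ⁻¹' {i})) (fun j => Q (κ.index d s ⁻¹' {j}))

/-- The density of the plan given by `κ`. -/
noncomputable def GridPlan.density (d : X → X → ℝ≥0∞) (s : ℕ → X) (κ : GridPlan)
    (P Q : Measure X) : X → X → ℝ≥0∞ :=
  blockDensity (κ.index d s) (κ.index d s) (κ.weight d s P Q) P Q

/-- An upper bound for the cost of the plan given by `κ`, computed from the distances of the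
centres of the cells. -/
noncomputable def GridPlan.cost (p : ℝ) (d : X → X → ℝ≥0∞) (s : ℕ → X) (κ : GridPlan)
    (P Q : Measure X) : ℝ≥0∞ :=
  ∑' i, ∑' j, κ.weight d s P Q i j * (d (s i) (s j) + 2 * κ.radius) ^ p

variable (h : IsSepDist d) {s : ℕ → X} (hs : ∀ x, ∀ ε, 0 < ε → ∃ n, d x (s n) < ε)
include h hs

theorem GridPlan.measurable_index (κ : GridPlan) : Measurable (κ.index d s) :=
  measurable_cellIndex h hs κ.radius_pos

theorem GridPlan.measurable_weight (κ : GridPlan) (i j : ℕ) :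
    Measurable fun z : Measure X × Measure X => κ.weight d s z.1 z.2 i j := by
  have hP : Measurable fun z : Measure X × Measure X => z.1 (κ.index d s ⁻¹' {i}) :=
    (Measure.measurable_coe (κ.measurable_index h hs (measurableSet_singleton i))).comp
      measurable_fst
  have hQ : Measurable fun z : Measure X × Measure X => z.2 (κ.index d s ⁻¹' {j}) :=
    (Measure.measurable_coe (κ.measurable_index h hs (measurableSet_singleton j))).comp
      measurable_snd
  unfold GridPlan.weight completion
  fun_prop

theorem GridPlan.measurable_cost (p : ℝ) (κ : GridPlan) :
    Measurable fun z : Measure X × Measure X => κ.cost p d s z.1 z.2 := by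
  unfold GridPlan.cost
  exact Measurable.tsum fun i => Measurable.tsum fun j =>
    (κ.measurable_weight h hs i j).mul_const _

theorem GridPlan.measurableSet_feasible (κ : GridPlan) :
    MeasurableSet {z : Measure X × Measure X | κ.Feasible d s z.1 z.2} := by
  have hP : ∀ i, Measurable fun z : Measure X × Measure X => z.1 (κ.index d s ⁻¹' {i}) := fun i =>
    (Measure.measurable_coe (κ.measurable_index h hs (measurableSet_singleton i))).comp
      measurable_fst
  have hQ : ∀ j, Measurable fun z : Measure X × Measure X => z.2 (κ.index d s ⁻¹' {j}) := fun j =>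
    (Measure.measurable_coe (κ.measurable_index h hs (measurableSet_singleton j))).comp
      measurable_snd
  simp only [GridPlan.Feasible, Set.ofPred_and, Set.ofPred_forall]
  refine MeasurableSet.inter (MeasurableSet.iInter fun i => ?_) (MeasurableSet.iInter fun j => ?_)
  · exact measurableSet_le measurable_const (hP i)
  · exact measurableSet_le measurable_const (hQ j)

theorem GridPlan.measurable_density (κ : GridPlan) :
    Measurable fun z : (Measure X × Measure X) × X × X =>
      κ.density d s z.1.1 z.1.2 z.2.1 z.2.2 := by
  have hι := κ.measurable_index h hs
  exact measurable_blockDensity hι hι (κ.measurable_weight h hs)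

theorem GridPlan.measurable_density_fixed (κ : GridPlan) (P Q : Measure X) :
    Measurable (Function.uncurry (κ.density d s P Q)) := by
  have := (κ.measurable_density h hs).comp
    (measurable_const (a := (P, Q)).prodMk (measurable_id (α := X × X)))
  simpa [Function.comp_def, Function.uncurry_def] using this

variable {P Q : Measure X} [IsProbabilityMeasure P] [IsProbabilityMeasure Q]

theorem GridPlan.tsum_weight_right {κ : GridPlan} (hκ : κ.Feasible d s P Q) (i : ℕ) :
    ∑' j, κ.weight d s P Q i j = P (κ.index d s ⁻¹' {i}) :=
  have hι := κ.measurable_index h hs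
  tsum_completion_right (tsum_measure_fiber hι P) (tsum_measure_fiber hι Q) hκ.1 hκ.2 i

theorem GridPlan.tsum_weight_left {κ : GridPlan} (hκ : κ.Feasible d s P Q) (j : ℕ) :
    ∑' i, κ.weight d s P Q i j = Q (κ.index d s ⁻¹' {j}) :=
  have hι := κ.measurable_index h hs
  tsum_completion_left (tsum_measure_fiber hι P) (tsum_measure_fiber hι Q) hκ.1 hκ.2 j

theorem GridPlan.ae_lintegral_density_right {κ : GridPlan} (hκ : κ.Feasible d s P Q) :
    ∀ᵐ a ∂P, ∫⁻ b, κ.density d s P Q a b ∂Q = 1 := by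
  filter_upwards [ae_measure_fiber_ne_zero (κ.index d s) P] with a ha
  exact lintegral_blockDensity_right (κ.measurable_index h hs) (κ.tsum_weight_right h hs hκ)
    (κ.tsum_weight_left h hs hκ) ha

theorem GridPlan.ae_lintegral_density_left {κ : GridPlan} (hκ : κ.Feasible d s P Q) :
    ∀ᵐ b ∂Q, ∫⁻ a, κ.density d s P Q a b ∂P = 1 := by
  filter_upwards [ae_measure_fiber_ne_zero (κ.index d s) Q] with a ha
  exact lintegral_blockDensity_left (κ.measurable_index h hs) (κ.tsum_weight_right h hs hκ)
    (κ.tsum_weight_left h hs hκ) ha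

theorem GridPlan.dist_le (κ : GridPlan) (a b : X) :
    d a b ≤ d (s (κ.index d s a)) (s (κ.index d s b)) + 2 * κ.radius := by
  have ha := (dist_cellIndex_lt hs κ.radius_pos a).le
  have hb := (dist_cellIndex_lt hs κ.radius_pos b).le
  calc d a b ≤ d a (s (κ.index d s a)) + (d (s (κ.index d s a)) (s (κ.index d s b))
        + d (s (κ.index d s b)) b) := (h.triangle _ _ _).trans (by gcongr; exact h.triangle _ _ _)
    _ ≤ κ.radius + (d (s (κ.index d s a)) (s (κ.index d s b)) + κ.radius) := by
        rw [h.comm _ b]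
        exact add_le_add ha (add_le_add le_rfl hb)
    _ = _ := by ring

theorem GridPlan.lintegral_density_le {p : ℝ} (hp : 1 ≤ p) {κ : GridPlan}
    (hκ : κ.Feasible d s P Q) :
    ∫⁻ a, ∫⁻ b, κ.density d s P Q a b * d a b ^ p ∂Q ∂P ≤ κ.cost p d s P Q := by
  have hι := κ.measurable_index h hs
  rw [GridPlan.cost, ← lintegral_lintegral_blockDensity_mul hι hι (κ.tsum_weight_right h hs hκ)
    (κ.tsum_weight_left h hs hκ)]
  refine lintegral_mono fun a => lintegral_mono fun b => ?_
  exact mul_le_mul_right (rpow_le_rpow' hp (κ.dist_le h hs a b)) _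

/-- A feasible candidate yields a coupling. -/
theorem GridPlan.wasserstein_rpow_le_cost {p : ℝ} (hp : 1 ≤ p) {κ : GridPlan}
    (hκ : κ.Feasible d s P Q) : wasserstein p d P Q ^ p ≤ κ.cost p d s P Q := by
  have hm := κ.measurable_density_fixed h hs P Q
  have hc := withDensity_mem_couplings hm (κ.ae_lintegral_density_right h hs hκ)
    (κ.ae_lintegral_density_left h hs hκ)
  refine (wasserstein_rpow_le hp hc).trans ?_
  rw [lintegral_withDensity_prod hm (f := fun a b => d a b ^ p) (h.measurable.pow_const p)]
  exact κ.lintegral_density_le h hs hp hκ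

end Grid

/-! ### Approximation of the Wasserstein distance by grid plans -/

theorem isProbabilityMeasure_of_mem_couplings {X Y : Type} [MeasurableSpace X] [MeasurableSpace Y]
    {P : Measure X} {Q : Measure Y} [IsProbabilityMeasure P] {γ : Measure (X × Y)}
    (hγ : γ ∈ couplings P Q) : IsProbabilityMeasure γ := by
  refine ⟨?_⟩
  rw [← Set.preimage_univ (f := Prod.fst), ← Measure.map_apply measurable_fst MeasurableSet.univ,
    hγ.1]
  exact measure_univ

theorem lintegral_fst_of_mem_couplings {X Y : Type} [MeasurableSpace X] [MeasurableSpace Y]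
    {P : Measure X} {Q : Measure Y} {γ : Measure (X × Y)} (hγ : γ ∈ couplings P Q)
    {f : X → ℝ≥0∞} (hf : Measurable f) : ∫⁻ z, f z.1 ∂γ = ∫⁻ x, f x ∂P := by
  rw [← hγ.1, lintegral_map hf measurable_fst]

theorem lintegral_snd_of_mem_couplings {X Y : Type} [MeasurableSpace X] [MeasurableSpace Y]
    {P : Measure X} {Q : Measure Y} {γ : Measure (X × Y)} (hγ : γ ∈ couplings P Q)
    {f : Y → ℝ≥0∞} (hf : Measurable f) : ∫⁻ z, f z.2 ∂γ = ∫⁻ y, f y ∂Q := by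
  rw [← hγ.2, lintegral_map hf measurable_snd]

theorem lintegral_add_of_mem_couplings {X Y : Type} [MeasurableSpace X] [MeasurableSpace Y]
    {P : Measure X} {Q : Measure Y} {γ : Measure (X × Y)} (hγ : γ ∈ couplings P Q)
    {f : X → ℝ≥0∞} {g : Y → ℝ≥0∞} (hf : Measurable f) (hg : Measurable g) :
    ∫⁻ z, f z.1 + g z.2 ∂γ = ∫⁻ x, f x ∂P + ∫⁻ y, g y ∂Q := by
  rw [lintegral_add_left (f := fun z : X × Y => f z.1) (hf.comp measurable_fst),
    lintegral_fst_of_mem_couplings hγ hf, lintegral_snd_of_mem_couplings hγ hg]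

/-- Reducing a matrix `w` with marginals `u`, `v` to `c ≤ w` and completing it again increases the
cost at most by the cost of the mass removed. -/
theorem tsum_completion_mul_le {c w D : ℕ → ℕ → ℝ≥0∞} {u v M : ℕ → ℝ≥0∞} (hu : ∑' i, u i = 1)
    (hv : ∑' j, v j = 1) (hcw : ∀ i j, c i j ≤ w i j) (hr : ∀ i, ∑' j, w i j = u i)
    (hc : ∀ j, ∑' i, w i j = v j) (hD : ∀ i j, D i j ≤ M i + M j) :
    ∑' i, ∑' j, completion c u v i j * D i j
      ≤ ∑' i, ∑' j, w i j * D i j + ∑' i, ∑' j, (w i j - c i j) * (M i + M j) := by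
  have hr' : ∀ i, ∑' j, c i j ≤ u i := fun i => hr i ▸ ENNReal.tsum_le_tsum (hcw i)
  have hc' : ∀ j, ∑' i, c i j ≤ v j := fun j => hc j ▸ ENNReal.tsum_le_tsum fun i => hcw i j
  have hut : ∀ i, u i ≠ ∞ := fun i =>
    ne_top_of_le_ne_top (hu ▸ ENNReal.one_ne_top) (ENNReal.le_tsum i)
  have hvt : ∀ i, v i ≠ ∞ := fun i =>
    ne_top_of_le_ne_top (hv ▸ ENNReal.one_ne_top) (ENNReal.le_tsum i)
  have hsu : ∀ i, u i - ∑' j, c i j = ∑' j, (w i j - c i j) := fun i => by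
    rw [ENNReal.tsum_sub (ne_top_of_le_ne_top (hut i) (hr' i)) (hcw i), hr]
  have hsv : ∀ j, v j - ∑' i, c i j = ∑' i, (w i j - c i j) := fun j => by
    rw [ENNReal.tsum_sub (ne_top_of_le_ne_top (hvt j) (hc' j)) (fun i => hcw i j), hc]
  set R : ℕ → ℕ → ℝ≥0∞ := fun i j =>
    (u i - ∑' j, c i j) * (v j - ∑' i, c i j) / (1 - ∑' i, ∑' j, c i j) with hR
  have hR1 : ∀ i, ∑' j, R i j = ∑' j, (w i j - c i j) := fun i => by
    rw [← hsu]; exact tsum_residual_product hu hv hr' hc' i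
  have hR2 : ∀ j, ∑' i, R i j = ∑' i, (w i j - c i j) := fun j => by
    rw [← hsv, ← tsum_residual_product (c := fun i j => c j i) hv hu hc' hr' j]
    refine tsum_congr fun i => ?_
    simp only [hR]
    rw [mul_comm, ENNReal.tsum_comm]
  have hres : ∑' i, ∑' j, R i j * D i j ≤ ∑' i, ∑' j, (w i j - c i j) * (M i + M j) := by
    calc ∑' i, ∑' j, R i j * D i j ≤ ∑' i, ∑' j, (R i j * M i + R i j * M j) := by
          gcongr with i j
          rw [← mul_add]
          exact mul_le_mul_right (hD i j) _
      _ = ∑' i, (∑' j, R i j) * M i + ∑' j, (∑' i, R i j) * M j := by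
          simp_rw [ENNReal.tsum_add]
          congr 1
          · simp_rw [ENNReal.tsum_mul_right]
          · rw [ENNReal.tsum_comm]
            simp_rw [ENNReal.tsum_mul_right]
      _ = ∑' i, ∑' j, (w i j - c i j) * (M i + M j) := by
          simp_rw [hR1, hR2, mul_add, ENNReal.tsum_add]
          congr 1
          · simp_rw [ENNReal.tsum_mul_right]
          · rw [ENNReal.tsum_comm (f := fun i j => (w i j - c i j) * M j)]
            simp_rw [ENNReal.tsum_mul_right]
  calc ∑' i, ∑' j, completion c u v i j * D i j
      = ∑' i, ∑' j, c i j * D i j + ∑' i, ∑' j, R i j * D i j := by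
        simp only [completion, add_mul, ENNReal.tsum_add, hR]
    _ ≤ _ := by
        gcongr with i j
        exact hcw i j

section Approx

variable {X : Type} [mX : MeasurableSpace X] {d : X → X → ℝ≥0∞} {p : ℝ}

theorem IsSepDist.lintegral_coupling_lt_top (h : IsSepDist d) (hp : 1 ≤ p) {P Q : Measure X}
    {x₀ : X} (hP : ∫⁻ x, d x x₀ ^ p ∂P < ∞) (hQ : ∫⁻ x, d x x₀ ^ p ∂Q < ∞)
    {γ : Measure (X × X)} (hγ : γ ∈ couplings P Q) : ∫⁻ z, d z.1 z.2 ^ p ∂γ < ∞ := by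
  have hm : Measurable fun x => d x x₀ ^ p :=
    (h.measurable_comp measurable_id measurable_const).pow_const p
  calc ∫⁻ z, d z.1 z.2 ^ p ∂γ
      ≤ ∫⁻ z, 2 ^ (p - 1) * (d z.1 x₀ ^ p + d z.2 x₀ ^ p) ∂γ := by
        refine lintegral_mono fun z => ?_
        refine (rpow_le_rpow' hp (h.triangle z.1 x₀ z.2)).trans ?_
        rw [h.comm x₀]
        exact rpow_add_le' hp _ _
    _ = 2 ^ (p - 1) * (∫⁻ x, d x x₀ ^ p ∂P + ∫⁻ x, d x x₀ ^ p ∂Q) := by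
        rw [lintegral_const_mul' _ _ (two_rpow_ne_top p),
          lintegral_add_of_mem_couplings hγ hm hm]
    _ < ∞ := ENNReal.mul_lt_top (two_rpow_ne_top p).lt_top (ENNReal.add_lt_top.2 ⟨hP, hQ⟩)

/-- Enlarging the cost `d` by a constant `a` increases the `Lᵖ`-cost at most by `a`. -/
theorem lintegral_add_const_rpow_le (hp : 1 ≤ p) {Ω : Type*} [MeasurableSpace Ω] {γ : Measure Ω}
    [IsProbabilityMeasure γ] {f : Ω → ℝ≥0∞} (hf : Measurable f) (a : ℝ≥0∞) :
    ∫⁻ z, (f z + a) ^ p ∂γ ≤ ((∫⁻ z, f z ^ p ∂γ) ^ (1 / p) + a) ^ p := by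
  have hM := ENNReal.lintegral_Lp_add_le (μ := γ) hf.aemeasurable
    (measurable_const (a := a)).aemeasurable hp
  have h1 : (∫⁻ _, a ^ p ∂γ) ^ (1 / p) = a := by
    rw [lintegral_const, measure_univ, mul_one, rpow_rpow_inv' hp]
  rw [h1] at hM
  rw [← rpow_inv_rpow' hp (∫⁻ z, (f z + a) ^ p ∂γ)]
  exact rpow_le_rpow' hp hM

/-- The constant `4` accounts for the replacement of two points by the centers of their cells and
for the term `2 * κ.radius` in `GridPlan.cost`. -/
theorem exists_radius (hp : 1 ≤ p) {K η : ℝ≥0∞} (hK : K ≠ ∞) (hη : η ≠ 0) :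
    ∃ m : ℕ, (K ^ (1 / p) + 4 * ((m : ℝ≥0∞) + 1)⁻¹) ^ p ≤ K + η := by
  have h0 : Tendsto (fun m : ℕ => ((m : ℝ≥0∞) + 1)⁻¹) atTop (𝓝 0) := by
    have := (tendsto_add_atTop_iff_nat 1).2 ENNReal.tendsto_inv_nat_nhds_zero
    simpa using this
  have h1 : Tendsto (fun m : ℕ => (K ^ (1 / p) + 4 * ((m : ℝ≥0∞) + 1)⁻¹) ^ p) atTop
      (𝓝 ((K ^ (1 / p) + 4 * 0) ^ p)) :=
    (ENNReal.continuous_rpow_const.tendsto _).comp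
      (tendsto_const_nhds.add (ENNReal.Tendsto.const_mul h0 (Or.inr (by simp))))
  rw [mul_zero, add_zero, rpow_inv_rpow' hp] at h1
  obtain ⟨m, hm⟩ := (h1.eventually (gt_mem_nhds (ENNReal.lt_add_right hK hη))).exists
  exact ⟨m, hm.le⟩

variable (h : IsSepDist d) {s : ℕ → X} (hs : ∀ x, ∀ ε, 0 < ε → ∃ n, d x (s n) < ε)
include h hs

theorem lintegral_grid_moment_lt_top (hp : 1 ≤ p) {κ : GridPlan} {P : Measure X}
    [IsProbabilityMeasure P] {x₀ : X} (hP : ∫⁻ x, d x x₀ ^ p ∂P < ∞) :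
    ∫⁻ a, (d (s (κ.index d s a)) x₀ + κ.radius) ^ p ∂P < ∞ := by
  have hr : κ.radius ≠ ∞ := by simp [GridPlan.radius]
  calc ∫⁻ a, (d (s (κ.index d s a)) x₀ + κ.radius) ^ p ∂P
      ≤ ∫⁻ a, (d a x₀ + (κ.radius + κ.radius)) ^ p ∂P := by
        refine lintegral_mono fun a => rpow_le_rpow' hp ?_
        rw [← add_assoc]
        gcongr
        rw [add_comm]
        refine (h.triangle _ a _).trans (add_le_add ?_ le_rfl)
        rw [h.comm]
        exact (dist_cellIndex_lt hs κ.radius_pos a).le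
    _ ≤ _ := lintegral_add_const_rpow_le hp (h.measurable_comp measurable_id measurable_const) _
    _ < ∞ := by
        refine ENNReal.rpow_lt_top_of_nonneg (by linarith) (ENNReal.add_ne_top.2 ⟨?_, ?_⟩)
        · exact ENNReal.rpow_ne_top_of_nonneg (by positivity) hP.ne
        · exact ENNReal.add_ne_top.2 ⟨hr, hr⟩

/-- The cost of every coupling is approximated from above by the cost of a grid plan: its
cell masses are rounded to finitely many rational numbers, and the mass lost is
redistributed. -/
theorem exists_gridPlan (hp : 1 ≤ p) {P Q : Measure X} [IsProbabilityMeasure P]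
    [IsProbabilityMeasure Q] {x₀ : X} (hP : ∫⁻ x, d x x₀ ^ p ∂P < ∞)
    (hQ : ∫⁻ x, d x x₀ ^ p ∂Q < ∞) {γ : Measure (X × X)} (hγ : γ ∈ couplings P Q)
    {η : ℝ≥0∞} (hη : η ≠ 0) :
    ∃ κ : GridPlan, κ.Feasible d s P Q ∧
      κ.cost p d s P Q ≤ ∫⁻ z, d z.1 z.2 ^ p ∂γ + η := by
  have hK := (h.lintegral_coupling_lt_top hp hP hQ hγ).ne
  have := isProbabilityMeasure_of_mem_couplings hγ
  have hη2 : η / 2 ≠ 0 := (ENNReal.half_pos hη).ne'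
  obtain ⟨m, hm⟩ := exists_radius hp hK hη2
  set κ₀ : GridPlan := (m, 0)
  set r : ℝ≥0∞ := κ₀.radius with hr
  set ι : X → ℕ := κ₀.index d s with hι'
  have hι : Measurable ι := κ₀.measurable_index h hs
  -- The masses of the cells under `γ`.
  set w : ℕ → ℕ → ℝ≥0∞ := fun i j => γ ((ι ⁻¹' {i}) ×ˢ (ι ⁻¹' {j})) with hw
  have hlint : ∀ F : ℕ → ℕ → ℝ≥0∞, ∫⁻ z, F (ι z.1) (ι z.2) ∂γ = ∑' i, ∑' j, w i j * F i j := by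
    intro F
    have hg : Measurable fun z : X × X => (ι z.1, ι z.2) :=
      (hι.comp measurable_fst).prodMk (hι.comp measurable_snd)
    rw [← lintegral_map (μ := γ) (f := fun q : ℕ × ℕ => F q.1 q.2) (by fun_prop) hg,
      lintegral_countable', ENNReal.tsum_prod']
    refine tsum_congr fun i => tsum_congr fun j => ?_
    rw [Measure.map_apply hg (measurableSet_singleton _), mul_comm]
    congr 2
    ext z
    simp
  have hrow : ∀ i, ∑' j, w i j = P (ι ⁻¹' {i}) := by
    intro i
    rw [← hγ.1, Measure.map_apply measurable_fst (hι (measurableSet_singleton i)), hw]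
    simp only
    rw [← measure_iUnion]
    · congr 1; ext z; simp
    · intro j k hjk
      refine Set.disjoint_left.2 fun z hz hz' => hjk ?_
      exact (hz.2 : ι z.2 = j).symm.trans hz'.2
    · exact fun j => (hι (measurableSet_singleton i)).prod (hι (measurableSet_singleton j))
  have hcol : ∀ j, ∑' i, w i j = Q (ι ⁻¹' {j}) := by
    intro j
    rw [← hγ.2, Measure.map_apply measurable_snd (hι (measurableSet_singleton j)), hw]
    simp only
    rw [← measure_iUnion]
    · congr 1; ext z; simp
    · intro i k hik
      refine Set.disjoint_left.2 fun z hz hz' => hik ?_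
      exact (hz.1 : ι z.1 = i).symm.trans hz'.1
    · exact fun i => (hι (measurableSet_singleton i)).prod (hι (measurableSet_singleton j))
  set D : ℕ → ℕ → ℝ≥0∞ := fun i j => (d (s i) (s j) + 2 * r) ^ p with hD
  set M : ℕ → ℝ≥0∞ := fun i => 2 ^ (p - 1) * (d (s i) x₀ + r) ^ p with hM
  have hDM : ∀ i j, D i j ≤ M i + M j := by
    intro i j
    rw [hM, ← mul_add]
    refine (rpow_le_rpow' hp ?_).trans (rpow_add_le' hp _ _)
    calc d (s i) (s j) + 2 * r ≤ (d (s i) x₀ + d (s j) x₀) + 2 * r := by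
          gcongr; rw [h.comm (s j)]; exact h.triangle _ _ _
      _ = _ := by ring
  have hfin : ∀ {P : Measure X} [IsProbabilityMeasure P], ∫⁻ x, d x x₀ ^ p ∂P < ∞ →
      ∫⁻ a, M (ι a) ∂P < ∞ := by
    intro P _ hP
    simp only [hM]
    rw [lintegral_const_mul' _ _ (two_rpow_ne_top p)]
    exact ENNReal.mul_lt_top (two_rpow_ne_top p).lt_top (lintegral_grid_moment_lt_top h hs hp hP)
  have hMm : Measurable fun a => M (ι a) := (measurable_of_countable M).comp hι
  have hwM : ∑' q : ℕ × ℕ, w q.1 q.2 * (M q.1 + M q.2) ≠ ∞ := by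
    rw [ENNReal.tsum_prod' (f := fun q : ℕ × ℕ => w q.1 q.2 * (M q.1 + M q.2)),
      ← hlint (fun i j => M i + M j), lintegral_add_of_mem_couplings hγ hMm hMm]
    exact (ENNReal.add_lt_top.2 ⟨hfin hP, hfin hQ⟩).ne
  obtain ⟨c, hc1, hc2⟩ := exists_finsupp_rat_approx hwM (fun q => measure_ne_top γ _)
    (pos_iff_ne_zero.2 hη2)
  have hcw : ∀ i j, GridPlan.entry (m, c) i j ≤ w i j := fun i j => hc1 (i, j)
  refine ⟨(m, c), ⟨fun i => ?_, fun j => ?_⟩, ?_⟩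
  · exact (ENNReal.tsum_le_tsum (hcw i)).trans_eq (hrow i)
  · exact (ENNReal.tsum_le_tsum fun i => hcw i j).trans_eq (hcol j)
  have hmain := tsum_completion_mul_le (c := GridPlan.entry (m, c)) (D := D) (M := M)
    (tsum_measure_fiber hι P) (tsum_measure_fiber hι Q) hcw hrow hcol hDM
  refine (hmain : GridPlan.cost p d s (m, c) P Q ≤ _).trans ?_
  rw [← hlint D, ← ENNReal.add_halves η, ← add_assoc]
  refine add_le_add ?_ ?_
  · calc ∫⁻ z, D (ι z.1) (ι z.2) ∂γ ≤ ∫⁻ z, (d z.1 z.2 + 4 * r) ^ p ∂γ := by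
          refine lintegral_mono fun z => rpow_le_rpow' hp ?_
          have ha := (dist_cellIndex_lt hs κ₀.radius_pos z.1).le
          have hb := (dist_cellIndex_lt hs κ₀.radius_pos z.2).le
          calc d (s (ι z.1)) (s (ι z.2)) + 2 * r
              ≤ (d (s (ι z.1)) z.1 + (d z.1 z.2 + d z.2 (s (ι z.2)))) + 2 * r := by
                gcongr
                exact (h.triangle _ z.1 _).trans (by gcongr; exact h.triangle _ _ _)
            _ ≤ (r + (d z.1 z.2 + r)) + 2 * r := by
                rw [h.comm _ z.1]
                exact add_le_add (add_le_add ha (add_le_add le_rfl hb)) le_rfl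
            _ = _ := by ring
      _ ≤ _ := lintegral_add_const_rpow_le hp h.measurable _
      _ ≤ _ := hm
  · rw [ENNReal.tsum_prod'] at hc2
    exact hc2

/-- The infimum of the costs of the grid plans. -/
noncomputable def gridValue {X : Type} [MeasurableSpace X] (p : ℝ) (d : X → X → ℝ≥0∞)
    (s : ℕ → X) (P Q : Measure X) : ℝ≥0∞ :=
  ⨅ κ : GridPlan, ⨅ _ : κ.Feasible d s P Q, κ.cost p d s P Q

theorem measurable_gridValue (p : ℝ) :
    Measurable fun z : Measure X × Measure X => gridValue p d s z.1 z.2 := by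
  classical
  unfold gridValue
  refine Measurable.iInf fun κ => ?_
  have : (fun z : Measure X × Measure X =>
      ⨅ _ : κ.Feasible d s z.1 z.2, κ.cost p d s z.1 z.2) = fun z =>
      if κ.Feasible d s z.1 z.2 then κ.cost p d s z.1 z.2 else ∞ := by
    ext z
    by_cases hz : κ.Feasible d s z.1 z.2 <;> simp [hz]
  rw [this]
  exact Measurable.ite (κ.measurableSet_feasible h hs) (κ.measurable_cost h hs p) measurable_const

/-- The infimum over the countably many grid plans is the infimum over all couplings. -/
theorem gridValue_eq (hp : 1 ≤ p) {P Q : Measure X} [IsProbabilityMeasure P]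
    [IsProbabilityMeasure Q] {x₀ : X} (hP : ∫⁻ x, d x x₀ ^ p ∂P < ∞)
    (hQ : ∫⁻ x, d x x₀ ^ p ∂Q < ∞) : gridValue p d s P Q = wasserstein p d P Q ^ p := by
  refine le_antisymm ?_ (le_iInf₂ fun κ hκ => κ.wasserstein_rpow_le_cost h hs hp hκ)
  rw [wasserstein_rpow hp]
  refine le_iInf₂ fun γ hγ => ENNReal.le_of_forall_pos_le_add fun η hη _ => ?_
  obtain ⟨κ, hκ, hcost⟩ := exists_gridPlan h hs hp hP hQ hγ
    (η := η) (by exact_mod_cast hη.ne')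
  exact (iInf₂_le κ hκ).trans hcost

end Approx

/-! ### Selection of almost optimal couplings -/

theorem measurable_of_index {T : Type*} [MeasurableSpace T] {N : T → ℕ} (hN : Measurable N)
    {F : ℕ → T → ℝ≥0∞} (hF : ∀ n, Measurable (F n)) : Measurable fun t => F (N t) t := by
  have : Measurable fun z : ℕ × T => F z.1 z.2 := measurable_from_prod_countable_right hF
  exact this.comp (hN.prodMk measurable_id)

section Selection

variable {X : Type} [mX : MeasurableSpace X] {d : X → X → ℝ≥0∞} {p : ℝ}

/-- **Measurable selection of almost optimal couplings.** There are densities `f P Q` with respect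
to `P ⊗ Q`, jointly measurable in the marginals and the points, that define couplings of `P` and
`Q` whose cost is optimal up to `ε`. One takes the first almost optimal grid plan in an
enumeration. -/
theorem IsSepDist.exists_density_selection (h : IsSepDist d) (hp : 1 ≤ p) {ε : ℝ≥0∞}
    (hε : ε ≠ 0) :
    ∃ f : Measure X → Measure X → X → X → ℝ≥0∞,
      (Measurable fun z : (Measure X × Measure X) × X × X => f z.1.1 z.1.2 z.2.1 z.2.2) ∧
      (∀ (P Q : Measure X) [IsProbabilityMeasure P] [IsProbabilityMeasure Q],
        (∀ᵐ a ∂P, ∫⁻ b, f P Q a b ∂Q = 1) ∧ (∀ᵐ b ∂Q, ∫⁻ a, f P Q a b ∂P = 1)) ∧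
      (∀ (P Q : Measure X) [IsProbabilityMeasure P] [IsProbabilityMeasure Q] (x₀ : X),
        ∫⁻ x, d x x₀ ^ p ∂P < ∞ → ∫⁻ x, d x x₀ ^ p ∂Q < ∞ →
        ∫⁻ a, ∫⁻ b, f P Q a b * d a b ^ p ∂Q ∂P ≤ wasserstein p d P Q ^ p + ε) := by
  classical
  obtain ⟨s, hs⟩ := h.dense
  obtain ⟨e, he⟩ := exists_surjective_nat GridPlan
  have hex : ∀ z : Measure X × Measure X, ∃ n, (e n).Feasible d s z.1 z.2 ∧
      (e n).cost p d s z.1 z.2 ≤ gridValue p d s z.1 z.2 + ε := by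
    intro z
    rcases eq_or_ne (gridValue p d s z.1 z.2) ∞ with hV | hV
    -- Here the cost is irrelevant; the zero matrix is feasible and gives the product coupling.
    · obtain ⟨n, hn⟩ := he (0, 0)
      refine ⟨n, ?_, by simp [hV]⟩
      rw [hn]
      constructor <;> simp [GridPlan.entry]
    · have hlt : gridValue p d s z.1 z.2 < gridValue p d s z.1 z.2 + ε :=
        ENNReal.lt_add_right hV hε
      obtain ⟨κ, hκ⟩ := iInf_lt_iff.1 (hlt.trans_eq' (by rw [gridValue]))
      obtain ⟨hf, hc⟩ := iInf_lt_iff.1 hκ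
      obtain ⟨n, rfl⟩ := he κ
      exact ⟨n, hf, hc.le⟩
  obtain ⟨N, hN, hNspec⟩ : ∃ N : Measure X × Measure X → ℕ, Measurable N ∧ ∀ z : _ × _,
      (e (N z)).Feasible d s z.1 z.2 ∧
        (e (N z)).cost p d s z.1 z.2 ≤ gridValue p d s z.1 z.2 + ε := by
    refine ⟨fun z => Nat.find (hex z), measurable_find _ fun n => ?_,
      fun z => Nat.find_spec (hex z)⟩
    exact ((e n).measurableSet_feasible h hs).inter
      (measurableSet_le ((e n).measurable_cost h hs p)
        ((measurable_gridValue h hs p).add_const ε))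
  refine ⟨fun P Q => (e (N (P, Q))).density d s P Q, ?_, fun P Q _ _ => ⟨?_, ?_⟩, ?_⟩
  · have hD : ∀ n, Measurable fun z : (Measure X × Measure X) × X × X =>
        (e n).density d s z.1.1 z.1.2 z.2.1 z.2.2 := fun n => (e n).measurable_density h hs
    have hN' : Measurable fun z : (Measure X × Measure X) × X × X => N z.1 :=
      hN.comp measurable_fst
    have := measurable_of_index hN' hD
    simpa only [Prod.mk.eta] using this
  · exact (e (N (P, Q))).ae_lintegral_density_right h hs (hNspec (P, Q)).1
  · exact (e (N (P, Q))).ae_lintegral_density_left h hs (hNspec (P, Q)).1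
  · intro P Q _ _ x₀ hP hQ
    rw [← gridValue_eq h hs hp hP hQ]
    exact ((e (N (P, Q))).lintegral_density_le h hs hp (hNspec (P, Q)).1).trans (hNspec (P, Q)).2

/-- The Wasserstein distance is measurable in both marginals for the `σ`-algebra generated by the
evaluations `P ↦ P A`, up to its values at measures without finite moments. -/
theorem IsSepDist.exists_measurable_eq_wasserstein (h : IsSepDist d) (hp : 1 ≤ p) :
    ∃ V : Measure X → Measure X → ℝ≥0∞, (Measurable fun z : Measure X × Measure X => V z.1 z.2) ∧
      ∀ (P Q : Measure X) [IsProbabilityMeasure P] [IsProbabilityMeasure Q] (x₀ : X),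
        ∫⁻ x, d x x₀ ^ p ∂P < ∞ → ∫⁻ x, d x x₀ ^ p ∂Q < ∞ → V P Q = wasserstein p d P Q := by
  obtain ⟨s, hs⟩ := h.dense
  refine ⟨fun P Q => gridValue p d s P Q ^ (1 / p), (measurable_gridValue h hs p).pow_const _,
    fun P Q _ _ x₀ hP hQ => ?_⟩
  simp only
  rw [gridValue_eq h hs hp hP hQ, rpow_rpow_inv' hp]

/-- Almost optimal couplings with densities, for fixed marginals. -/
theorem IsSepDist.exists_density (h : IsSepDist d) (hp : 1 ≤ p) {P Q : Measure X}
    [IsProbabilityMeasure P] [IsProbabilityMeasure Q] {x₀ : X} (hP : ∫⁻ x, d x x₀ ^ p ∂P < ∞)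
    (hQ : ∫⁻ x, d x x₀ ^ p ∂Q < ∞) {ε : ℝ≥0∞} (hε : ε ≠ 0) :
    ∃ f : X → X → ℝ≥0∞, Measurable (Function.uncurry f) ∧ (∀ᵐ a ∂P, ∫⁻ b, f a b ∂Q = 1) ∧
      (∀ᵐ b ∂Q, ∫⁻ a, f a b ∂P = 1) ∧
      ∫⁻ a, ∫⁻ b, f a b * d a b ^ p ∂Q ∂P ≤ wasserstein p d P Q ^ p + ε := by
  obtain ⟨f, hm, h1, h2⟩ := h.exists_density_selection hp hε
  refine ⟨f P Q, ?_, (h1 P Q).1, (h1 P Q).2, h2 P Q x₀ hP hQ⟩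
  exact hm.comp (measurable_const (a := (P, Q)).prodMk (measurable_id (α := X × X)))

end Selection

/-! ### The Wasserstein metric -/

section Metric

variable {X : Type} [mX : MeasurableSpace X] {d : X → X → ℝ≥0∞} {p : ℝ}

theorem map_swap_mem_couplings {X Y : Type} [MeasurableSpace X] [MeasurableSpace Y]
    {P : Measure X} {Q : Measure Y} {γ : Measure (X × Y)} (hγ : γ ∈ couplings P Q) :
    γ.map Prod.swap ∈ couplings Q P := by
  constructor
  · rw [Measure.map_map measurable_fst measurable_swap]
    exact hγ.2
  · rw [Measure.map_map measurable_snd measurable_swap]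
    exact hγ.1

theorem IsSepDist.wasserstein_comm (h : IsSepDist d) (hp : 1 ≤ p) (P Q : Measure X) :
    wasserstein p d P Q = wasserstein p d Q P := by
  have key : ∀ P Q : Measure X, wasserstein p d P Q ≤ wasserstein p d Q P := by
    intro P Q
    rw [← rpow_le_rpow_iff' hp, wasserstein_rpow hp Q P]
    refine le_iInf₂ fun γ hγ => ?_
    refine (wasserstein_rpow_le hp (map_swap_mem_couplings hγ)).trans_eq ?_
    rw [lintegral_map (h.measurable.pow_const p) measurable_swap]
    simp only [Prod.fst_swap, Prod.snd_swap, h.comm]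
  exact le_antisymm (key P Q) (key Q P)

theorem prod_mem_couplings {X Y : Type} [MeasurableSpace X] [MeasurableSpace Y] (P : Measure X)
    (Q : Measure Y) [IsProbabilityMeasure P] [IsProbabilityMeasure Q] :
    P.prod Q ∈ couplings P Q := by
  constructor
  · exact Measure.map_fst_prod.trans (by simp)
  · exact Measure.map_snd_prod.trans (by simp)

theorem IsSepDist.wasserstein_lt_top (h : IsSepDist d) (hp : 1 ≤ p) {P Q : Measure X}
    [IsProbabilityMeasure P] [IsProbabilityMeasure Q] {x₀ : X} (hP : ∫⁻ x, d x x₀ ^ p ∂P < ∞)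
    (hQ : ∫⁻ x, d x x₀ ^ p ∂Q < ∞) : wasserstein p d P Q < ∞ := by
  have hc := prod_mem_couplings P Q
  refine (wasserstein_le hp hc).trans_lt (ENNReal.rpow_lt_top_of_nonneg (by positivity) ?_)
  exact (h.lintegral_coupling_lt_top hp hP hQ hc).ne

/-- If one marginal of a coupling of finite cost has finite moments, so does the other one. -/
theorem IsSepDist.moment_of_coupling (h : IsSepDist d) (hp : 1 ≤ p) {P Q : Measure X} {x₀ : X}
    (hP : ∫⁻ x, d x x₀ ^ p ∂P < ∞) {γ : Measure (X × X)} (hγ : γ ∈ couplings P Q)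
    (hc : ∫⁻ z, d z.1 z.2 ^ p ∂γ < ∞) : ∫⁻ x, d x x₀ ^ p ∂Q < ∞ := by
  have hm : Measurable fun x => d x x₀ ^ p :=
    (h.measurable_comp measurable_id measurable_const).pow_const p
  rw [← lintegral_snd_of_mem_couplings hγ hm]
  calc ∫⁻ z, d z.2 x₀ ^ p ∂γ
      ≤ ∫⁻ z, 2 ^ (p - 1) * (d z.1 z.2 ^ p + d z.1 x₀ ^ p) ∂γ := by
        refine lintegral_mono fun z => ?_
        refine (rpow_le_rpow' hp (h.triangle z.2 z.1 x₀)).trans ?_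
        rw [h.comm z.2]
        exact rpow_add_le' hp _ _
    _ = 2 ^ (p - 1) * (∫⁻ z, d z.1 z.2 ^ p ∂γ + ∫⁻ x, d x x₀ ^ p ∂P) := by
        rw [lintegral_const_mul' _ _ (two_rpow_ne_top p),
          lintegral_add_left (h.measurable.pow_const p), lintegral_fst_of_mem_couplings hγ hm]
    _ < ∞ := ENNReal.mul_lt_top (two_rpow_ne_top p).lt_top (ENNReal.add_lt_top.2 ⟨hc, hP⟩)

/-- Two couplings with densities are glued along their common marginal. -/
theorem exists_gluing {X Y Z : Type} [MeasurableSpace X] [MeasurableSpace Y] [MeasurableSpace Z]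
    {P : Measure X} {Q : Measure Y} {S : Measure Z} [SFinite P] [SFinite Q] [SFinite S]
    {f : X → Y → ℝ≥0∞} {g : Y → Z → ℝ≥0∞} (hf : Measurable (Function.uncurry f))
    (hg : Measurable (Function.uncurry g)) (hf1 : ∀ᵐ b ∂Q, ∫⁻ a, f a b ∂P = 1)
    (hg1 : ∀ᵐ b ∂Q, ∫⁻ c, g b c ∂S = 1) :
    ∃ γ : Measure (X × Y × Z),
      (∀ F : X → Y → ℝ≥0∞, Measurable (Function.uncurry F) →
        ∫⁻ z, F z.1 z.2.1 ∂γ = ∫⁻ a, ∫⁻ b, f a b * F a b ∂Q ∂P) ∧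
      (∀ F : Y → Z → ℝ≥0∞, Measurable (Function.uncurry F) →
        ∫⁻ z, F z.2.1 z.2.2 ∂γ = ∫⁻ b, ∫⁻ c, g b c * F b c ∂S ∂Q) := by
  have hf' : Measurable fun z : X × Y × Z => f z.1 z.2.1 :=
    hf.comp (measurable_fst.prodMk (measurable_fst.comp measurable_snd))
  have hg' : Measurable fun z : X × Y × Z => g z.2.1 z.2.2 := hg.comp measurable_snd
  have hfg : Measurable fun z : X × Y × Z => f z.1 z.2.1 * g z.2.1 z.2.2 := hf'.mul hg'
  refine ⟨(P.prod (Q.prod S)).withDensity fun z => f z.1 z.2.1 * g z.2.1 z.2.2,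
    fun F hF => ?_, fun F hF => ?_⟩
  · have hF' : Measurable fun z : X × Y × Z => F z.1 z.2.1 :=
      hF.comp (measurable_fst.prodMk (measurable_fst.comp measurable_snd))
    have hm : Measurable fun z : X × Y × Z => f z.1 z.2.1 * g z.2.1 z.2.2 * F z.1 z.2.1 :=
      (hf'.mul hg').mul hF'
    rw [lintegral_withDensity_eq_lintegral_mul _ hfg hF']
    simp only [Pi.mul_apply]
    rw [lintegral_prod _ hm.aemeasurable]
    refine lintegral_congr fun a => ?_
    have hma : Measurable fun z : Y × Z => f a z.1 * g z.1 z.2 * F a z.1 :=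
      hm.comp measurable_prodMk_left
    simp only
    rw [lintegral_prod _ hma.aemeasurable]
    refine lintegral_congr_ae ?_
    filter_upwards [hg1] with b hb
    have hgb : Measurable fun c => g b c := hg.comp measurable_prodMk_left
    calc ∫⁻ c, f a b * g b c * F a b ∂S = ∫⁻ c, (f a b * F a b) * g b c ∂S := by
          simp_rw [mul_right_comm]
      _ = f a b * F a b := by rw [lintegral_const_mul _ hgb, hb, mul_one]
  · have hF' : Measurable fun z : X × Y × Z => F z.2.1 z.2.2 := hF.comp measurable_snd
    have hm : Measurable fun z : X × Y × Z => f z.1 z.2.1 * g z.2.1 z.2.2 * F z.2.1 z.2.2 :=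
      (hf'.mul hg').mul hF'
    rw [lintegral_withDensity_eq_lintegral_mul _ hfg hF']
    simp only [Pi.mul_apply]
    rw [lintegral_prod_symm _ hm.aemeasurable]
    have hgF : Measurable fun z : Y × Z => g z.1 z.2 * F z.1 z.2 := hg.mul hF
    have hfb : Measurable fun z : Y × Z => ∫⁻ a, f a z.1 ∂P := by
      have : Measurable fun z : Y × X => f z.2 z.1 := hf.comp measurable_swap
      exact this.lintegral_prod_right'.comp measurable_fst
    have h1 : ∀ z : Y × Z, ∫⁻ a, f a z.1 * g z.1 z.2 * F z.1 z.2 ∂P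
        = (∫⁻ a, f a z.1 ∂P) * (g z.1 z.2 * F z.1 z.2) := by
      intro z
      have hfz : Measurable fun a => f a z.1 := hf.comp measurable_prodMk_right
      rw [← lintegral_mul_const _ hfz]
      simp_rw [mul_assoc]
    simp only [h1]
    have hall : Measurable fun z : Y × Z => (∫⁻ a, f a z.1 ∂P) * (g z.1 z.2 * F z.1 z.2) :=
      hfb.mul hgF
    rw [lintegral_prod _ hall.aemeasurable]
    refine lintegral_congr_ae ?_
    filter_upwards [hf1] with b hb
    simp only [hb, one_mul]

/-- `IsSepDist.exists_density` with the error outside of the `p`-th root. -/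
theorem IsSepDist.exists_density' (h : IsSepDist d) (hp : 1 ≤ p) {P Q : Measure X}
    [IsProbabilityMeasure P] [IsProbabilityMeasure Q] {x₀ : X} (hP : ∫⁻ x, d x x₀ ^ p ∂P < ∞)
    (hQ : ∫⁻ x, d x x₀ ^ p ∂Q < ∞) {ε : ℝ≥0∞} (hε : ε ≠ 0) :
    ∃ f : X → X → ℝ≥0∞, Measurable (Function.uncurry f) ∧ (∀ᵐ a ∂P, ∫⁻ b, f a b ∂Q = 1) ∧
      (∀ᵐ b ∂Q, ∫⁻ a, f a b ∂P = 1) ∧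
      (∫⁻ a, ∫⁻ b, f a b * d a b ^ p ∂Q ∂P) ^ (1 / p) ≤ wasserstein p d P Q + ε := by
  have hε' : ε ^ p ≠ 0 := by
    rw [Ne, ENNReal.rpow_eq_zero_iff_of_pos (by linarith)]
    exact hε
  obtain ⟨f, hm, h1, h2, h3⟩ := h.exists_density hp hP hQ hε'
  refine ⟨f, hm, h1, h2, ?_⟩
  rw [← rpow_le_rpow_iff' hp, rpow_inv_rpow' hp]
  exact h3.trans (ENNReal.add_rpow_le_rpow_add _ _ hp)

/-- Almost optimal couplings with densities are glued, which requires no disintegration; the rest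
is the Minkowski inequality. -/
theorem IsSepDist.wasserstein_triangle (h : IsSepDist d) (hp : 1 ≤ p) {P Q S : Measure X}
    [IsProbabilityMeasure P] [IsProbabilityMeasure Q] [IsProbabilityMeasure S] {x₀ : X}
    (hP : ∫⁻ x, d x x₀ ^ p ∂P < ∞) (hQ : ∫⁻ x, d x x₀ ^ p ∂Q < ∞)
    (hS : ∫⁻ x, d x x₀ ^ p ∂S < ∞) :
    wasserstein p d P S ≤ wasserstein p d P Q + wasserstein p d Q S := by
  refine ENNReal.le_of_forall_pos_le_add fun η hη _ => ?_
  have hη2 : (η : ℝ≥0∞) / 2 ≠ 0 := (ENNReal.half_pos (by exact_mod_cast hη.ne')).ne'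
  obtain ⟨f, hf, hf1, hf2, hf3⟩ := h.exists_density' hp hP hQ hη2
  obtain ⟨g, hg, hg1, hg2, hg3⟩ := h.exists_density' hp hQ hS hη2
  obtain ⟨γ, hγ1, hγ2⟩ := exists_gluing hf hg hf2 hg1
  have hdp : Measurable (Function.uncurry fun a b => d a b ^ p) := h.measurable.pow_const p
  have hm13 : Measurable fun z : X × X × X => (z.1, z.2.2) :=
    measurable_fst.prodMk (measurable_snd.comp measurable_snd)
  have hc : γ.map (fun z : X × X × X => (z.1, z.2.2)) ∈ couplings P S := by
    constructor
    · rw [Measure.map_map measurable_fst hm13]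
      ext A hA
      rw [Measure.map_apply (measurable_fst.comp hm13) hA,
        ← lintegral_indicator_one ((measurable_fst.comp hm13) hA)]
      refine (hγ1 (fun a _ => A.indicator 1 a)
        ((measurable_one.indicator hA).comp measurable_fst)).trans ?_
      rw [← lintegral_indicator_one hA]
      refine lintegral_congr_ae ?_
      filter_upwards [hf1] with a ha
      have hfa : Measurable fun b => f a b := hf.comp measurable_prodMk_left
      rw [lintegral_mul_const _ hfa, ha, one_mul]
    · rw [Measure.map_map measurable_snd hm13]
      ext A hA
      rw [Measure.map_apply (measurable_snd.comp hm13) hA,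
        ← lintegral_indicator_one ((measurable_snd.comp hm13) hA)]
      have hA' : Measurable (A.indicator (1 : X → ℝ≥0∞)) := measurable_one.indicator hA
      refine (hγ2 (fun _ c => A.indicator 1 c) (hA'.comp measurable_snd)).trans ?_
      have hm : Measurable fun z : X × X => g z.1 z.2 * A.indicator 1 z.2 :=
        hg.mul (hA'.comp measurable_snd)
      rw [lintegral_lintegral_swap hm.aemeasurable, ← lintegral_indicator_one hA]
      refine lintegral_congr_ae ?_
      filter_upwards [hg2] with a ha
      have hga : Measurable fun b => g b a := hg.comp measurable_prodMk_right
      rw [lintegral_mul_const _ hga, ha, one_mul]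
  have hd12 : Measurable fun z : X × X × X => d z.1 z.2.1 :=
    h.measurable_comp measurable_fst (measurable_fst.comp measurable_snd)
  have hd23 : Measurable fun z : X × X × X => d z.2.1 z.2.2 :=
    h.measurable.comp measurable_snd
  calc wasserstein p d P S ≤ _ := wasserstein_le hp hc
    _ = (∫⁻ z, d z.1 z.2.2 ^ p ∂γ) ^ (1 / p) := by
        rw [lintegral_map (h.measurable.pow_const p) hm13]
    _ ≤ (∫⁻ z, (d z.1 z.2.1 + d z.2.1 z.2.2) ^ p ∂γ) ^ (1 / p) := by
        refine ENNReal.rpow_le_rpow (lintegral_mono fun z => ?_) (by positivity)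
        exact rpow_le_rpow' hp (h.triangle _ _ _)
    _ ≤ (∫⁻ z, d z.1 z.2.1 ^ p ∂γ) ^ (1 / p) + (∫⁻ z, d z.2.1 z.2.2 ^ p ∂γ) ^ (1 / p) :=
        ENNReal.lintegral_Lp_add_le hd12.aemeasurable hd23.aemeasurable hp
    _ ≤ (wasserstein p d P Q + η / 2) + (wasserstein p d Q S + η / 2) := by
        rw [hγ1 (fun a b => d a b ^ p) hdp, hγ2 (fun a b => d a b ^ p) hdp]
        exact add_le_add hf3 hg3
    _ = wasserstein p d P Q + wasserstein p d Q S + η := by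
        rw [add_add_add_comm, ENNReal.add_halves]

/-- By the Markov inequality, couplings of small cost give `P F ≤ Q (F^δ)` for closed sets `F` and
all thickenings `F^δ`. -/
theorem IsSepDist.eq_of_wasserstein_eq_zero (h : IsSepDist d) (hp : 1 ≤ p) {P Q : Measure X}
    [IsProbabilityMeasure P] [IsProbabilityMeasure Q] (h0 : wasserstein p d P Q = 0) : P = Q := by
  let _ := h.emetricSpace
  have _ := h.borelSpace
  have key : ∀ P Q : Measure X, IsProbabilityMeasure P → IsProbabilityMeasure Q →
      wasserstein p d P Q = 0 → ∀ F : Set X, IsClosed F → P F ≤ Q F := by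
    intro P Q _ _ h0 F hF
    have hW : ⨅ γ ∈ couplings P Q, ∫⁻ z, d z.1 z.2 ^ p ∂γ = 0 := by
      rw [← wasserstein_rpow hp, h0, ENNReal.zero_rpow_of_pos (by linarith)]
    have hth : ∀ δ : ℝ, 0 < δ → P F ≤ Q (Metric.thickening δ F) := by
      intro δ hδ
      have hδ' : ENNReal.ofReal δ ^ p ≠ 0 := by
        rw [Ne, ENNReal.rpow_eq_zero_iff_of_pos (by linarith)]
        simpa using hδ
      have hδt : ENNReal.ofReal δ ^ p ≠ ∞ :=
        ENNReal.rpow_ne_top_of_nonneg (by linarith) ENNReal.ofReal_ne_top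
      refine ENNReal.le_of_forall_pos_le_add fun η hη _ => ?_
      have hlt : ⨅ γ ∈ couplings P Q, ∫⁻ z, d z.1 z.2 ^ p ∂γ < ENNReal.ofReal δ ^ p * η := by
        rw [hW]
        exact ENNReal.mul_pos hδ' (by exact_mod_cast hη.ne')
      obtain ⟨γ, hγ, hlt⟩ := by simpa only [iInf_lt_iff] using hlt
      have hmarkov := mul_meas_ge_le_lintegral (μ := γ) (h.measurable.pow_const p)
        (ENNReal.ofReal δ ^ p)
      have hbad : γ {z | ENNReal.ofReal δ ^ p ≤ d z.1 z.2 ^ p} ≤ η := by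
        rw [← ENNReal.mul_le_mul_iff_right hδ' hδt]
        exact hmarkov.trans hlt.le
      have hPF : P F = γ (Prod.fst ⁻¹' F) := by
        rw [← hγ.1, Measure.map_apply measurable_fst hF.measurableSet]
      have hQF : Q (Metric.thickening δ F) = γ (Prod.snd ⁻¹' Metric.thickening δ F) := by
        rw [← hγ.2, Measure.map_apply measurable_snd Metric.isOpen_thickening.measurableSet]
      rw [hPF, hQF]
      refine (measure_mono ?_).trans ((measure_union_le _ _).trans (add_le_add le_rfl hbad))
      intro z hz
      by_cases hd : d z.1 z.2 < ENNReal.ofReal δ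
      · left
        refine (Metric.mem_thickening_iff_exists_edist_lt _ _).2 ⟨z.1, hz, ?_⟩
        rw [edist_comm]
        exact hd
      · right
        exact rpow_le_rpow' hp (not_lt.1 hd)
    have hlim := tendsto_measure_thickening_of_isClosed (μ := Q) ⟨1, one_pos, measure_ne_top _ _⟩ hF
    exact ge_of_tendsto hlim (by filter_upwards [self_mem_nhdsWithin] with δ hδ using hth δ hδ)
  have h0' : wasserstein p d Q P = 0 := by rw [h.wasserstein_comm hp, h0]
  refine ext_of_generate_finite _ ?_ isPiSystem_isClosed (fun F hF => ?_) (by simp)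
  · rw [← borel_eq_generateFrom_isClosed]
    exact BorelSpace.measurable_eq
  · exact le_antisymm (key P Q inferInstance inferInstance h0 F hF)
      (key Q P inferInstance inferInstance h0' F hF)

end Metric

/-! ### Separability of the Wasserstein space -/

section Separable

variable {X : Type} [mX : MeasurableSpace X] {d : X → X → ℝ≥0∞} {p : ℝ}

/-- The measure with the rational masses `c i` at the points `s i`, the mass missing to one being
put at `s 0`. -/
noncomputable def rationalMeasure (s : ℕ → X) (c : ℕ →₀ ℚ) : Measure X :=
  Measure.sum (fun i => ENNReal.ofReal (c i) • Measure.dirac (s i))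
    + (1 - ∑' i, ENNReal.ofReal (c i)) • Measure.dirac (s 0)

/-- Every measure with finite moments is close to a measure with rational masses on a dense
sequence: the part of the mass of the `i`-th cell that exceeds a rational number is moved to `s 0`,
the rest of it to `s i`. -/
theorem IsSepDist.exists_coupling_rationalMeasure (h : IsSepDist d) (hp : 1 ≤ p) {s : ℕ → X}
    (hs : ∀ x, ∀ ε, 0 < ε → ∃ n, d x (s n) < ε) {P : Measure X} [IsProbabilityMeasure P]
    {x₀ : X} (hP : ∫⁻ x, d x x₀ ^ p ∂P < ∞) {η : ℝ≥0∞} (hη : η ≠ 0) :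
    ∃ c : ℕ →₀ ℚ, ∃ γ ∈ couplings P (rationalMeasure s c), ∫⁻ z, d z.1 z.2 ^ p ∂γ ≤ η := by
  have hη2 : η / 2 ≠ 0 := (ENNReal.half_pos hη).ne'
  have hp0 : 0 < p := by linarith
  obtain ⟨m, hm⟩ := exists_radius hp (K := 0) ENNReal.zero_ne_top hη2
  set κ : GridPlan := (m, 0)
  set r : ℝ≥0∞ := κ.radius with hr
  set ι : X → ℕ := κ.index d s with hι'
  have hι : Measurable ι := κ.measurable_index h hs
  have hrη : r ^ p ≤ η / 2 := by
    rw [ENNReal.zero_rpow_of_pos (by positivity), zero_add, zero_add] at hm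
    refine (rpow_le_rpow' hp ?_).trans hm
    exact le_mul_of_one_le_left (zero_le) (by norm_num)
  set M : ℕ → ℝ≥0∞ := fun i => (d (s i) (s 0) + r) ^ p with hM
  set u : ℕ → ℝ≥0∞ := fun i => P (ι ⁻¹' {i}) with hu
  have hu1 : ∑' i, u i = 1 := tsum_measure_fiber hι P
  have huM : ∑' i, u i * M i ≠ ∞ := by
    have h1 := lintegral_grid_moment_lt_top h hs hp (κ := κ) (P := P) (x₀ := s 0)
      (h.moment_lt_top hp hP _)
    have h2 := lintegral_comp_nat hι P M
    simp_rw [mul_comm (u _)]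
    rw [← h2]
    exact h1.ne
  obtain ⟨c, hc1, hc2⟩ := exists_finsupp_rat_approx huM (fun i => measure_ne_top P _)
    (pos_iff_ne_zero.2 hη2)
  set q : ℕ → ℝ≥0∞ := fun i => ENNReal.ofReal (c i) with hq
  set θ : ℕ → ℝ≥0∞ := fun i => q i / u i with hθ
  have hut : ∀ i, u i ≠ ∞ := fun i => measure_ne_top P _
  have hθu : ∀ i, θ i * u i = q i := by
    intro i
    rcases eq_or_ne (u i) 0 with h0 | h0
    · have : q i = 0 := le_antisymm (h0 ▸ hc1 i) bot_le
      simp [hθ, this]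
    · exact ENNReal.div_mul_cancel h0 (hut i)
  have hθ1 : ∀ i, θ i ≤ 1 := fun i => ENNReal.div_le_of_le_mul (by rw [one_mul]; exact hc1 i)
  have hθu' : ∀ i, (1 - θ i) * u i = u i - q i := by
    intro i
    rw [ENNReal.sub_mul (fun _ _ => hut i), one_mul, hθu]
  have hθm : Measurable fun x => θ (ι x) := (measurable_of_countable θ).comp hι
  have hθm' : Measurable fun x => 1 - θ (ι x) := measurable_const.sub hθm
  have hT : Measurable fun x => s (ι x) := (measurable_of_countable s).comp hι
  have hm1 : Measurable fun x => (x, s (ι x)) := measurable_id.prodMk hT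
  have hm2 : Measurable fun x : X => (x, s 0) := measurable_id.prodMk measurable_const
  refine ⟨c, (P.withDensity fun x => θ (ι x)).map (fun x => (x, s (ι x)))
    + (P.withDensity fun x => 1 - θ (ι x)).map (fun x => (x, s 0)), ⟨?_, ?_⟩, ?_⟩
  · rw [Measure.map_add _ _ measurable_fst, Measure.map_map measurable_fst hm1,
      Measure.map_map measurable_fst hm2]
    change Measure.map id _ + Measure.map id _ = P
    rw [Measure.map_id, Measure.map_id, ← withDensity_add_left hθm]
    have : ((fun x => θ (ι x)) + fun x => 1 - θ (ι x)) = 1 := by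
      ext x
      exact add_tsub_cancel_of_le (hθ1 _)
    rw [this, withDensity_one]
  · rw [Measure.map_add _ _ measurable_snd, Measure.map_map measurable_snd hm1,
      Measure.map_map measurable_snd hm2]
    ext A hA
    have hAm : Measurable fun i => A.indicator (1 : X → ℝ≥0∞) (s i) := measurable_of_countable _
    have e1 : ((P.withDensity fun x => θ (ι x)).map (Prod.snd ∘ fun x => (x, s (ι x)))) A
        = ∑' i, q i * A.indicator 1 (s i) := by
      have hT' : Measurable (Prod.snd ∘ fun x => (x, s (ι x))) := hT
      rw [Measure.map_apply hT' hA, withDensity_apply _ (hT' hA), ← lintegral_indicator (hT' hA)]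
      have := lintegral_comp_nat hι P (fun i => θ i * A.indicator 1 (s i))
      simp_rw [mul_right_comm, fun i => show P (ι ⁻¹' {i}) = u i from rfl, hθu] at this
      rw [← this]
      refine lintegral_congr fun x => ?_
      by_cases hx : s (ι x) ∈ A <;> simp [Set.indicator, hx]
    have e2 : ((P.withDensity fun x => 1 - θ (ι x)).map (Prod.snd ∘ fun x : X => (x, s 0))) A
        = (1 - ∑' i, q i) * A.indicator 1 (s 0) := by
      have hT' : Measurable (Prod.snd ∘ fun x : X => (x, s 0)) := measurable_const
      rw [Measure.map_apply hT' hA, withDensity_apply _ (hT' hA), ← lintegral_indicator (hT' hA)]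
      have := lintegral_comp_nat hι P (fun i => (1 - θ i) * A.indicator 1 (s 0))
      simp_rw [mul_right_comm, fun i => show P (ι ⁻¹' {i}) = u i from rfl, hθu'] at this
      rw [ENNReal.tsum_mul_right, ENNReal.tsum_sub (ne_top_of_le_ne_top ENNReal.one_ne_top
        (hu1 ▸ ENNReal.tsum_le_tsum hc1)) hc1, hu1] at this
      rw [← this]
      refine lintegral_congr fun x => ?_
      by_cases hx : s 0 ∈ A <;> simp [Set.indicator, hx]
    rw [Measure.add_apply, e1, e2, rationalMeasure, Measure.add_apply, Measure.sum_apply _ hA]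
    simp only [Measure.smul_apply, Measure.dirac_apply' _ hA, smul_eq_mul, hq]
  · have hdm : Measurable fun z : X × X => d z.1 z.2 ^ p := h.measurable.pow_const p
    have hd1 : Measurable fun x => d x (s (ι x)) ^ p := hdm.comp hm1
    have hd2 : Measurable fun x => d x (s 0) ^ p := hdm.comp hm2
    rw [lintegral_add_measure, lintegral_map hdm hm1, lintegral_map hdm hm2,
      lintegral_withDensity_eq_lintegral_mul _ hθm hd1,
      lintegral_withDensity_eq_lintegral_mul _ hθm' hd2, ← ENNReal.add_halves η]
    have hcell : ∀ x, d x (s (ι x)) ≤ r := fun x => (dist_cellIndex_lt hs κ.radius_pos x).le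
    refine add_le_add ?_ ?_
    · calc _ ≤ ∫⁻ x, r ^ p ∂P := by
            refine lintegral_mono fun x => ?_
            exact (mul_le_mul' (hθ1 _) (rpow_le_rpow' hp (hcell x))).trans_eq (one_mul _)
        _ = r ^ p := by simp
        _ ≤ η / 2 := hrη
    · calc _ ≤ ∫⁻ x, (1 - θ (ι x)) * M (ι x) ∂P := by
            refine lintegral_mono fun x => mul_le_mul_right (rpow_le_rpow' hp ?_) _
            rw [add_comm]
            exact (h.triangle x (s (ι x)) (s 0)).trans (add_le_add (hcell x) le_rfl)
        _ = ∑' i, (u i - q i) * M i := by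
            rw [lintegral_comp_nat hι P (fun i => (1 - θ i) * M i)]
            refine tsum_congr fun i => ?_
            rw [mul_right_comm]
            exact congrArg (· * M i) (hθu' i)
        _ ≤ η / 2 := hc2

/-- The Wasserstein distance on `𝒫ᵖ(X)`. -/
noncomputable def PMoment.dist {X : Type} [MeasurableSpace X] {p : ℝ} {d : X → X → ℝ≥0∞}
    (P Q : PMoment p d) : ℝ≥0∞ :=
  wasserstein p d P.toMeasure Q.toMeasure

theorem PMoment.ext {P Q : PMoment p d} (hPQ : P.toMeasure = Q.toMeasure) : P = Q :=
  Subtype.ext hPQ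

theorem PMoment.lintegral_lt_top (h : IsSepDist d) (hp : 1 ≤ p) (P : PMoment p d) (x : X) :
    ∫⁻ y, d y x ^ p ∂P.toMeasure < ∞ := by
  obtain ⟨x₀, hx₀⟩ := P.2.2
  exact h.moment_lt_top (P := P.toMeasure) hp hx₀ x

/-- The rational measures on a dense sequence with finite moments form a countable dense set. -/
theorem IsSepDist.exists_dense_pMoment (h : IsSepDist d) (hp : 1 ≤ p) :
    ∃ S : ℕ → PMoment p d, ∀ P : PMoment p d, ∀ ε, 0 < ε → ∃ n, P.dist (S n) < ε := by
  obtain ⟨s, hs⟩ := h.dense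
  let D : Set (PMoment p d) := {P | P.toMeasure ∈ Set.range (rationalMeasure s)}
  have hD : D.Countable :=
    (Set.countable_range (rationalMeasure s)).preimage fun P Q hPQ => PMoment.ext hPQ
  have hdense : ∀ P : PMoment p d, ∀ ε, 0 < ε → ∃ Q ∈ D, P.dist Q < ε := by
    intro P ε hε
    obtain ⟨δ, hδ0, hδ⟩ := exists_between hε
    have hδp : δ ^ p ≠ 0 := by
      rw [Ne, ENNReal.rpow_eq_zero_iff_of_pos (by linarith)]
      exact hδ0.ne'
    have hPm := PMoment.lintegral_lt_top h hp P (s 0)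
    obtain ⟨c, γ, hγ, hcost⟩ := h.exists_coupling_rationalMeasure hp hs hPm hδp
    have hfin : ∫⁻ z, d z.1 z.2 ^ p ∂γ < ∞ := hcost.trans_lt
      (ENNReal.rpow_lt_top_of_nonneg (by linarith) hδ.ne_top)
    have hprob : IsProbabilityMeasure (rationalMeasure s c) := by
      have := isProbabilityMeasure_of_mem_couplings hγ
      rw [← hγ.2]
      exact Measure.isProbabilityMeasure_map measurable_snd.aemeasurable
    refine ⟨⟨rationalMeasure s c, hprob, s 0, h.moment_of_coupling hp hPm hγ hfin⟩, ⟨c, rfl⟩, ?_⟩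
    refine (wasserstein_le hp hγ).trans_lt (lt_of_le_of_lt ?_ hδ)
    rw [← rpow_le_rpow_iff' hp, rpow_inv_rpow' hp]
    exact hcost
  have hm : Measurable fun x => d x (s 0) ^ p :=
    (h.measurable_comp measurable_id measurable_const).pow_const p
  let P₀ : PMoment p d := ⟨Measure.dirac (s 0), inferInstance, s 0, by
    rw [lintegral_dirac' _ hm]
    simp [h.self, ENNReal.zero_rpow_of_pos (show 0 < p by linarith)]⟩
  obtain ⟨Q₀, hQ₀, -⟩ := hdense P₀ 1 one_pos
  obtain ⟨S, hS⟩ := hD.exists_eq_range ⟨Q₀, hQ₀⟩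
  refine ⟨S, fun P ε hε => ?_⟩
  obtain ⟨Q, hQ, hlt⟩ := hdense P ε hε
  rw [hS] at hQ
  obtain ⟨n, rfl⟩ := hQ
  exact ⟨n, hlt⟩

theorem IsSepDist.isSepDist_pMoment (h : IsSepDist d) (hp : 1 ≤ p) :
    @IsSepDist (PMoment p d) (@_root_.borel (PMoment p d) (metricTopology PMoment.dist))
      PMoment.dist := by
  obtain ⟨s, hs⟩ := h.dense
  refine @IsSepDist.mk _ (_) _ ?_ ?_ ?_ ?_ ?_ ?_ rfl
  · exact fun P => wasserstein_self hp h.self _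
  · exact fun P Q => h.wasserstein_comm hp _ _
  · exact fun P Q S => h.wasserstein_triangle hp (P.lintegral_lt_top h hp (s 0))
      (Q.lintegral_lt_top h hp _) (S.lintegral_lt_top h hp _)
  · exact fun P Q => (h.wasserstein_lt_top hp (P.lintegral_lt_top h hp (s 0))
      (Q.lintegral_lt_top h hp _)).ne
  · exact fun P Q h0 => PMoment.ext (h.eq_of_wasserstein_eq_zero hp h0)
  · exact h.exists_dense_pMoment hp

end Separable

/-! ### Completeness of the Wasserstein space -/

section Complete

variable {X : Type} [mX : MeasurableSpace X] {d : X → X → ℝ≥0∞} {p : ℝ}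

/-- A sequence of couplings of consecutive measures, given by densities, is realized by a Markov
chain. -/
theorem exists_markovChain {u : ℕ → Measure X} [∀ n, IsProbabilityMeasure (u n)]
    {f : ℕ → X → X → ℝ≥0∞} (hf : ∀ n, Measurable (Function.uncurry (f n)))
    (h₁ : ∀ n, ∀ᵐ a ∂u n, ∫⁻ b, f n a b ∂u (n + 1) = 1)
    (h₂ : ∀ n, ∀ᵐ b ∂u (n + 1), ∫⁻ a, f n a b ∂u n = 1) :
    ∃ T : Measure (ℕ → X), IsProbabilityMeasure T ∧ (∀ n, T.map (fun x => x n) = u n) ∧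
      ∀ n, T.map (fun x => (x n, x (n + 1)))
        = ((u n).prod (u (n + 1))).withDensity (Function.uncurry (f n)) := by
  classical
  -- On a null set the densities are replaced by one, which gives Markov kernels.
  let g : ℕ → X → X → ℝ≥0∞ := fun n a b => if ∫⁻ b, f n a b ∂u (n + 1) = 1 then f n a b else 1
  have hg : ∀ n, Measurable (Function.uncurry (g n)) := by
    intro n
    have hI : Measurable fun a => ∫⁻ b, f n a b ∂u (n + 1) := (hf n).lintegral_prod_right'
    exact Measurable.ite ((hI.comp measurable_fst) (measurableSet_singleton 1)) (hf n)
      measurable_const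
  have hg1 : ∀ n a, ∫⁻ b, g n a b ∂u (n + 1) = 1 := by
    intro n a
    by_cases ha : ∫⁻ b, f n a b ∂u (n + 1) = 1 <;> simp [g, ha]
  have hgf : ∀ n, ∀ᵐ a ∂u n, ∀ b, g n a b = f n a b := by
    intro n
    filter_upwards [h₁ n] with a ha b
    simp [g, ha]
  have hgf' : ∀ n, ((u n).prod (u (n + 1))).withDensity (Function.uncurry (g n))
      = ((u n).prod (u (n + 1))).withDensity (Function.uncurry (f n)) := by
    intro n
    refine withDensity_congr_ae ?_
    have : ∀ᵐ z ∂(u n).prod (u (n + 1)), ∀ b, g n z.1 b = f n z.1 b :=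
      Measure.quasiMeasurePreserving_fst.ae (hgf n)
    filter_upwards [this] with z hz using hz z.2
  let K : (n : ℕ) → Kernel X X := fun n => (Kernel.const X (u (n + 1))).withDensity (g n)
  have hK : ∀ n a, K n a = (u (n + 1)).withDensity (g n a) := by
    intro n a
    rw [Kernel.withDensity_apply _ (hg n), Kernel.const_apply]
  have hKM : ∀ n, IsMarkovKernel (K n) := by
    refine fun n => ⟨fun a => ⟨?_⟩⟩
    rw [hK, withDensity_apply _ MeasurableSet.univ, setLIntegral_univ, hg1]
  let κ : (n : ℕ) → Kernel ((i : Finset.Iic n) → X) X := fun n =>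
    (K n).comap (fun x => x ⟨n, Finset.mem_Iic.2 le_rfl⟩) (measurable_pi_apply _)
  have hκM : ∀ n, IsMarkovKernel (κ n) := fun n => by
    have := hKM n
    infer_instance
  let T : Measure (ℕ → X) := Kernel.trajMeasure (X := fun _ => X) (u 0) κ
  have hpair : ∀ n, T.map (fun x => x n) = u n → T.map (fun x => (x n, x (n + 1)))
      = ((u n).prod (u (n + 1))).withDensity (Function.uncurry (f n)) := by
    intro n hn
    rw [← hgf' n]
    have hm2 : Measurable fun x : ℕ → X => (x n, x (n + 1)) := by fun_prop
    refine Measure.ext_of_lintegral _ fun F hF => ?_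
    have key := Kernel.map_frestrictLe_trajMeasure_compProd_eq_map_trajMeasure
      (X := fun _ => X) (μ₀ := u 0) (κ := κ) (a := n)
    have hlast : Measurable fun y : ((i : Finset.Iic n) → X) × X =>
        (y.1 ⟨n, Finset.mem_Iic.2 le_rfl⟩, y.2) := by fun_prop
    have hr : Measurable (Preorder.frestrictLe (π := fun _ : ℕ => X) n) := by fun_prop
    have hmm : Measurable fun x : ℕ → X => (Preorder.frestrictLe n x, x (n + 1)) := by fun_prop
    have hFg : Measurable fun z : X × X => g n z.1 z.2 * F z := (hg n).mul hF
    have hFK : Measurable fun a => ∫⁻ b, g n a b * F (a, b) ∂u (n + 1) :=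
      hFg.lintegral_prod_right'
    have hFl : Measurable fun y : ((i : Finset.Iic n) → X) × X =>
        F (y.1 ⟨n, Finset.mem_Iic.2 le_rfl⟩, y.2) := hF.comp hlast
    have hFy : ∀ a, Measurable fun b => F (a, b) := fun a => hF.comp measurable_prodMk_left
    have hFKy : Measurable fun y : (i : Finset.Iic n) → X =>
        ∫⁻ b, g n (y ⟨n, Finset.mem_Iic.2 le_rfl⟩) b
          * F (y ⟨n, Finset.mem_Iic.2 le_rfl⟩, b) ∂u (n + 1) :=
      hFK.comp (measurable_pi_apply _)
    calc ∫⁻ z, F z ∂T.map (fun x => (x n, x (n + 1)))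
        = ∫⁻ y, F (y.1 ⟨n, Finset.mem_Iic.2 le_rfl⟩, y.2)
            ∂T.map (fun x => (Preorder.frestrictLe n x, x (n + 1))) := by
          rw [lintegral_map hF hm2, lintegral_map hFl hmm]
          rfl
      _ = ∫⁻ y, ∫⁻ b, F (y ⟨n, Finset.mem_Iic.2 le_rfl⟩, b) ∂κ n y
            ∂T.map (Preorder.frestrictLe n) := by
          rw [← key, Measure.lintegral_compProd hFl]
      _ = ∫⁻ y, ∫⁻ b, g n (y ⟨n, Finset.mem_Iic.2 le_rfl⟩) b
            * F (y ⟨n, Finset.mem_Iic.2 le_rfl⟩, b) ∂u (n + 1)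
            ∂T.map (Preorder.frestrictLe n) := by
          refine lintegral_congr fun y => ?_
          change ∫⁻ b, _ ∂K n (y ⟨n, Finset.mem_Iic.2 le_rfl⟩) = _
          have hga : Measurable (g n (y ⟨n, Finset.mem_Iic.2 le_rfl⟩)) :=
            (hg n).comp measurable_prodMk_left
          rw [hK, lintegral_withDensity_eq_lintegral_mul _ hga (hFy _)]
          rfl
      _ = ∫⁻ x, ∫⁻ b, g n (x n) b * F (x n, b) ∂u (n + 1) ∂T := by
          rw [lintegral_map hFKy hr]
          rfl
      _ = ∫⁻ a, ∫⁻ b, g n a b * F (a, b) ∂u (n + 1) ∂u n := by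
          rw [← hn, lintegral_map hFK (measurable_pi_apply n)]
      _ = _ := by
          rw [← lintegral_withDensity_prod (f := fun a b => F (a, b)) (hg n) hF]
  have hlaw : ∀ n, T.map (fun x => x n) = u n := by
    intro n
    induction n with
    | zero =>
      have h0 : T.map (Preorder.frestrictLe 0)
          = (u 0).map (MeasurableEquiv.piUnique (fun _ : Finset.Iic 0 => X)).symm := by
        simp only [T, Kernel.trajMeasure]
        rw [Measure.map_comp _ _ (by fun_prop), Kernel.traj_map_frestrictLe,
          Kernel.partialTraj_self, Measure.id_comp]
      have : (fun x : ℕ → X => x 0)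
          = (fun y : (i : Finset.Iic 0) → X => y ⟨0, Finset.mem_Iic.2 le_rfl⟩)
            ∘ Preorder.frestrictLe (π := fun _ : ℕ => X) 0 := rfl
      rw [this, ← Measure.map_map (by fun_prop) (by fun_prop), h0, Measure.map_map (by fun_prop)
        (MeasurableEquiv.measurable _)]
      exact Measure.map_id
    | succ n ih =>
      have h := hpair n ih
      have hc := (withDensity_mem_couplings (hf n) (h₁ n) (h₂ n)).2
      rw [← h, Measure.map_map measurable_snd (by fun_prop)] at hc
      exact hc
  exact ⟨T, inferInstance, hlaw, fun n => hpair n (hlaw n)⟩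

/-- The Minkowski inequality for countable sums. -/
theorem lintegral_tsum_rpow_le (hp : 1 ≤ p) {Ω : Type*} [MeasurableSpace Ω] {μ : Measure Ω}
    {g : ℕ → Ω → ℝ≥0∞} (hg : ∀ n, Measurable (g n)) :
    (∫⁻ ω, (∑' n, g n ω) ^ p ∂μ) ^ (1 / p) ≤ ∑' n, (∫⁻ ω, g n ω ^ p ∂μ) ^ (1 / p) := by
  have hp0 : 0 < p := by linarith
  have hfin : ∀ N, (∫⁻ ω, (∑ n ∈ Finset.range N, g n ω) ^ p ∂μ) ^ (1 / p)
      ≤ ∑ n ∈ Finset.range N, (∫⁻ ω, g n ω ^ p ∂μ) ^ (1 / p) := by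
    intro N
    induction N with
    | zero => simp [ENNReal.zero_rpow_of_pos hp0, hp0]
    | succ N ih =>
      simp only [Finset.sum_range_succ]
      have hm : Measurable fun ω => ∑ n ∈ Finset.range N, g n ω :=
        Finset.measurable_sum _ fun n _ => hg n
      exact (ENNReal.lintegral_Lp_add_le hm.aemeasurable (hg N).aemeasurable hp).trans
        (add_le_add ih le_rfl)
  rw [← rpow_le_rpow_iff' hp, rpow_inv_rpow' hp]
  have hsup : ∀ ω, (∑' n, g n ω) ^ p = ⨆ N, (∑ n ∈ Finset.range N, g n ω) ^ p := by
    intro ω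
    rw [ENNReal.tsum_eq_iSup_nat]
    exact (ENNReal.orderIsoRpow p hp0).map_iSup _
  simp_rw [hsup]
  rw [lintegral_iSup]
  · refine iSup_le fun N => ?_
    rw [← rpow_inv_rpow' hp (∫⁻ ω, (∑ n ∈ Finset.range N, g n ω) ^ p ∂μ)]
    exact rpow_le_rpow' hp ((hfin N).trans (ENNReal.sum_le_tsum _))
  · exact fun N => (Finset.measurable_sum _ fun n _ => hg n).pow_const p
  · intro N M hNM ω
    exact rpow_le_rpow' hp (Finset.sum_le_sum_of_subset (Finset.range_mono hNM))

/-- The Markov chain through almost optimal couplings of consecutive measures converges almost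
surely, and the law of its limit is the limit of the sequence. -/
theorem IsSepDist.isCompleteDist_pMoment (h : IsSepDist d) (hp : 1 ≤ p) (hc : IsCompleteDist d) :
    IsCompleteDist (PMoment.dist (X := X) (p := p) (d := d)) := by
  intro u hu
  have hp0 : 0 < p := by linarith
  obtain ⟨s, hs⟩ := h.dense
  have hum : ∀ n, ∫⁻ x, d x (s 0) ^ p ∂(u n).toMeasure < ∞ :=
    fun n => (u n).lintegral_lt_top h hp _
  have hex : ∀ n, ∃ f : X → X → ℝ≥0∞, Measurable (Function.uncurry f) ∧
      (∀ᵐ a ∂(u n).toMeasure, ∫⁻ b, f a b ∂(u (n + 1)).toMeasure = 1) ∧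
      (∀ᵐ b ∂(u (n + 1)).toMeasure, ∫⁻ a, f a b ∂(u n).toMeasure = 1) ∧
      (∫⁻ a, ∫⁻ b, f a b * d a b ^ p ∂(u (n + 1)).toMeasure ∂(u n).toMeasure) ^ (1 / p)
        ≤ (u n).dist (u (n + 1)) + 2⁻¹ ^ n := fun n =>
    h.exists_density' hp (hum n) (hum (n + 1)) (by simp)
  choose f hf hf1 hf2 hf3 using hex
  obtain ⟨T, hT, hT1, hT2⟩ := exists_markovChain hf hf1 hf2
  set b : ℕ → ℝ≥0∞ := fun n => (u n).dist (u (n + 1)) + 2⁻¹ ^ n with hb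
  have hbsum : ∑' n, b n ≠ ∞ := by
    rw [ENNReal.tsum_add]
    refine ENNReal.add_ne_top.2 ⟨hu, ?_⟩
    rw [ENNReal.tsum_geometric]
    simp
  let e : ℕ → (ℕ → X) → ℝ≥0∞ := fun n x => d (x n) (x (n + 1))
  have he : ∀ n, Measurable (e n) := fun n =>
    h.measurable_comp (measurable_pi_apply n) (measurable_pi_apply (n + 1))
  have heb : ∀ n, (∫⁻ x, e n x ^ p ∂T) ^ (1 / p) ≤ b n := by
    intro n
    refine le_trans (le_of_eq ?_) (hf3 n)
    congr 1
    rw [← lintegral_withDensity_prod (f := fun a b => d a b ^ p) (hf n) (h.measurable.pow_const p),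
      ← hT2 n, lintegral_map (h.measurable.pow_const p) (by fun_prop)]
  have hS : ∀ n, (∫⁻ x, (∑' k, e (n + k) x) ^ p ∂T) ^ (1 / p) ≤ ∑' k, b (n + k) := fun n =>
    (lintegral_tsum_rpow_le hp fun k => he (n + k)).trans
      (ENNReal.tsum_le_tsum fun k => heb (n + k))
  have hfin : ∀ᵐ x ∂T, ∑' k, e k x < ∞ := by
    have hlt : ∫⁻ x, (∑' k, e k x) ^ p ∂T ≠ ∞ := by
      have h0 := hS 0
      simp only [zero_add] at h0
      intro htop
      rw [htop, ENNReal.top_rpow_of_pos (by positivity)] at h0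
      exact hbsum (top_le_iff.1 h0)
    filter_upwards [ae_lt_top ((Measurable.tsum he).pow_const p) hlt] with x hx
    exact (ENNReal.rpow_lt_top_iff_of_pos hp0).1 hx
  let _ := h.emetricSpace
  have _ := h.borelSpace
  have hlim : ∀ᵐ x ∂T, ∃ l, Tendsto (fun n => x n) atTop (𝓝 l) := by
    filter_upwards [hfin] with x hx
    obtain ⟨l, hl⟩ := hc x hx.ne
    exact ⟨l, tendsto_iff_edist_tendsto_0.2 hl⟩
  obtain ⟨y, hy, hylim⟩ := measurable_limit_of_tendsto_metrizable_ae
    (fun n => (measurable_pi_apply n).aemeasurable) hlim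
  have hcoup : ∀ n, T.map (fun x => (x n, y x)) ∈ couplings (u n).toMeasure (T.map y) := by
    intro n
    have hm : Measurable fun x : ℕ → X => (x n, y x) := (measurable_pi_apply n).prodMk hy
    constructor
    · rw [Measure.map_map measurable_fst hm]
      exact hT1 n
    · rw [Measure.map_map measurable_snd hm]
      rfl
  have hcost : ∀ n, (∫⁻ z, d z.1 z.2 ^ p ∂T.map (fun x => (x n, y x))) ^ (1 / p)
      ≤ ∑' k, b (n + k) := by
    intro n
    rw [lintegral_map (h.measurable.pow_const p) ((measurable_pi_apply n).prodMk hy)]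
    refine le_trans (ENNReal.rpow_le_rpow (lintegral_mono_ae ?_) (by positivity)) (hS n)
    filter_upwards [hylim] with x hx
    exact rpow_le_rpow' hp
      (edist_le_tsum_of_edist_le_of_tendsto (fun k => e k x) (fun k => le_rfl) hx n)
  have htail : Tendsto (fun n => ∑' k, b (n + k)) atTop (𝓝 0) := by
    have := ENNReal.tendsto_sum_nat_add b hbsum
    simpa only [add_comm] using this
  have hprob : IsProbabilityMeasure (T.map y) := Measure.isProbabilityMeasure_map hy.aemeasurable
  have hmom : ∫⁻ x, d x (s 0) ^ p ∂T.map y < ∞ := by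
    refine h.moment_of_coupling hp (hum 0) (hcoup 0) ?_
    have h0 := hcost 0
    simp only [zero_add] at h0
    rw [lt_top_iff_ne_top]
    intro htop
    rw [htop, ENNReal.top_rpow_of_pos (by positivity)] at h0
    exact hbsum (top_le_iff.1 h0)
  refine ⟨⟨T.map y, hprob, s 0, hmom⟩, ?_⟩
  exact tendsto_of_tendsto_of_tendsto_of_le_of_le tendsto_const_nhds htail (fun _ => zero_le)
    fun n => (wasserstein_le hp (hcoup n)).trans (hcost n)

end Complete

/-! ### Sums of powers -/

section Lp

variable {p : ℝ}

theorem le_lp_left (hp : 1 ≤ p) (a b : ℝ≥0∞) : a ≤ (a ^ p + b ^ p) ^ (1 / p) := by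
  rw [← rpow_le_rpow_iff' hp, rpow_inv_rpow' hp]
  exact le_self_add

theorem le_lp_right (hp : 1 ≤ p) (a b : ℝ≥0∞) : b ≤ (a ^ p + b ^ p) ^ (1 / p) := by
  rw [add_comm]
  exact le_lp_left hp b a

theorem lp_le_add (hp : 1 ≤ p) (a b : ℝ≥0∞) : (a ^ p + b ^ p) ^ (1 / p) ≤ a + b := by
  rw [← rpow_le_rpow_iff' hp, rpow_inv_rpow' hp]
  exact ENNReal.add_rpow_le_rpow_add _ _ hp

theorem lp_triangle (hp : 1 ≤ p) {a b a₁ b₁ a₂ b₂ : ℝ≥0∞} (ha : a ≤ a₁ + a₂) (hb : b ≤ b₁ + b₂) :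
    (a ^ p + b ^ p) ^ (1 / p) ≤ (a₁ ^ p + b₁ ^ p) ^ (1 / p) + (a₂ ^ p + b₂ ^ p) ^ (1 / p) := by
  have h := ENNReal.Lp_add_le Finset.univ ![a₁, b₁] ![a₂, b₂] hp
  simp only [Fin.sum_univ_two, Matrix.cons_val_zero, Matrix.cons_val_one] at h
  refine le_trans (ENNReal.rpow_le_rpow ?_ (by positivity)) h
  exact add_le_add (rpow_le_rpow' hp ha) (rpow_le_rpow' hp hb)

end Lp

/-! ### The base distance and the path distance -/

section Base

variable {p : ℝ} {ρ : MetricSpace ℝ}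

theorem metricTopology_baseDist (hρ : IsCompatible ρ) :
    metricTopology (baseDist ρ) = Real.pseudoMetricSpace.toUniformSpace.toTopologicalSpace := by
  rw [← hρ]
  exact (IsSepDist.topology_eq ρ.toPseudoMetricSpace.toPseudoEMetricSpace).symm

theorem continuous_baseDist (hρ : IsCompatible ρ) :
    Continuous fun z : ℝ × ℝ => baseDist ρ z.1 z.2 := by
  have h : @Continuous (ℝ × ℝ) ℝ≥0∞ (@instTopologicalSpaceProd ℝ ℝ
      ρ.toPseudoMetricSpace.toUniformSpace.toTopologicalSpace
      ρ.toPseudoMetricSpace.toUniformSpace.toTopologicalSpace) _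
      (fun z => baseDist ρ z.1 z.2) :=
    @continuous_edist ℝ ρ.toPseudoMetricSpace.toPseudoEMetricSpace
  have hρ' : ρ.toPseudoMetricSpace.toUniformSpace.toTopologicalSpace
      = Real.pseudoMetricSpace.toUniformSpace.toTopologicalSpace := hρ
  rw [hρ'] at h
  exact h

theorem baseDist_comm (ρ : MetricSpace ℝ) (x y : ℝ) : baseDist ρ x y = baseDist ρ y x :=
  @edist_comm ℝ ρ.toPseudoMetricSpace.toPseudoEMetricSpace x y

theorem baseDist_triangle (ρ : MetricSpace ℝ) (x y z : ℝ) :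
    baseDist ρ x z ≤ baseDist ρ x y + baseDist ρ y z :=
  @edist_triangle ℝ ρ.toPseudoMetricSpace.toPseudoEMetricSpace x y z

theorem baseDist_ne_top (ρ : MetricSpace ℝ) (x y : ℝ) : baseDist ρ x y ≠ ∞ :=
  @edist_ne_top ℝ ρ.toPseudoMetricSpace x y

theorem eq_of_baseDist_eq_zero (ρ : MetricSpace ℝ) (x y : ℝ) (h : baseDist ρ x y = 0) : x = y :=
  @eq_of_edist_eq_zero ℝ (@MetricSpace.toEMetricSpace ℝ ρ) x y h

theorem exists_dense_baseDist (hρ : IsCompatible ρ) :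
    ∃ s : ℕ → ℝ, ∀ x, ∀ ε, 0 < ε → ∃ n, baseDist ρ x (s n) < ε := by
  refine ⟨TopologicalSpace.denseSeq ℝ, fun x ε hε => ?_⟩
  have hc : Continuous fun y => baseDist ρ x y :=
    (continuous_baseDist hρ).comp (continuous_const.prodMk continuous_id)
  obtain ⟨y, hy, n, rfl⟩ := (TopologicalSpace.denseRange_denseSeq ℝ).inter_open_nonempty
    {y | baseDist ρ x y < ε} (isOpen_lt hc continuous_const)
    ⟨x, by simpa [baseDist_self] using hε⟩
  exact ⟨n, hy⟩

theorem isSepDist_baseDist (hρ : IsCompatible ρ) : IsSepDist (baseDist ρ) where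
  self := baseDist_self ρ
  comm := baseDist_comm ρ
  triangle := baseDist_triangle ρ
  ne_top := baseDist_ne_top ρ
  eq_of_zero := eq_of_baseDist_eq_zero ρ
  dense := exists_dense_baseDist hρ
  borel := by
    rw [metricTopology_baseDist hρ]
    exact BorelSpace.measurable_eq

theorem baseDist_le_pathDist (hp : 1 ≤ p) {n : ℕ} (x y : Fin (n + 1) → ℝ) (i : Fin (n + 1)) :
    baseDist ρ (x i) (y i) ≤ pathDist p ρ n x y := by
  rw [pathDist, ← rpow_le_rpow_iff' hp, rpow_inv_rpow' hp]
  exact Finset.single_le_sum (f := fun i => baseDist ρ (x i) (y i) ^ p) (fun _ _ => zero_le)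
    (Finset.mem_univ i)

theorem pathDist_rpow (hp : 1 ≤ p) {n : ℕ} (x y : Fin (n + 1) → ℝ) :
    pathDist p ρ n x y ^ p = ∑ i, baseDist ρ (x i) (y i) ^ p :=
  rpow_inv_rpow' hp _

theorem continuous_pathDist (hρ : IsCompatible ρ) (n : ℕ) (x : Fin (n + 1) → ℝ) :
    Continuous fun y => pathDist p ρ n y x := by
  refine ENNReal.continuous_rpow_const.comp (continuous_finsetSum _ fun i _ => ?_)
  refine ENNReal.continuous_rpow_const.comp ?_
  have hi : Continuous fun y : Fin (n + 1) → ℝ => (y i, x i) :=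
    (continuous_apply i).prodMk continuous_const
  exact (continuous_baseDist hρ).comp hi

theorem pathDist_self (hp : 1 ≤ p) {n : ℕ} (x : Fin (n + 1) → ℝ) : pathDist p ρ n x x = 0 := by
  have hp0 : 0 < p := by linarith
  simp [pathDist, baseDist_self, ENNReal.zero_rpow_of_pos hp0, hp0]

theorem metricTopology_pathDist (hp : 1 ≤ p) (hρ : IsCompatible ρ) (n : ℕ) :
    metricTopology (pathDist p ρ n) = Pi.topologicalSpace := by
  ext U
  constructor
  · intro hU
    refine isOpen_iff_forall_mem_open.2 fun x hx => ?_
    obtain ⟨ε, hε, hb⟩ := hU x hx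
    refine ⟨{y | pathDist p ρ n y x < ε}, hb,
      isOpen_lt (continuous_pathDist hρ n x) continuous_const, ?_⟩
    change pathDist p ρ n x x < ε
    rwa [pathDist_self hp]
  · intro hU x hx
    obtain ⟨u, hu, huU⟩ := isOpen_pi_iff'.1 hU x hx
    have hball : ∀ i, ∃ ε > 0, ∀ y, baseDist ρ y (x i) < ε → y ∈ u i := by
      intro i
      have h := (hu i).1
      rw [← metricTopology_baseDist hρ] at h
      exact h (x i) (hu i).2
    choose ε hε hb using hball
    refine ⟨Finset.univ.inf ε, (Finset.lt_inf_iff (by simp)).2 fun i _ => hε i, fun y hy => ?_⟩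
    refine huU fun i _ => hb i _ ?_
    exact (baseDist_le_pathDist hp y x i).trans_lt
      (hy.trans_le (Finset.inf_le (Finset.mem_univ i)))

theorem isSepDist_pathDist (hp : 1 ≤ p) (hρ : IsCompatible ρ) (n : ℕ) :
    IsSepDist (pathDist p ρ n) where
  self := pathDist_self hp
  comm x y := by simp only [pathDist, baseDist_comm ρ]
  triangle x y z := by
    refine le_trans ?_ (ENNReal.Lp_add_le Finset.univ (fun i => baseDist ρ (x i) (y i))
      (fun i => baseDist ρ (y i) (z i)) hp)
    refine ENNReal.rpow_le_rpow (Finset.sum_le_sum fun i _ => ?_) (by positivity)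
    exact rpow_le_rpow' hp (baseDist_triangle ρ _ _ _)
  ne_top x y := by
    refine ENNReal.rpow_ne_top_of_nonneg (by positivity) (ENNReal.sum_ne_top.2 fun i _ => ?_)
    exact ENNReal.rpow_ne_top_of_nonneg (by linarith) (baseDist_ne_top ρ _ _)
  eq_of_zero x y h := by
    ext i
    exact eq_of_baseDist_eq_zero ρ _ _
      (le_antisymm ((baseDist_le_pathDist hp x y i).trans_eq h) bot_le)
  dense := by
    refine ⟨TopologicalSpace.denseSeq _, fun x ε hε => ?_⟩
    obtain ⟨y, hy, k, rfl⟩ := (TopologicalSpace.denseRange_denseSeq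
      (Fin (n + 1) → ℝ)).inter_open_nonempty {y | pathDist p ρ n y x < ε}
      (isOpen_lt (continuous_pathDist hρ n x) continuous_const)
      ⟨x, by simpa [pathDist_self hp] using hε⟩
    refine ⟨k, ?_⟩
    have : pathDist p ρ n (TopologicalSpace.denseSeq (Fin (n + 1) → ℝ) k) x < ε := hy
    simpa only [pathDist, baseDist_comm ρ] using this
  borel := by
    rw [metricTopology_pathDist hp hρ]
    exact BorelSpace.measurable_eq

end Base

/-! ### The spaces of nested distributions -/

section Nested

variable {p : ℝ} {ρ : MetricSpace ℝ}

theorem isSepDist_next (hp : 1 ≤ p) (hρ : IsCompatible ρ) {X : DistSpace} (h : IsSepDist X.d) :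
    IsSepDist (X.next hp ρ).d := by
  let _ : MeasurableSpace (PMoment p X.d) := @borel _ (metricTopology PMoment.dist)
  have hW : IsSepDist (PMoment.dist (p := p) (d := X.d)) := h.isSepDist_pMoment hp
  refine ⟨(X.next hp ρ).d_self, fun a b => ?_, fun a b c => ?_, fun a b => ?_, fun a b h0 => ?_, ?_,
    rfl⟩
  · simp only [DistSpace.next, baseDist_comm ρ a.1]
    rw [h.wasserstein_comm hp]
  · exact lp_triangle hp (baseDist_triangle ρ _ _ _) (hW.triangle a.2 b.2 c.2)
  · refine ENNReal.rpow_ne_top_of_nonneg (by positivity) (ENNReal.add_ne_top.2 ⟨?_, ?_⟩)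
    · exact ENNReal.rpow_ne_top_of_nonneg (by linarith) (baseDist_ne_top ρ _ _)
    · exact ENNReal.rpow_ne_top_of_nonneg (by linarith) (hW.ne_top a.2 b.2)
  · refine Prod.ext ?_ ?_
    · exact eq_of_baseDist_eq_zero ρ _ _ (le_antisymm ((le_lp_left hp _ _).trans_eq h0) bot_le)
    · exact hW.eq_of_zero _ _ (le_antisymm ((le_lp_right hp _ _).trans_eq h0) bot_le)
  · obtain ⟨s, hs⟩ := exists_dense_baseDist hρ
    obtain ⟨S, hS⟩ := hW.dense
    refine ⟨fun n => (s n.unpair.1, S n.unpair.2), fun a ε hε => ?_⟩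
    have hε2 := ENNReal.half_pos hε.ne'
    obtain ⟨i, hi⟩ := hs a.1 _ hε2
    obtain ⟨j, hj⟩ := hS a.2 _ hε2
    refine ⟨Nat.pair i j, (lp_le_add hp _ _).trans_lt ?_⟩
    simp only [Nat.unpair_pair]
    exact (ENNReal.add_lt_add hi hj).trans_eq (ENNReal.add_halves ε)

theorem isSepDist_nestedSpace (hp : 1 ≤ p) (hρ : IsCompatible ρ) (k : ℕ) :
    IsSepDist (nestedSpace hp ρ k).d := by
  induction k with
  | zero =>
    have h := isSepDist_baseDist hρ
    exact ⟨h.self, h.comm, h.triangle, h.ne_top, h.eq_of_zero, h.dense, rfl⟩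
  | succ k ih => exact isSepDist_next hp hρ ih

theorem isCompleteDist_next (hp : 1 ≤ p) {X : DistSpace} (h : IsSepDist X.d)
    (hρ : IsCompleteDist (baseDist ρ)) (hX : IsCompleteDist X.d) :
    IsCompleteDist (X.next hp ρ).d := by
  intro u hu
  have hp0 : 0 < p := by linarith
  obtain ⟨x, hx⟩ := hρ (fun n => (u n).1) (ne_top_of_le_ne_top hu
    (ENNReal.tsum_le_tsum fun n => le_lp_left hp _ _))
  obtain ⟨P, hP⟩ := h.isCompleteDist_pMoment hp hX (fun n => (u n).2) (ne_top_of_le_ne_top hu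
    (ENNReal.tsum_le_tsum fun n => le_lp_right hp _ _))
  refine ⟨(x, P), ?_⟩
  have hsum := hx.add hP
  rw [add_zero] at hsum
  exact tendsto_of_tendsto_of_tendsto_of_le_of_le tendsto_const_nhds hsum (fun _ => zero_le)
    fun n => lp_le_add hp _ _

theorem isCompleteDist_baseDist
    (hc : @CompleteSpace ℝ ρ.toPseudoMetricSpace.toUniformSpace) :
    IsCompleteDist (baseDist ρ) := by
  intro u hu
  have hcau := @cauchySeq_of_edist_le_of_tsum_ne_top ℝ
    ρ.toPseudoMetricSpace.toPseudoEMetricSpace u (fun n => baseDist ρ (u n) (u (n + 1)))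
    (fun n => le_rfl) hu
  obtain ⟨x, hx⟩ := @cauchySeq_tendsto_of_complete ℝ ℕ ρ.toPseudoMetricSpace.toUniformSpace _ hc u
    hcau
  exact ⟨x,
    (@tendsto_iff_edist_tendsto_0 ℝ ℕ ρ.toPseudoMetricSpace.toPseudoEMetricSpace _ _ _).1 hx⟩

theorem isCompleteDist_nestedSpace (hp : 1 ≤ p) (hρ : IsCompatible ρ)
    (hc : @CompleteSpace ℝ ρ.toPseudoMetricSpace.toUniformSpace) (k : ℕ) :
    IsCompleteDist (nestedSpace hp ρ k).d := by
  induction k with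
  | zero => exact isCompleteDist_baseDist hc
  | succ k ih =>
    exact isCompleteDist_next hp (isSepDist_nestedSpace hp hρ k) (isCompleteDist_baseDist hc) ih

theorem IsSepDist.completeSpace {X : Type} [MeasurableSpace X] {d : X → X → ℝ≥0∞}
    (h : IsSepDist d) (hc : IsCompleteDist d) :
    @CompleteSpace X h.metricSpace.toPseudoMetricSpace.toUniformSpace := by
  let _ := h.metricSpace
  refine EMetric.complete_of_convergent_controlled_sequences (fun n => 2⁻¹ ^ n)
    (fun n => ENNReal.pow_pos (by simp) n)
    fun u hu => ?_
  have hsum : ∑' n, d (u n) (u (n + 1)) ≠ ∞ := by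
    refine ne_top_of_le_ne_top ?_
      (ENNReal.tsum_le_tsum fun n => (hu n n (n + 1) le_rfl (Nat.le_succ n)).le)
    rw [ENNReal.tsum_geometric]
    simp
  obtain ⟨x, hx⟩ := hc u hsum
  exact ⟨x, tendsto_iff_edist_tendsto_0.2 hx⟩

theorem IsSepDist.separableSpace {X : Type} [MeasurableSpace X] {d : X → X → ℝ≥0∞}
    (h : IsSepDist d) :
    @TopologicalSpace.SeparableSpace X
      h.metricSpace.toPseudoMetricSpace.toUniformSpace.toTopologicalSpace := by
  obtain ⟨s, hs⟩ := h.dense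
  exact IsSepDist.separableSpace_of_dense h.metricSpace.toPseudoMetricSpace.toPseudoEMetricSpace
    s hs

end Nested

/-! ### Conditional laws -/

section CondExpKernel

variable {Ω : Type} {m : MeasurableSpace Ω} [mΩ : MeasurableSpace Ω] [StandardBorelSpace Ω]
  {μ : Measure Ω} [IsFiniteMeasure μ]

/-- The defining property of the conditional expectation kernel, for functions of two variables the
first of which only enters through the conditioning `σ`-algebra. -/
theorem lintegral_lintegral_condExpKernel (hm : m ≤ mΩ) {f : Ω → Ω → ℝ≥0∞}
    (hf : @Measurable _ _ (m.prod mΩ) _ (Function.uncurry f)) :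
    ∫⁻ ω, ∫⁻ ω', f ω ω' ∂condExpKernel μ m ω ∂μ = ∫⁻ ω, f ω ω ∂μ := by
  have hdiag : @Measurable _ _ mΩ (m.prod mΩ) (Function.diag (α := Ω)) :=
    Measurable.prodMk (measurable_id'' hm) measurable_id
  have h1 := congrArg (fun η => @lintegral (Ω × Ω) (m.prod mΩ) η (Function.uncurry f))
    (compProd_trim_condExpKernel (μ := μ) hm)
  rw [Measure.lintegral_compProd hf] at h1
  have h2 : Measurable[m] fun ω => ∫⁻ ω', f ω ω' ∂condExpKernel μ m ω :=
    @Measurable.lintegral_kernel_prod_right Ω Ω m mΩ (condExpKernel μ m) _ f hf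
  rw [← lintegral_trim hm h2]
  exact h1.trans (@lintegral_map Ω (Ω × Ω) mΩ (m.prod mΩ) μ _ _ hf hdiag)

theorem lintegral_condExpKernel (hm : m ≤ mΩ) {f : Ω → ℝ≥0∞} (hf : Measurable f) :
    ∫⁻ ω, ∫⁻ ω', f ω' ∂condExpKernel μ m ω ∂μ = ∫⁻ ω, f ω ∂μ :=
  lintegral_lintegral_condExpKernel hm (f := fun _ ω' => f ω')
    (hf.comp (@measurable_snd _ _ m mΩ))

theorem lintegral_mul_condExpKernel (hm : m ≤ mΩ) {u v : Ω → ℝ≥0∞} (hu : Measurable[m] u)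
    (hv : Measurable v) :
    ∫⁻ ω, u ω * ∫⁻ ω', v ω' ∂condExpKernel μ m ω ∂μ = ∫⁻ ω, u ω * v ω ∂μ := by
  refine Eq.trans (lintegral_congr fun ω => (lintegral_const_mul _ hv).symm)
    (lintegral_lintegral_condExpKernel hm (f := fun ω ω' => u ω * v ω') ?_)
  have h1 : @Measurable _ _ (m.prod mΩ) _ fun z : Ω × Ω => u z.1 :=
    hu.comp (@measurable_fst _ _ m mΩ)
  have h2 : @Measurable _ _ (m.prod mΩ) _ fun z : Ω × Ω => v z.2 :=
    hv.comp (@measurable_snd _ _ m mΩ)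
  exact h1.mul h2

end CondExpKernel

section Past

variable {n : ℕ}

theorem past_le (n t : ℕ) : past n t ≤ MeasurableSpace.pi := by
  refine Measurable.comap_le ?_
  fun_prop

theorem measurable_past_eval {t : ℕ} {i : Fin (n + 1)} (hi : i.val < t) :
    Measurable[past n t] fun x : Fin (n + 1) → ℝ => x i :=
  (measurable_pi_apply (⟨i, hi⟩ : {i : Fin (n + 1) // i.val < t})).comp
    (comap_measurable fun (x : Fin (n + 1) → ℝ) (i : {i : Fin (n + 1) // i.val < t}) => x i)

theorem past_mono {s t : ℕ} (hst : s ≤ t) : past n s ≤ past n t := by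
  refine @Measurable.comap_le _ _ (past n t) _ _ ?_
  exact @measurable_pi_lambda _ _ _ (past n t) _ _ fun i =>
    measurable_past_eval (i.2.trans_le hst)

theorem past_zero : past n 0 = ⊥ := by
  have : (fun (x : Fin (n + 1) → ℝ) (i : {i : Fin (n + 1) // i.val < 0}) => x i)
      = fun _ i => absurd i.2 (Nat.not_lt_zero _) := by
    ext x i
    exact absurd i.2 (Nat.not_lt_zero _)
  rw [past, this, MeasurableSpace.comap_const]

variable {μ : Measure (Fin (n + 1) → ℝ)} [IsFiniteMeasure μ] {X : DistSpace}

theorem measurable_condLaw (t : ℕ) {Z : (Fin (n + 1) → ℝ) → X.carrier} (hZ : Measurable Z) :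
    Measurable[past n t] (condLaw μ t Z) :=
  (Measure.measurable_map Z hZ).comp (condExpKernel μ (past n t)).measurable

theorem isProbabilityMeasure_condLaw (t : ℕ) {Z : (Fin (n + 1) → ℝ) → X.carrier}
    (hZ : Measurable Z) (ω : Fin (n + 1) → ℝ) : IsProbabilityMeasure (condLaw μ t Z ω) :=
  Measure.isProbabilityMeasure_map hZ.aemeasurable

theorem lintegral_condLaw (t : ℕ) {Z : (Fin (n + 1) → ℝ) → X.carrier} (hZ : Measurable Z)
    {f : X.carrier → ℝ≥0∞} (hf : Measurable f) (ω : Fin (n + 1) → ℝ) :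
    ∫⁻ x, f x ∂condLaw μ t Z ω = ∫⁻ ω', f (Z ω') ∂condExpKernel μ (past n t) ω :=
  lintegral_map hf hZ

theorem lintegral_lintegral_condLaw (t : ℕ) {Z : (Fin (n + 1) → ℝ) → X.carrier}
    (hZ : Measurable Z) {f : X.carrier → ℝ≥0∞} (hf : Measurable f) :
    ∫⁻ ω, ∫⁻ x, f x ∂condLaw μ t Z ω ∂μ = ∫⁻ ω, f (Z ω) ∂μ := by
  simp_rw [lintegral_condLaw t hZ hf]
  exact lintegral_condExpKernel (past_le n t) (hf.comp hZ)

end Past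

/-! ### Measures as elements of `𝒫ᵖ(X)` -/

section OfMeasure

variable {X : DistSpace} {p : ℝ} {ρ : MetricSpace ℝ}

theorem toMeasure_ofMeasure (hp : 1 ≤ p) {P : Measure X.carrier} (hP : IsProbabilityMeasure P)
    {x₀ : X.carrier} (hm : ∫⁻ x, X.d x x₀ ^ p ∂P < ∞) :
    (X.ofMeasure hp P).toMeasure = P := by
  have h : X.ofMeasure hp P = ⟨P, hP, x₀, hm⟩ := dif_pos ⟨hP, x₀, hm⟩
  rw [h]
  rfl

theorem wasserstein_dirac_rpow_le (h : IsSepDist X.d) (hp : 1 ≤ p) (P : Measure X.carrier)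
    [IsProbabilityMeasure P] (x₀ : X.carrier) :
    wasserstein p X.d P (Measure.dirac x₀) ^ p ≤ ∫⁻ x, X.d x x₀ ^ p ∂P := by
  have hm : Measurable fun x : X.carrier => (x, x₀) := measurable_id.prodMk measurable_const
  have hc : P.map (fun x => (x, x₀)) ∈ couplings P (Measure.dirac x₀) := by
    constructor
    · rw [Measure.map_map measurable_fst hm]
      exact Measure.map_id
    · rw [Measure.map_map measurable_snd hm]
      exact (Measure.map_const P x₀).trans (by simp)
  refine (wasserstein_rpow_le hp hc).trans_eq ?_
  rw [lintegral_map (h.measurable.pow_const p) hm]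

/-- A real random variable and a random probability measure together form a random element of
`ℝ × 𝒫ᵖ(X)` with its metric Borel `σ`-algebra. -/
theorem measurable_mk_ofMeasure (h : IsSepDist X.d) (hp : 1 ≤ p) (hρ : IsCompatible ρ) {Ω : Type}
    [MeasurableSpace Ω] {x : Ω → ℝ} {P : Ω → Measure X.carrier} (hx : Measurable x)
    (hP : Measurable P) (hprob : ∀ ω, IsProbabilityMeasure (P ω)) :
    Measurable fun ω => (show (X.next hp ρ).carrier from (x ω, X.ofMeasure hp (P ω))) := by
  classical
  refine (isSepDist_next hp hρ h).measurable_of_dist fun y => ?_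
  have hbase : Measurable fun ω => baseDist ρ (x ω) y.1 :=
    (isSepDist_baseDist hρ).measurable_comp hx measurable_const
  have hd : Measurable fun z => X.d z X.base ^ p :=
    (h.measurable_comp measurable_id measurable_const).pow_const p
  have hmom : MeasurableSet {ω | ∫⁻ z, X.d z X.base ^ p ∂P ω < ∞} :=
    measurableSet_lt ((Measure.measurable_lintegral hd).comp hP) measurable_const
  obtain ⟨V, hV, hVW⟩ := h.exists_measurable_eq_wasserstein hp
  have hW : (fun ω => wasserstein p X.d (X.ofMeasure hp (P ω)).toMeasure y.2.toMeasure)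
      = fun ω => if ∫⁻ z, X.d z X.base ^ p ∂P ω < ∞ then V (P ω) y.2.toMeasure
        else wasserstein p X.d (X.diracBase hp).toMeasure y.2.toMeasure := by
    ext ω
    have := hprob ω
    split_ifs with hω
    · rw [toMeasure_ofMeasure hp this hω,
        hVW _ _ X.base hω (PMoment.lintegral_lt_top h hp y.2 _)]
    · have hd : X.ofMeasure hp (P ω) = X.diracBase hp :=
        dif_neg fun ⟨_, x₀, hx₀⟩ => hω (h.moment_lt_top hp hx₀ _)
      rw [hd]
  have hWm : Measurable fun ω =>
      wasserstein p X.d (X.ofMeasure hp (P ω)).toMeasure y.2.toMeasure := by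
    rw [hW]
    exact Measurable.ite hmom (hV.comp (hP.prodMk measurable_const)) measurable_const
  exact ((hbase.pow_const p).add (hWm.pow_const p)).pow_const (1 / p)

end OfMeasure

/-! ### The iterated conditional laws -/

section Iterated

variable {n : ℕ} {p : ℝ} {ρ : MetricSpace ℝ} {μ : Measure (Fin (n + 1) → ℝ)}
  [IsProbabilityMeasure μ]

/-- The iterated conditional law with index `k` belongs to time `n + 1 - k`, and is adapted. -/
theorem measurable_iterated (hp : 1 ≤ p) (hρ : IsCompatible ρ) (k : ℕ) (hk : k ≤ n) :
    Measurable[past n (n + 1 - k)] (iterated hp ρ μ k) := by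
  induction k with
  | zero =>
    have h : Measurable[past n (n + 1)] fun x : Fin (n + 1) → ℝ => x ⟨n, by omega⟩ :=
      measurable_past_eval (by simp)
    refine @IsSepDist.measurable_of_dist _ _ _ (isSepDist_nestedSpace hp hρ 0) _ (past n (n + 1)) _
      fun y => ?_
    have h2 : Measurable fun x : ℝ => baseDist ρ x y :=
      (isSepDist_baseDist hρ).measurable_comp measurable_id measurable_const
    exact h2.comp h
  | succ k ih =>
    have hZ : Measurable (iterated hp ρ μ k) := (ih (by omega)).mono (past_le _ _) le_rfl
    have hc : Measurable[past n (n - k)] (condLaw μ (n - k) (iterated hp ρ μ k)) :=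
      measurable_condLaw _ hZ
    have hx : Measurable[past n (n - k)]
        fun x : Fin (n + 1) → ℝ => x ⟨n - (k + 1), by omega⟩ :=
      measurable_past_eval (by simp only; omega)
    have hnk : n + 1 - (k + 1) = n - k := by omega
    rw [hnk]
    exact @measurable_mk_ofMeasure _ _ _ (isSepDist_nestedSpace hp hρ k) hp hρ _ (past n (n - k))
      _ _ hx hc fun ω => isProbabilityMeasure_condLaw _ hZ ω

theorem measurable_iterated' (hp : 1 ≤ p) (hρ : IsCompatible ρ) (k : ℕ) (hk : k ≤ n) :
    Measurable (iterated hp ρ μ k) :=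
  (measurable_iterated hp hρ k hk).mono (past_le _ _) le_rfl

/-- If the random element `Z` has finite moments, then almost surely so do its conditional laws. -/
theorem ae_condLaw_moment {X : DistSpace} (h : IsSepDist X.d) (t : ℕ)
    {Z : (Fin (n + 1) → ℝ) → X.carrier} (hZ : Measurable Z) {x₀ : X.carrier}
    (hm : ∫⁻ ω, X.d (Z ω) x₀ ^ p ∂μ < ∞) :
    ∀ᵐ ω ∂μ, ∫⁻ x, X.d x x₀ ^ p ∂condLaw μ t Z ω < ∞ := by
  have hd : Measurable fun z => X.d z x₀ ^ p :=
    (h.measurable_comp measurable_id measurable_const).pow_const p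
  have hlaw : Measurable (condLaw μ t Z) := (measurable_condLaw t hZ).mono (past_le _ _) le_rfl
  refine ae_lt_top ((Measure.measurable_lintegral hd).comp hlaw) ?_
  rw [lintegral_lintegral_condLaw t hZ hd]
  exact hm.ne

/-- Almost surely the default value in the definition of `iterated` does not occur. -/
theorem ae_toMeasure_tail {hp : 1 ≤ p} (hρ : IsCompatible ρ) {k : ℕ} (hk : k < n)
    (hm : ∫⁻ ω, (nestedSpace hp ρ k).d (iterated hp ρ μ k ω) (nestedSpace hp ρ k).base ^ p ∂μ < ∞) :
    ∀ᵐ ω ∂μ, (tail (iterated hp ρ μ (k + 1) ω)).toMeasure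
      = condLaw μ (n - k) (iterated hp ρ μ k) ω := by
  have hZ := measurable_iterated' (μ := μ) hp hρ k hk.le
  filter_upwards [ae_condLaw_moment (isSepDist_nestedSpace hp hρ k) (n - k) hZ hm] with ω hω
  exact toMeasure_ofMeasure hp (isProbabilityMeasure_condLaw _ hZ ω) hω

/-- The moments of the iterated conditional laws are bounded by those of `μ`: the `p`-th power of
the distance of a law to a Dirac measure is at most the moment of the law, and conditioning
preserves expectations. -/
theorem lintegral_iterated_lt_top (hp : 1 ≤ p) (hρ : IsCompatible ρ)
    (hμ : ∫⁻ ω, pathDist p ρ n ω 0 ^ p ∂μ < ∞) (k : ℕ) (hk : k ≤ n) :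
    ∫⁻ ω, (nestedSpace hp ρ k).d (iterated hp ρ μ k ω) (nestedSpace hp ρ k).base ^ p ∂μ < ∞ := by
  have hcoord : ∀ i, ∫⁻ ω, baseDist ρ (ω i) 0 ^ p ∂μ < ∞ := fun i =>
    (lintegral_mono fun ω => rpow_le_rpow' hp (baseDist_le_pathDist hp ω 0 i)).trans_lt hμ
  induction k with
  | zero => exact hcoord ⟨n, by omega⟩
  | succ k ih =>
    have ih := ih (by omega)
    have h := isSepDist_nestedSpace hp hρ k
    have hZ := measurable_iterated' (μ := μ) hp hρ k (by omega)
    have hd : Measurable fun z => (nestedSpace hp ρ k).d z (nestedSpace hp ρ k).base ^ p :=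
      (h.measurable_comp measurable_id measurable_const).pow_const p
    have hb : Measurable fun ω : Fin (n + 1) → ℝ => baseDist ρ (ω ⟨n - (k + 1), by omega⟩) 0 ^ p :=
      ((isSepDist_baseDist hρ).measurable_comp (measurable_pi_apply _) measurable_const).pow_const p
    calc ∫⁻ ω, (nestedSpace hp ρ (k + 1)).d (iterated hp ρ μ (k + 1) ω)
          (nestedSpace hp ρ (k + 1)).base ^ p ∂μ
        = ∫⁻ ω, (baseDist ρ (ω ⟨n - (k + 1), by omega⟩) 0 ^ p
            + wasserstein p (nestedSpace hp ρ k).d (tail (iterated hp ρ μ (k + 1) ω)).toMeasure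
              (Measure.dirac (nestedSpace hp ρ k).base) ^ p) ∂μ :=
          lintegral_congr fun ω => rpow_inv_rpow' hp _
      _ ≤ ∫⁻ ω, (baseDist ρ (ω ⟨n - (k + 1), by omega⟩) 0 ^ p
            + ∫⁻ x, (nestedSpace hp ρ k).d x (nestedSpace hp ρ k).base ^ p
              ∂condLaw μ (n - k) (iterated hp ρ μ k) ω) ∂μ := by
          refine lintegral_mono_ae ?_
          filter_upwards [ae_toMeasure_tail hρ (by omega) ih] with ω hω
          have := isProbabilityMeasure_condLaw (μ := μ) (n - k) hZ ω
          rw [hω]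
          exact add_le_add le_rfl (wasserstein_dirac_rpow_le h hp _ _)
      _ = ∫⁻ ω, baseDist ρ (ω ⟨n - (k + 1), by omega⟩) 0 ^ p ∂μ
            + ∫⁻ ω, (nestedSpace hp ρ k).d (iterated hp ρ μ k ω) (nestedSpace hp ρ k).base ^ p
              ∂μ := by
          rw [lintegral_add_left hb, lintegral_lintegral_condLaw (n - k) hZ hd]
      _ < ∞ := ENNReal.add_lt_top.2 ⟨hcoord _, ih⟩

theorem iteratedLawWellDefined (hp : 1 ≤ p) (hρ : IsCompatible ρ) (μ : PathLaw p ρ n) :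
    IteratedLawWellDefined hp ρ n μ := by
  have hμ := PMoment.lintegral_lt_top (isSepDist_pathDist hp hρ n) hp μ 0
  have hmom := lintegral_iterated_lt_top (μ := μ.toMeasure) hp hρ hμ
  refine ⟨fun k hk => measurable_iterated' hp hρ k hk,
    fun k hk => ae_toMeasure_tail hρ hk (hmom k hk.le), ?_⟩
  have hZ := measurable_iterated' (μ := μ.toMeasure) hp hρ n le_rfl
  refine toMeasure_ofMeasure hp (Measure.isProbabilityMeasure_map hZ.aemeasurable)
    (x₀ := (nestedSpace hp ρ n).base) ?_
  have h := isSepDist_nestedSpace hp hρ n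
  have hd : Measurable fun z => (nestedSpace hp ρ n).d z (nestedSpace hp ρ n).base ^ p :=
    (h.measurable_comp measurable_id measurable_const).pow_const p
  rw [lintegral_map hd hZ]
  exact hmom n le_rfl

end Iterated

/-! ### Conditional laws under a bicausal plan -/

theorem prod_le_prod {Ω : Type} {m mΩ : MeasurableSpace Ω} (hm : m ≤ mΩ) : m.prod m ≤ mΩ.prod mΩ :=
  sup_le_sup (MeasurableSpace.comap_mono hm) (MeasurableSpace.comap_mono hm)

section Causal

variable {Ω : Type} {m : MeasurableSpace Ω} [mΩ : MeasurableSpace Ω] [StandardBorelSpace Ω]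
  {μ : Measure Ω} [IsFiniteMeasure μ] {γ : Measure (Ω × Ω)} [IsFiniteMeasure γ]

/-- The conditional law of `T` under `γ` given `m ⊗ m` is the conditional law under `μ` given `m`,
provided this can be verified by integration over `m`-measurable rectangles. -/
theorem ae_map_condExpKernel_prod (hm : m ≤ mΩ) {T : Ω × Ω → Ω} (hT : Measurable T)
    (hTm : Measurable[m.prod m, m] T)
    (h : ∀ A B C : Set Ω, MeasurableSet[m] A → MeasurableSet[m] B → MeasurableSet C →
      ∫⁻ z in A ×ˢ B, (T ⁻¹' C).indicator 1 z ∂γ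
        = ∫⁻ z in A ×ˢ B, condExpKernel μ m (T z) C ∂γ) :
    ∀ᵐ z ∂γ, (condExpKernel γ (m.prod m) z).map T = condExpKernel μ m (T z) := by
  have hmm := prod_le_prod hm
  let η₁ : @Kernel (Ω × Ω) Ω (m.prod m) mΩ := (condExpKernel γ (m.prod m)).map T
  let η₂ : @Kernel (Ω × Ω) Ω (m.prod m) mΩ :=
    @Kernel.comap Ω Ω m mΩ (Ω × Ω) (m.prod m) (condExpKernel μ m) T hTm
  have hη₁ : @IsMarkovKernel _ _ (m.prod m) mΩ η₁ := Kernel.IsMarkovKernel.map _ hT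
  have hη₂ : @IsMarkovKernel _ _ (m.prod m) mΩ η₂ := Kernel.IsMarkovKernel.comap _ hTm
  have hfin : @IsFiniteMeasure _ (m.prod m) (γ.trim hmm) := isFiniteMeasure_trim hmm
  have key : @Measure.compProd _ _ (m.prod m) mΩ (γ.trim hmm) η₁
      = @Measure.compProd _ _ (m.prod m) mΩ (γ.trim hmm) η₂ := by
    refine @Measure.ext_prod₃' Ω Ω Ω m m mΩ _ _ _ fun {A B C} hA hB hC => ?_
    have hAB : @MeasurableSet _ (m.prod m) (A ×ˢ B) := @MeasurableSet.prod _ _ m m _ _ hA hB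
    have hAB' : MeasurableSet (A ×ˢ B) := hmm _ hAB
    have hTC : MeasurableSet (T ⁻¹' C) := hT hC
    rw [@Measure.compProd_apply_prod _ _ (m.prod m) mΩ _ _ _ _ _ _ hAB hC,
      @Measure.compProd_apply_prod _ _ (m.prod m) mΩ _ _ _ _ _ _ hAB hC,
      ← @lintegral_indicator _ (m.prod m) _ _ hAB, ← @lintegral_indicator _ (m.prod m) _ _ hAB]
    have h1 : Measurable[m.prod m] ((A ×ˢ B).indicator fun z => η₁ z C) :=
      @Measurable.indicator _ _ _ _ (m.prod m) _ _ (η₁.measurable_coe hC) hAB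
    have h2 : Measurable[m.prod m] ((A ×ˢ B).indicator fun z => η₂ z C) :=
      @Measurable.indicator _ _ _ _ (m.prod m) _ _ (η₂.measurable_coe hC) hAB
    rw [lintegral_trim hmm h1, lintegral_trim hmm h2, lintegral_indicator hAB',
      lintegral_indicator hAB']
    refine Eq.trans ?_ (h A B C hA hB hC)
    rw [← lintegral_indicator hAB', ← lintegral_indicator hAB']
    have hind : ∀ (φ : Ω × Ω → ℝ≥0∞) (z : Ω × Ω),
        (A ×ˢ B).indicator φ z = (A ×ˢ B).indicator 1 z * φ z := fun φ z => by
      by_cases hz : z ∈ A ×ˢ B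
      · rw [Set.indicator_of_mem hz, Set.indicator_of_mem hz, Pi.one_apply, one_mul]
      · rw [Set.indicator_of_notMem hz, Set.indicator_of_notMem hz, zero_mul]
    rw [lintegral_congr (hind _), lintegral_congr (hind _)]
    refine Eq.trans ?_ (lintegral_mul_condExpKernel hmm
      (@Measurable.indicator _ _ _ _ (m.prod m) _ _ (@measurable_const _ _ _ (m.prod m) 1) hAB)
      (measurable_one.indicator hTC))
    refine lintegral_congr fun z => ?_
    rw [lintegral_indicator_one hTC]
    simp only [η₁]
    rw [Kernel.map_apply' _ hT _ hC]
  filter_upwards [ae_of_ae_trim hmm (Kernel.ae_eq_of_compProd_eq key)] with z hz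
  simp only [η₁, η₂] at hz
  rw [Kernel.map_apply _ hT, Kernel.comap_apply] at hz
  exact hz

/-- Causality means conditional independence: given the past of the first coordinate, the first
coordinate is independent of the past of the second coordinate. -/
theorem setLIntegral_fst_of_causal (hm : m ≤ mΩ) [Nonempty Ω] (hγ : γ.map Prod.fst = μ)
    (hc : ∀ B : Set Ω, MeasurableSet[m] B → ∃ g : Ω → ℝ≥0∞, Measurable[m] g ∧
      (fun x => γ.condKernel x B) =ᵐ[γ.fst] g)
    {A B : Set Ω} (hA : MeasurableSet[m] A) (hB : MeasurableSet[m] B) {f : Ω → ℝ≥0∞}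
    (hf : Measurable f) :
    ∫⁻ z in A ×ˢ B, f z.1 ∂γ = ∫⁻ z in A ×ˢ B, ∫⁻ ω, f ω ∂condExpKernel μ m z.1 ∂γ := by
  obtain ⟨g, hg, hgB⟩ := hc B hB
  have hfst : γ.fst = μ := hγ
  rw [hfst] at hgB
  have hf' : Measurable[m] fun x => ∫⁻ ω, f ω ∂condExpKernel μ m x :=
    (Measure.measurable_lintegral hf).comp (condExpKernel μ m).measurable
  have main : ∀ φ : Ω → ℝ≥0∞, Measurable φ →
      ∫⁻ z in A ×ˢ B, φ z.1 ∂γ = ∫⁻ x, A.indicator 1 x * g x * φ x ∂μ := fun φ hφ => by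
    have hφ' : Measurable fun z : Ω × Ω => φ z.1 := hφ.comp measurable_fst
    rw [← Measure.setLIntegral_condKernel hφ' (hm _ hA) (hm _ hB), hfst,
      ← lintegral_indicator (hm _ hA)]
    refine lintegral_congr_ae ?_
    filter_upwards [hgB] with x hx
    by_cases hxA : x ∈ A
    · simp only [Set.indicator_of_mem hxA, lintegral_const,
        Measure.restrict_apply MeasurableSet.univ, Set.univ_inter, hx, Pi.one_apply, one_mul]
      exact mul_comm _ _
    · simp [Set.indicator_of_notMem hxA]
  have hA1 : Measurable[m] (A.indicator (1 : Ω → ℝ≥0∞)) :=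
    @Measurable.indicator _ _ _ _ m _ _ (@measurable_const _ _ _ m 1) hA
  have hAg : Measurable[m] fun x => A.indicator 1 x * g x := hA1.mul hg
  rw [main f hf, main _ (hf'.mono hm le_rfl), lintegral_mul_condExpKernel hm hAg hf]

/-- Under a causal plan, the additional knowledge of the past of the second coordinate does not
change the conditional law of the first coordinate. -/
theorem ae_map_fst_condExpKernel (hm : m ≤ mΩ) [Nonempty Ω] (hγ : γ.map Prod.fst = μ)
    (hc : ∀ B : Set Ω, MeasurableSet[m] B → ∃ g : Ω → ℝ≥0∞, Measurable[m] g ∧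
      (fun x => γ.condKernel x B) =ᵐ[γ.fst] g) :
    ∀ᵐ z ∂γ, (condExpKernel γ (m.prod m) z).map Prod.fst = condExpKernel μ m z.1 := by
  refine ae_map_condExpKernel_prod hm measurable_fst (@measurable_fst _ _ m m)
    fun A B C hA hB hC => ?_
  have := setLIntegral_fst_of_causal hm hγ hc hA hB (measurable_one.indicator hC)
  simp_rw [lintegral_indicator_one hC] at this
  exact this

theorem ae_map_snd_condExpKernel (hm : m ≤ mΩ) [Nonempty Ω] (hγ : γ.map Prod.snd = μ)
    (hc : ∀ B : Set Ω, MeasurableSet[m] B → ∃ g : Ω → ℝ≥0∞, Measurable[m] g ∧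
      (fun x => (γ.map Prod.swap).condKernel x B) =ᵐ[(γ.map Prod.swap).fst] g) :
    ∀ᵐ z ∂γ, (condExpKernel γ (m.prod m) z).map Prod.snd = condExpKernel μ m z.2 := by
  refine ae_map_condExpKernel_prod hm measurable_snd (@measurable_snd _ _ m m)
    fun A B C hA hB hC => ?_
  have hγ' : (γ.map Prod.swap).map Prod.fst = μ := by
    rw [Measure.map_map measurable_fst measurable_swap]
    exact hγ
  have := setLIntegral_fst_of_causal hm hγ' hc hB hA (measurable_one.indicator hC)
  simp_rw [lintegral_indicator_one hC] at this
  have hBA : MeasurableSet (B ×ˢ A) := (hm _ hB).prod (hm _ hA)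
  have hmeas : Measurable fun z : Ω × Ω => condExpKernel μ m z.1 C :=
    (((condExpKernel μ m).measurable_coe hC).mono hm le_rfl).comp measurable_fst
  have hind : Measurable fun z : Ω × Ω => C.indicator (1 : Ω → ℝ≥0∞) z.1 :=
    (measurable_one.indicator hC).comp measurable_fst
  rw [setLIntegral_map hBA hind measurable_swap,
    setLIntegral_map hBA hmeas measurable_swap, Set.preimage_swap_prod] at this
  exact this

end Causal

section Lower

variable {n : ℕ} {p : ℝ} {ρ : MetricSpace ℝ} {μ ν : Measure (Fin (n + 1) → ℝ)}
  [IsProbabilityMeasure μ] [IsProbabilityMeasure ν]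

/-- Under a bicausal plan, the conditional joint laws of `(Z, Z')` given the past couple the
conditional laws of `Z` and `Z'`. -/
theorem lintegral_wasserstein_condLaw_le (hp : 1 ≤ p) {X : DistSpace} (h : IsSepDist X.d)
    {γ : Measure ((Fin (n + 1) → ℝ) × (Fin (n + 1) → ℝ))} (hγ : γ ∈ bicausal μ ν)
    {Z Z' : (Fin (n + 1) → ℝ) → X.carrier} (hZ : Measurable Z) (hZ' : Measurable Z')
    {t : ℕ} (ht : t < n + 1) :
    ∫⁻ z, wasserstein p X.d (condLaw μ t Z z.1) (condLaw ν t Z' z.2) ^ p ∂γ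
      ≤ ∫⁻ z, X.d (Z z.1) (Z' z.2) ^ p ∂γ := by
  obtain ⟨⟨hfst, hsnd⟩, hfin, hc, hc'⟩ := hγ
  have hcost : Measurable fun z : (Fin (n + 1) → ℝ) × (Fin (n + 1) → ℝ) =>
      X.d (Z z.1) (Z' z.2) ^ p :=
    (h.measurable_comp (hZ.comp measurable_fst) (hZ'.comp measurable_snd)).pow_const p
  have hZZ : Measurable (Prod.map Z Z') := hZ.prodMap hZ'
  rw [← lintegral_condExpKernel (prod_le_prod (past_le n t)) hcost]
  refine lintegral_mono_ae ?_
  filter_upwards [ae_map_fst_condExpKernel (past_le n t) hfst (hc t ht),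
    ae_map_snd_condExpKernel (past_le n t) hsnd (hc' t ht)] with z h1 h2
  have hmem : (condExpKernel γ ((past n t).prod (past n t)) z).map (Prod.map Z Z')
      ∈ couplings (condLaw μ t Z z.1) (condLaw ν t Z' z.2) := by
    constructor
    · rw [condLaw, ← h1, Measure.map_map measurable_fst hZZ, Measure.map_map hZ measurable_fst]
      rfl
    · rw [condLaw, ← h2, Measure.map_map measurable_snd hZZ, Measure.map_map hZ' measurable_snd]
      rfl
  refine (wasserstein_rpow_le hp hmem).trans_eq ?_
  rw [lintegral_map (h.measurable.pow_const p) hZZ]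
  rfl

/-- Backward induction in time: the transport cost between the iterated conditional laws under a
bicausal plan is at most the cost of the plan in the remaining coordinates. -/
theorem lintegral_nestedSpace_iterated_le (hp : 1 ≤ p) (hρ : IsCompatible ρ)
    (hμ : ∫⁻ ω, pathDist p ρ n ω 0 ^ p ∂μ < ∞) (hν : ∫⁻ ω, pathDist p ρ n ω 0 ^ p ∂ν < ∞)
    {γ : Measure ((Fin (n + 1) → ℝ) × (Fin (n + 1) → ℝ))} (hγ : γ ∈ bicausal μ ν)
    (k : ℕ) (hk : k ≤ n) :
    ∫⁻ z, (nestedSpace hp ρ k).d (iterated hp ρ μ k z.1) (iterated hp ρ ν k z.2) ^ p ∂γ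
      ≤ ∫⁻ z, ∑ i : Fin (n + 1), (if n - k ≤ i.val then baseDist ρ (z.1 i) (z.2 i) ^ p else 0)
        ∂γ := by
  have hb : ∀ i, Measurable fun z : (Fin (n + 1) → ℝ) × (Fin (n + 1) → ℝ) =>
      baseDist ρ (z.1 i) (z.2 i) ^ p := fun i =>
    ((isSepDist_baseDist hρ).measurable_comp ((measurable_pi_apply i).comp measurable_fst)
      ((measurable_pi_apply i).comp measurable_snd)).pow_const p
  induction k with
  | zero =>
    refine lintegral_mono fun z => ?_
    refine le_trans ?_ (Finset.single_le_sum (fun i _ => zero_le) (Finset.mem_univ ⟨n, by omega⟩))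
    simp only [Nat.sub_zero, le_refl, if_true]
    exact le_rfl
  | succ k ih =>
    have ih := ih (by omega)
    have h := isSepDist_nestedSpace hp hρ k
    have hfst : γ.map Prod.fst = μ := hγ.1.1
    have hsnd : γ.map Prod.snd = ν := hγ.1.2
    have hae : ∀ᵐ z ∂γ, (tail (iterated hp ρ μ (k + 1) z.1)).toMeasure
        = condLaw μ (n - k) (iterated hp ρ μ k) z.1 := by
      have := ae_toMeasure_tail (hp := hp) hρ (by omega)
        (lintegral_iterated_lt_top hp hρ hμ k (by omega))
      have hac : γ.map Prod.fst ≪ μ := hfst.absolutelyContinuous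
      exact ae_of_ae_map measurable_fst.aemeasurable (hac.ae_le this)
    have hae' : ∀ᵐ z ∂γ, (tail (iterated hp ρ ν (k + 1) z.2)).toMeasure
        = condLaw ν (n - k) (iterated hp ρ ν k) z.2 := by
      have := ae_toMeasure_tail (hp := hp) hρ (by omega)
        (lintegral_iterated_lt_top hp hρ hν k (by omega))
      have hac : γ.map Prod.snd ≪ ν := hsnd.absolutelyContinuous
      exact ae_of_ae_map measurable_snd.aemeasurable (hac.ae_le this)
    let i₀ : Fin (n + 1) := ⟨n - (k + 1), by omega⟩
    calc ∫⁻ z, (nestedSpace hp ρ (k + 1)).d (iterated hp ρ μ (k + 1) z.1)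
          (iterated hp ρ ν (k + 1) z.2) ^ p ∂γ
        = ∫⁻ z, (baseDist ρ (z.1 i₀) (z.2 i₀) ^ p + wasserstein p (nestedSpace hp ρ k).d
            (tail (iterated hp ρ μ (k + 1) z.1)).toMeasure
            (tail (iterated hp ρ ν (k + 1) z.2)).toMeasure ^ p) ∂γ :=
          lintegral_congr fun ω => rpow_inv_rpow' hp _
      _ = ∫⁻ z, (baseDist ρ (z.1 i₀) (z.2 i₀) ^ p + wasserstein p (nestedSpace hp ρ k).d
            (condLaw μ (n - k) (iterated hp ρ μ k) z.1)
            (condLaw ν (n - k) (iterated hp ρ ν k) z.2) ^ p) ∂γ := by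
          refine lintegral_congr_ae ?_
          filter_upwards [hae, hae'] with z h1 h2
          rw [h1, h2]
      _ ≤ ∫⁻ z, baseDist ρ (z.1 i₀) (z.2 i₀) ^ p ∂γ + ∫⁻ z, ∑ i : Fin (n + 1),
            (if n - k ≤ i.val then baseDist ρ (z.1 i) (z.2 i) ^ p else 0) ∂γ := by
          rw [lintegral_add_left (hb i₀)]
          refine add_le_add le_rfl (le_trans ?_ ih)
          exact lintegral_wasserstein_condLaw_le hp h hγ (measurable_iterated' hp hρ k (by omega))
            (measurable_iterated' hp hρ k (by omega)) (by omega)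
      _ = ∫⁻ z, ∑ i : Fin (n + 1),
            (if n - (k + 1) ≤ i.val then baseDist ρ (z.1 i) (z.2 i) ^ p else 0) ∂γ := by
          rw [← lintegral_add_left (hb i₀)]
          refine lintegral_congr fun z => ?_
          have h1 : baseDist ρ (z.1 i₀) (z.2 i₀) ^ p
              = ∑ i : Fin (n + 1), if i = i₀ then baseDist ρ (z.1 i) (z.2 i) ^ p else 0 := by
            simp
          rw [h1, ← Finset.sum_add_distrib]
          refine Finset.sum_congr rfl fun i _ => ?_
          have hi : i = i₀ ↔ i.val = n - (k + 1) := Fin.ext_iff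
          by_cases h2 : i.val = n - (k + 1)
          · rw [if_pos (hi.2 h2), if_neg (by omega), if_pos (by omega), add_zero]
          · rw [if_neg (fun h3 => h2 (hi.1 h3)), zero_add]
            by_cases h3 : n - k ≤ i.val
            · rw [if_pos h3, if_pos (by omega)]
            · rw [if_neg h3, if_neg (by omega)]

/-- A bicausal plan of `μ` and `ν`, mapped by the iterated conditional laws, couples `I[μ]` and
`I[ν]` without increasing the cost. -/
theorem nestedLawDist_iteratedLaw_le (hp : 1 ≤ p) (hρ : IsCompatible ρ) (μ ν : PathLaw p ρ n) :
    nestedLawDist hp ρ n (iteratedLaw hp ρ n μ) (iteratedLaw hp ρ n ν) ≤ nestedDist p ρ n μ ν := by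
  have hp0 : 0 < p := by linarith
  refine (ENNReal.le_rpow_inv_iff hp0).2 ?_ |>.trans_eq (by rw [nestedDist, one_div])
  refine le_iInf₂ fun γ hγ => ?_
  have hμ := PMoment.lintegral_lt_top (isSepDist_pathDist hp hρ n) hp μ 0
  have hν := PMoment.lintegral_lt_top (isSepDist_pathDist hp hρ n) hp ν 0
  have hZ := measurable_iterated' (μ := μ.toMeasure) hp hρ n le_rfl
  have hZ' := measurable_iterated' (μ := ν.toMeasure) hp hρ n le_rfl
  have hZZ := hZ.prodMap hZ'
  have hmem : γ.map (Prod.map (iterated hp ρ μ.toMeasure n) (iterated hp ρ ν.toMeasure n))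
      ∈ couplings (iteratedLaw hp ρ n μ).toMeasure (iteratedLaw hp ρ n ν).toMeasure := by
    rw [(iteratedLawWellDefined hp hρ μ).2.2, (iteratedLawWellDefined hp hρ ν).2.2]
    constructor
    · refine Eq.trans ?_ (congrArg (Measure.map (iterated hp ρ μ.toMeasure n)) hγ.1.1)
      rw [Measure.map_map measurable_fst hZZ, Measure.map_map hZ measurable_fst]
      rfl
    · refine Eq.trans ?_ (congrArg (Measure.map (iterated hp ρ ν.toMeasure n)) hγ.1.2)
      rw [Measure.map_map measurable_snd hZZ, Measure.map_map hZ' measurable_snd]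
      rfl
  refine (wasserstein_rpow_le hp hmem).trans ?_
  rw [lintegral_map ((isSepDist_nestedSpace hp hρ n).measurable.pow_const p) hZZ]
  refine (lintegral_nestedSpace_iterated_le hp hρ hμ hν hγ n le_rfl).trans_eq ?_
  refine lintegral_congr fun z => ?_
  rw [pathDist_rpow hp]
  exact Finset.sum_congr rfl fun i _ => if_pos (by omega)

end Lower

/-! ### Densities of conditional couplings -/

section CondDensity

/-- Integrals against a measurable family of probability measures depend measurably on the
parameter. -/
theorem measurable_lintegral_param {α X : Type} {mα : MeasurableSpace α} {mX : MeasurableSpace X}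
    {κ : α → Measure X} (hκ : Measurable κ) (hprob : ∀ a, IsProbabilityMeasure (κ a))
    {g : α → X → ℝ≥0∞} (hg : Measurable (Function.uncurry g)) :
    Measurable fun a => ∫⁻ x, g a x ∂κ a := by
  let K : Kernel α X := ⟨κ, hκ⟩
  have hK : IsMarkovKernel K := ⟨hprob⟩
  exact hg.lintegral_kernel_prod_right (κ := K)

/-- `κ` is a version of the conditional law of `Z` under `μ` given the `σ`-algebra `m`. -/
structure IsCondLaw {Ω X : Type} (m : MeasurableSpace Ω) [mΩ : MeasurableSpace Ω]
    [mX : MeasurableSpace X] (μ : Measure Ω) (Z : Ω → X) (κ : Ω → Measure X) : Prop where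
  measurable : Measurable[m] κ
  prob : ∀ ω, IsProbabilityMeasure (κ ω)
  lintegral_eq : ∀ g : Ω → X → ℝ≥0∞, @Measurable _ _ (m.prod mX) _ (Function.uncurry g) →
    ∫⁻ ω, g ω (Z ω) ∂μ = ∫⁻ ω, ∫⁻ x, g ω x ∂κ ω ∂μ

variable {Ω X : Type} {m : MeasurableSpace Ω} [mΩ : MeasurableSpace Ω] [mX : MeasurableSpace X]
  {μ ν : Measure Ω} {Z Z' : Ω → X} {κ κ' : Ω → Measure X}
  {f : Measure X → Measure X → X → X → ℝ≥0∞}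

/-- A property which holds almost surely under all conditional laws of `Z` holds almost surely. -/
theorem IsCondLaw.ae_of_ae (h : IsCondLaw m μ Z κ) (hm : m ≤ mΩ) (hZ : Measurable Z)
    {s : Set (Ω × X)} (hs : MeasurableSet[m.prod mX] s) (hae : ∀ ω, ∀ᵐ x ∂κ ω, (ω, x) ∈ s) :
    ∀ᵐ ω ∂μ, (ω, Z ω) ∈ s := by
  have hmeas : @Measurable _ _ (m.prod mX) _ (sᶜ.indicator (1 : Ω × X → ℝ≥0∞)) :=
    @Measurable.indicator _ _ _ _ (m.prod mX) _ _ (@measurable_const _ _ _ (m.prod mX) 1) hs.compl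
  have h0 : ∫⁻ ω, sᶜ.indicator (1 : Ω × X → ℝ≥0∞) (ω, Z ω) ∂μ = 0 := by
    rw [h.lintegral_eq (fun ω x => sᶜ.indicator 1 (ω, x)) hmeas]
    refine (lintegral_congr fun ω => ?_).trans lintegral_zero
    refine (lintegral_congr_ae ?_).trans lintegral_zero
    filter_upwards [hae ω] with x hx
    exact Set.indicator_of_notMem (Set.notMem_compl_iff.2 hx) _
  have hle : mΩ.prod mX ≥ m.prod mX := sup_le_sup (MeasurableSpace.comap_mono hm) le_rfl
  have hdiag : Measurable fun ω => sᶜ.indicator (1 : Ω × X → ℝ≥0∞) (ω, Z ω) :=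
    (hmeas.mono hle le_rfl).comp (measurable_id.prodMk hZ)
  rw [lintegral_eq_zero_iff hdiag] at h0
  filter_upwards [h0] with ω hω
  by_contra hns
  have h1 : sᶜ.indicator (1 : Ω × X → ℝ≥0∞) (ω, Z ω) = 1 := Set.indicator_of_mem hns _
  rw [h1] at hω
  exact one_ne_zero hω

variable [IsProbabilityMeasure μ] [IsProbabilityMeasure ν]

theorem measurable_density_comp (hf : Measurable fun z : (Measure X × Measure X) × X × X =>
      f z.1.1 z.1.2 z.2.1 z.2.2) {α : Type} {mα : MeasurableSpace α} {P Q : α → Measure X}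
    {a b : α → X} (hP : Measurable P) (hQ : Measurable Q) (ha : Measurable a) (hb : Measurable b) :
    Measurable fun z => f (P z) (Q z) (a z) (b z) :=
  hf.comp ((hP.prodMk hQ).prodMk (ha.prodMk hb))

/-- A measurable selection of densities of couplings, applied to conditional laws, yields a
density which does not change the past of the second coordinate. -/
theorem ae_lintegral_mul_condDensity (hm : m ≤ mΩ) (hκ : IsCondLaw m μ Z κ)
    (hκ' : IsCondLaw m ν Z' κ') (hZ : Measurable Z)
    (hf : Measurable fun z : (Measure X × Measure X) × X × X => f z.1.1 z.1.2 z.2.1 z.2.2)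
    (hrow : ∀ (P Q : Measure X) [IsProbabilityMeasure P] [IsProbabilityMeasure Q],
      ∀ᵐ a ∂P, ∫⁻ b, f P Q a b ∂Q = 1) :
    ∀ᵐ x ∂μ, ∀ ψ : Ω → ℝ≥0∞, Measurable[m] ψ →
      ∫⁻ y, ψ y * f (κ x) (κ' y) (Z x) (Z' y) ∂ν = ∫⁻ y, ψ y ∂ν := by
  have hκm : Measurable κ := hκ.measurable.mono hm le_rfl
  have hκ'm : Measurable κ' := hκ'.measurable.mono hm le_rfl
  have hr : Measurable fun z : Ω × Ω => ∫⁻ b, f (κ z.1) (κ' z.2) (Z z.1) b ∂κ' z.2 := by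
    refine measurable_lintegral_param (hκ'm.comp measurable_snd) (fun z => hκ'.prob z.2) ?_
    exact measurable_density_comp hf (hκm.comp (measurable_fst.comp measurable_fst))
      (hκ'm.comp (measurable_snd.comp measurable_fst))
      (hZ.comp (measurable_fst.comp measurable_fst))
      measurable_snd
  have hgood : ∀ᵐ x ∂μ, ∀ᵐ y ∂ν, ∫⁻ b, f (κ x) (κ' y) (Z x) b ∂κ' y = 1 := by
    -- For fixed `y` the conditional law of `Z` can be used, hence the exchange of the quantifiers.
    rw [Measure.ae_ae_comm (p := fun x y => ∫⁻ b, f (κ x) (κ' y) (Z x) b ∂κ' y = 1)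
      (hr (measurableSet_singleton 1))]
    refine ae_of_all _ fun y => ?_
    have := hκ'.prob y
    have hs : @Measurable _ _ (m.prod mX) _
        fun z : Ω × X => ∫⁻ b, f (κ z.1) (κ' y) z.2 b ∂κ' y := by
      refine @measurable_lintegral_param _ _ (m.prod mX) _ _ measurable_const
        (fun _ => hκ'.prob y) _ ?_
      exact measurable_density_comp hf (hκ.measurable.comp ((@measurable_fst _ _ m mX).comp
        (@measurable_fst _ _ (m.prod mX) mX))) measurable_const ((@measurable_snd _ _ m mX).comp
        (@measurable_fst _ _ (m.prod mX) mX)) (@measurable_snd _ _ (m.prod mX) mX)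
    exact hκ.ae_of_ae hm hZ (hs (measurableSet_singleton 1)) fun ω => by
      have := hκ.prob ω
      exact hrow (κ ω) (κ' y)
  filter_upwards [hgood] with x hx ψ hψ
  have hmeas : @Measurable _ _ (m.prod mX) _
      (Function.uncurry fun y b => ψ y * f (κ x) (κ' y) (Z x) b) := by
    have h1 : @Measurable _ _ (m.prod mX) _ fun z : Ω × X => ψ z.1 :=
      hψ.comp (@measurable_fst _ _ m mX)
    have h2 : @Measurable _ _ (m.prod mX) _ fun z : Ω × X => f (κ x) (κ' z.1) (Z x) z.2 :=
      measurable_density_comp hf measurable_const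
        (hκ'.measurable.comp (@measurable_fst _ _ m mX)) measurable_const
        (@measurable_snd _ _ m mX)
    exact h1.mul h2
  rw [hκ'.lintegral_eq _ hmeas]
  refine lintegral_congr_ae ?_
  filter_upwards [hx] with y hy
  have h3 : Measurable fun b => f (κ x) (κ' y) (Z x) b :=
    measurable_density_comp hf measurable_const measurable_const measurable_const measurable_id
  rw [lintegral_const_mul _ h3, hy, mul_one]

/-- Integration against such a density integrates with respect to the conditional couplings. -/
theorem lintegral_lintegral_mul_condDensity (hm : m ≤ mΩ) (hκ : IsCondLaw m μ Z κ)
    (hκ' : IsCondLaw m ν Z' κ') (hZ : Measurable Z)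
    (hf : Measurable fun z : (Measure X × Measure X) × X × X => f z.1.1 z.1.2 z.2.1 z.2.2)
    {c : X → X → ℝ≥0∞} (hc : Measurable (Function.uncurry c)) {G : Ω → Ω → ℝ≥0∞}
    (hG : @Measurable _ _ (m.prod m) _ (Function.uncurry G)) :
    ∫⁻ x, ∫⁻ y, G x y * (f (κ x) (κ' y) (Z x) (Z' y) * c (Z x) (Z' y)) ∂ν ∂μ
      = ∫⁻ x, ∫⁻ y, G x y * ∫⁻ a, ∫⁻ b, f (κ x) (κ' y) a b * c a b ∂κ' y ∂κ x ∂ν ∂μ := by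
  have hκm : Measurable κ := hκ.measurable.mono hm le_rfl
  have hκ'm : Measurable κ' := hκ'.measurable.mono hm le_rfl
  have hGm : Measurable (Function.uncurry G) := hG.mono (prod_le_prod hm) le_rfl
  have hGx : ∀ x, Measurable[m] (G x) := fun x =>
    hG.comp (@measurable_prodMk_left _ _ m m x)
  have hGy : ∀ y, Measurable[m] fun x => G x y := fun y =>
    hG.comp (@measurable_prodMk_right _ _ m m y)
  -- Joint measurability of the integrand, for every choice of the `σ`-algebra on the parameters.
  have hfc : ∀ {α : Type} {mα : MeasurableSpace α} {P Q : α → Measure X} {a b : α → X},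
      Measurable P → Measurable Q → Measurable a → Measurable b →
      Measurable fun z => f (P z) (Q z) (a z) (b z) * c (a z) (b z) :=
    fun hP hQ ha hb => (measurable_density_comp hf hP hQ ha hb).mul (hc.comp (ha.prodMk hb))
  have hinner : ∀ {α : Type} {mα : MeasurableSpace α} {P Q : α → Measure X} {a : α → X},
      Measurable P → Measurable Q → Measurable a → (∀ z, IsProbabilityMeasure (Q z)) →
      Measurable fun z => ∫⁻ b, f (P z) (Q z) (a z) b * c (a z) b ∂Q z :=
    fun hP hQ ha hprob => measurable_lintegral_param hQ hprob
      (hfc (hP.comp measurable_fst) (hQ.comp measurable_fst) (ha.comp measurable_fst)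
        measurable_snd)
  have step1 : ∀ x, ∫⁻ y, G x y * (f (κ x) (κ' y) (Z x) (Z' y) * c (Z x) (Z' y)) ∂ν
      = ∫⁻ y, G x y * ∫⁻ b, f (κ x) (κ' y) (Z x) b * c (Z x) b ∂κ' y ∂ν := fun x => by
    have hmeas : @Measurable _ _ (m.prod mX) _
        (Function.uncurry fun y b => G x y * (f (κ x) (κ' y) (Z x) b * c (Z x) b)) := by
      have h1 : @Measurable _ _ (m.prod mX) _ fun z : Ω × X => G x z.1 :=
        (hGx x).comp (@measurable_fst _ _ m mX)
      have h2 : @Measurable _ _ (m.prod mX) _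
          fun z : Ω × X => f (κ x) (κ' z.1) (Z x) z.2 * c (Z x) z.2 :=
        hfc measurable_const (hκ'.measurable.comp (@measurable_fst _ _ m mX)) measurable_const
          (@measurable_snd _ _ m mX)
      exact h1.mul h2
    rw [hκ'.lintegral_eq _ hmeas]
    exact lintegral_congr fun y => lintegral_const_mul _
      (hfc measurable_const measurable_const measurable_const measurable_id)
  have step2 : ∀ y, ∫⁻ x, G x y * ∫⁻ b, f (κ x) (κ' y) (Z x) b * c (Z x) b ∂κ' y ∂μ
      = ∫⁻ x, G x y * ∫⁻ a, ∫⁻ b, f (κ x) (κ' y) a b * c a b ∂κ' y ∂κ x ∂μ := fun y => by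
    have hmeas : @Measurable _ _ (m.prod mX) _
        (Function.uncurry fun x a => G x y * ∫⁻ b, f (κ x) (κ' y) a b * c a b ∂κ' y) := by
      have h1 : @Measurable _ _ (m.prod mX) _ fun z : Ω × X => G z.1 y :=
        (hGy y).comp (@measurable_fst _ _ m mX)
      have h2 : @Measurable _ _ (m.prod mX) _
          fun z : Ω × X => ∫⁻ b, f (κ z.1) (κ' y) z.2 b * c z.2 b ∂κ' y :=
        hinner (hκ.measurable.comp (@measurable_fst _ _ m mX)) measurable_const
          (@measurable_snd _ _ m mX) fun _ => hκ'.prob y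
      exact h1.mul h2
    rw [hκ.lintegral_eq _ hmeas]
    exact lintegral_congr fun x => lintegral_const_mul _
      (hinner measurable_const measurable_const measurable_id fun _ => hκ'.prob y)
  have hmeas1 : Measurable (Function.uncurry fun x y =>
      G x y * ∫⁻ b, f (κ x) (κ' y) (Z x) b * c (Z x) b ∂κ' y) :=
    hGm.mul (hinner (hκm.comp measurable_fst) (hκ'm.comp measurable_snd) (hZ.comp measurable_fst)
      fun z => hκ'.prob z.2)
  have hmeas2 : Measurable (Function.uncurry fun x y =>
      G x y * ∫⁻ a, ∫⁻ b, f (κ x) (κ' y) a b * c a b ∂κ' y ∂κ x) :=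
    hGm.mul (measurable_lintegral_param (hκm.comp measurable_fst) (fun z => hκ.prob z.1)
      (hinner (hκm.comp (measurable_fst.comp measurable_fst))
        (hκ'm.comp (measurable_snd.comp measurable_fst)) measurable_snd fun z => hκ'.prob z.1.2))
  simp_rw [step1]
  rw [lintegral_lintegral_swap hmeas1.aemeasurable]
  simp_rw [step2]
  rw [lintegral_lintegral_swap hmeas2.aemeasurable]

end CondDensity

/-! ### Bicausal plans with densities -/

section BicausalDensity

variable {n : ℕ} {μ ν : Measure (Fin (n + 1) → ℝ)}
  {H : ℕ → (Fin (n + 1) → ℝ) → (Fin (n + 1) → ℝ) → ℝ≥0∞}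

/-- A sequence of densities with respect to `μ ⊗ ν` whose products define bicausal plans. The factor
`H t` depends only on the coordinates of both paths up to the one with index `t`; given the past of
`y` before `t`, its conditional expectation is one for almost every `x`, and likewise with the roles
of `x` and `y` interchanged. -/
structure IsBicausalDensity (μ ν : Measure (Fin (n + 1) → ℝ))
    (H : ℕ → (Fin (n + 1) → ℝ) → (Fin (n + 1) → ℝ) → ℝ≥0∞) : Prop where
  measurable : ∀ t, @Measurable _ _ ((past n (t + 1)).prod (past n (t + 1))) _
    (Function.uncurry (H t))
  row : ∀ t, ∀ᵐ x ∂μ, ∀ ψ : (Fin (n + 1) → ℝ) → ℝ≥0∞, Measurable[past n t] ψ →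
    ∫⁻ y, ψ y * H t x y ∂ν = ∫⁻ y, ψ y ∂ν
  col : ∀ t, ∀ᵐ y ∂ν, ∀ ψ : (Fin (n + 1) → ℝ) → ℝ≥0∞, Measurable[past n t] ψ →
    ∫⁻ x, ψ x * H t x y ∂μ = ∫⁻ x, ψ x ∂μ

theorem IsBicausalDensity.swap (h : IsBicausalDensity μ ν H) :
    IsBicausalDensity ν μ fun t y x => H t x y where
  measurable t := (h.measurable t).comp (@measurable_swap _ _ (past n (t + 1)) (past n (t + 1)))
  row := h.col
  col := h.row

/-- The product of the first `t` densities. -/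
noncomputable def partialDensity (H : ℕ → (Fin (n + 1) → ℝ) → (Fin (n + 1) → ℝ) → ℝ≥0∞) (t : ℕ)
    (x y : Fin (n + 1) → ℝ) : ℝ≥0∞ :=
  ∏ s ∈ Finset.range t, H s x y

theorem partialDensity_succ (t : ℕ) (x y : Fin (n + 1) → ℝ) :
    partialDensity H (t + 1) x y = partialDensity H t x y * H t x y :=
  Finset.prod_range_succ _ _

theorem IsBicausalDensity.measurable_partialDensity (h : IsBicausalDensity μ ν H) (t : ℕ) :
    @Measurable _ _ ((past n t).prod (past n t)) _ (Function.uncurry (partialDensity H t)) := by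
  have hH : ∀ s ∈ Finset.range t, @Measurable _ _ ((past n t).prod (past n t)) _
      (Function.uncurry (H s)) := fun s hs =>
    (h.measurable s).mono (prod_le_prod (past_mono (Finset.mem_range.1 hs))) le_rfl
  exact Finset.measurable_fun_prod (f := fun s => Function.uncurry (H s)) _ hH

theorem IsBicausalDensity.measurable_partialDensity' (h : IsBicausalDensity μ ν H) (t : ℕ) :
    Measurable (Function.uncurry (partialDensity H t)) :=
  (h.measurable_partialDensity t).mono (prod_le_prod (past_le n t)) le_rfl

/-- Later factors of the density do not affect integrals of functions of the past. -/
theorem IsBicausalDensity.ae_lintegral_mul_partialDensity (h : IsBicausalDensity μ ν H) :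
    ∀ᵐ x ∂μ, ∀ t u, t ≤ u → ∀ ψ : (Fin (n + 1) → ℝ) → ℝ≥0∞, Measurable[past n t] ψ →
      ∫⁻ y, partialDensity H u x y * ψ y ∂ν = ∫⁻ y, partialDensity H t x y * ψ y ∂ν := by
  filter_upwards [ae_all_iff.2 h.row] with x hx t u htu ψ hψ
  induction u, htu using Nat.le_induction with
  | base => rfl
  | succ u htu ih =>
    rw [← ih]
    have hm : Measurable[past n u] fun y => partialDensity H u x y * ψ y := by
      have h1 : Measurable[past n u] (partialDensity H u x) :=
        (h.measurable_partialDensity u).comp (@measurable_prodMk_left _ _ (past n u) (past n u) x)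
      exact h1.mul (hψ.mono (past_mono htu) le_rfl)
    rw [← hx u _ hm]
    refine lintegral_congr fun y => ?_
    rw [partialDensity_succ]
    ring

/-- The plan with the given densities. -/
noncomputable def densityPlan (μ ν : Measure (Fin (n + 1) → ℝ))
    (H : ℕ → (Fin (n + 1) → ℝ) → (Fin (n + 1) → ℝ) → ℝ≥0∞) :
    Measure ((Fin (n + 1) → ℝ) × (Fin (n + 1) → ℝ)) :=
  (μ.prod ν).withDensity (Function.uncurry (partialDensity H (n + 1)))

variable [IsProbabilityMeasure ν]

theorem IsBicausalDensity.ae_lintegral_partialDensity (h : IsBicausalDensity μ ν H) (t : ℕ) :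
    ∀ᵐ x ∂μ, ∫⁻ y, partialDensity H t x y ∂ν = 1 := by
  filter_upwards [h.ae_lintegral_mul_partialDensity] with x hx
  have := hx 0 t (Nat.zero_le t) 1 (@measurable_const _ _ _ (past n 0) 1)
  simpa [partialDensity] using this

variable [IsProbabilityMeasure μ]

/-- A function which depends on the second coordinate only through its past at time `t` is
integrated with the first `t` factors of the density. -/
theorem IsBicausalDensity.lintegral_densityPlan (h : IsBicausalDensity μ ν H) {t : ℕ}
    (ht : t ≤ n + 1) {φ : (Fin (n + 1) → ℝ) → (Fin (n + 1) → ℝ) → ℝ≥0∞}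
    (hφ : Measurable (Function.uncurry φ)) (hφt : ∀ x, Measurable[past n t] (φ x)) :
    ∫⁻ z, φ z.1 z.2 ∂densityPlan μ ν H = ∫⁻ x, ∫⁻ y, partialDensity H t x y * φ x y ∂ν ∂μ := by
  rw [densityPlan, lintegral_withDensity_prod (h.measurable_partialDensity' _) hφ]
  refine lintegral_congr_ae ?_
  filter_upwards [h.ae_lintegral_mul_partialDensity] with x hx
  exact hx t (n + 1) ht _ (hφt x)

theorem IsBicausalDensity.densityPlan_mem_couplings (h : IsBicausalDensity μ ν H) :
    densityPlan μ ν H ∈ couplings μ ν :=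
  withDensity_mem_couplings (h.measurable_partialDensity' _) (h.ae_lintegral_partialDensity _)
    (h.swap.ae_lintegral_partialDensity _)

theorem IsBicausalDensity.map_swap_densityPlan (h : IsBicausalDensity μ ν H) :
    (densityPlan μ ν H).map Prod.swap = densityPlan ν μ fun t y x => H t x y := by
  ext s hs
  have hm := h.measurable_partialDensity' (n + 1)
  rw [Measure.map_apply measurable_swap hs, densityPlan, densityPlan,
    withDensity_apply _ (measurable_swap hs), withDensity_apply _ hs, ← Measure.prod_swap,
    setLIntegral_map (measurable_swap hs) hm measurable_swap]
  rfl

/-- For `B` in the past at time `t`, `γˣ(B)` is the integral over `B` of the first `t` factors of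
the density, and these depend on `x` only through its past. -/
theorem IsBicausalDensity.isCausal (h : IsBicausalDensity μ ν H)
    [IsFiniteMeasure (densityPlan μ ν H)] : IsCausal (densityPlan μ ν H) := by
  intro t ht B hB
  have hB' : MeasurableSet B := past_le n t _ hB
  have hind : Measurable[past n t] (B.indicator (1 : (Fin (n + 1) → ℝ) → ℝ≥0∞)) :=
    @Measurable.indicator _ _ _ _ (past n t) _ _ (@measurable_const _ _ _ (past n t) 1) hB
  have hfst : (densityPlan μ ν H).fst = μ := h.densityPlan_mem_couplings.1
  let g : (Fin (n + 1) → ℝ) → ℝ≥0∞ := fun x => ∫⁻ y, partialDensity H t x y * B.indicator 1 y ∂ν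
  have hg : Measurable[past n t] g := by
    have hG : @Measurable _ _ ((past n t).prod MeasurableSpace.pi) _
        (Function.uncurry (partialDensity H t)) :=
      (h.measurable_partialDensity t).mono
        (sup_le_sup le_rfl (MeasurableSpace.comap_mono (past_le n t))) le_rfl
    have h1 : @Measurable _ _ ((past n t).prod MeasurableSpace.pi) _
        fun z : (Fin (n + 1) → ℝ) × (Fin (n + 1) → ℝ) =>
          B.indicator (1 : (Fin (n + 1) → ℝ) → ℝ≥0∞) z.2 :=
      (measurable_one.indicator hB').comp (@measurable_snd _ _ (past n t) _)
    exact @Measurable.lintegral_prod_right' _ _ (past n t) _ ν _ _ (hG.mul h1)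
  refine ⟨g, hg, ?_⟩
  rw [hfst]
  refine ae_eq_of_forall_setLIntegral_eq_of_sigmaFinite
    ((densityPlan μ ν H).condKernel.measurable_coe hB') (hg.mono (past_le n t) le_rfl)
    fun A hA _ => ?_
  have h2 := Measure.setLIntegral_condKernel (ρ := densityPlan μ ν H) (f := 1) measurable_one hA hB'
  simp only [Pi.one_apply, lintegral_one, Measure.restrict_apply MeasurableSet.univ,
    Set.univ_inter, hfst] at h2
  rw [h2, ← lintegral_indicator_one (hA.prod hB'), ← lintegral_indicator hA]
  have hφ : Measurable (Function.uncurry fun x y : Fin (n + 1) → ℝ =>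
      A.indicator (1 : (Fin (n + 1) → ℝ) → ℝ≥0∞) x * B.indicator 1 y) :=
    ((measurable_one.indicator hA).comp measurable_fst).mul
      ((measurable_one.indicator hB').comp measurable_snd)
  have h3 := h.lintegral_densityPlan ht.le hφ fun x => hind.const_mul _
  refine Eq.trans (lintegral_congr fun z => ?_) (h3.trans (lintegral_congr fun x => ?_))
  · by_cases h1 : z.1 ∈ A <;> by_cases h2 : z.2 ∈ B <;> simp [Set.indicator, h1, h2]
  · by_cases hx : x ∈ A <;> simp [hx, g]

theorem IsBicausalDensity.densityPlan_mem_bicausal (h : IsBicausalDensity μ ν H) :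
    densityPlan μ ν H ∈ bicausal μ ν := by
  have h1 := isProbabilityMeasure_of_mem_couplings h.densityPlan_mem_couplings
  have h2 := isProbabilityMeasure_of_mem_couplings h.swap.densityPlan_mem_couplings
  refine ⟨h.densityPlan_mem_couplings, inferInstance, h.isCausal, ?_⟩
  have h3 := h.swap.isCausal
  have h4 := h.map_swap_densityPlan
  intro t ht B hB
  obtain ⟨g, hg, hgB⟩ := h3 t ht B hB
  refine ⟨g, hg, ?_⟩
  simp_rw [h4]
  exact hgB

end BicausalDensity

/-! ### Almost optimal bicausal plans -/

section CondLaw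

variable {n : ℕ} {μ : Measure (Fin (n + 1) → ℝ)} [IsProbabilityMeasure μ] {X : DistSpace}

theorem isCondLaw_condLaw (t : ℕ) {Z : (Fin (n + 1) → ℝ) → X.carrier} (hZ : Measurable Z) :
    IsCondLaw (past n t) μ Z (condLaw μ t Z) where
  measurable := measurable_condLaw t hZ
  prob := isProbabilityMeasure_condLaw t hZ
  lintegral_eq g hg := by
    have h1 : @Measurable _ _ ((past n t).prod MeasurableSpace.pi)
        ((past n t).prod X.measurableSpace)
        fun z : (Fin (n + 1) → ℝ) × (Fin (n + 1) → ℝ) => (z.1, Z z.2) :=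
      Measurable.prodMk
        (@measurable_fst _ _ (past n t) MeasurableSpace.pi)
        (hZ.comp (@measurable_snd _ _ (past n t) MeasurableSpace.pi))
    rw [← lintegral_lintegral_condExpKernel (μ := μ) (past_le n t) (f := fun ω ω' => g ω (Z ω'))
      (hg.comp h1)]
    refine lintegral_congr fun ω => ?_
    exact (lintegral_condLaw t hZ
      (hg.comp (@measurable_prodMk_left _ _ (past n t) X.measurableSpace ω)) ω).symm

/-- Conditioning on no coordinates is trivial, everywhere and not just almost everywhere, because a
function measurable with respect to `⊥` is constant. -/
theorem condLaw_zero {Z : (Fin (n + 1) → ℝ) → X.carrier} (hZ : Measurable Z)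
    (ω : Fin (n + 1) → ℝ) : condLaw μ 0 Z ω = μ.map Z := by
  ext B hB
  have hκ := isCondLaw_condLaw (μ := μ) 0 hZ
  have hm : Measurable[past n 0] fun ω' => condLaw μ 0 Z ω' B :=
    (Measure.measurable_coe hB).comp hκ.measurable
  have hs : MeasurableSet[past n 0] {ω' | condLaw μ 0 Z ω' B = condLaw μ 0 Z ω B} :=
    hm (measurableSet_singleton _)
  rw [past_zero, MeasurableSpace.measurableSet_bot_iff] at hs
  have huniv : ∀ ω', condLaw μ 0 Z ω' B = condLaw μ 0 Z ω B := by
    rcases hs with hs | hs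
    · exact absurd (show ω ∈ {ω' | condLaw μ 0 Z ω' B = condLaw μ 0 Z ω B} from rfl) (hs ▸ id)
    · intro ω'
      have h1 : ω' ∈ {ω' | condLaw μ 0 Z ω' B = condLaw μ 0 Z ω B} := hs ▸ Set.mem_univ ω'
      exact h1
  have h1 := lintegral_lintegral_condLaw (μ := μ) 0 hZ (measurable_one.indicator hB)
  simp_rw [lintegral_indicator_one hB, huniv] at h1
  rw [lintegral_const, measure_univ, mul_one] at h1
  rw [h1, ← lintegral_map (measurable_one.indicator hB) hZ, lintegral_indicator_one hB]

end CondLaw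

section Upper

variable {n : ℕ} {p : ℝ} {ρ : MetricSpace ℝ} {μ ν : Measure (Fin (n + 1) → ℝ)}
  [IsProbabilityMeasure μ] [IsProbabilityMeasure ν]

/-- The densities which couple the iterated conditional laws conditionally on the past, by means of
densities `f j P Q` of couplings of laws `P`, `Q` on the spaces `R_{N-j:N}`. The index `t` of the
factor belongs to the index `n - t` of `iterated`. -/
noncomputable def condDensity (hp : 1 ≤ p) (ρ : MetricSpace ℝ) (μ ν : Measure (Fin (n + 1) → ℝ))
    [IsProbabilityMeasure μ] [IsProbabilityMeasure ν]
    (f : (j : ℕ) → Measure (nestedSpace hp ρ j).carrier → Measure (nestedSpace hp ρ j).carrier →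
      (nestedSpace hp ρ j).carrier → (nestedSpace hp ρ j).carrier → ℝ≥0∞)
    (t : ℕ) (x y : Fin (n + 1) → ℝ) : ℝ≥0∞ :=
  f (n - t) (condLaw μ t (iterated hp ρ μ (n - t)) x) (condLaw ν t (iterated hp ρ ν (n - t)) y)
    (iterated hp ρ μ (n - t) x) (iterated hp ρ ν (n - t) y)

variable {hp : 1 ≤ p}
  {f : (j : ℕ) → Measure (nestedSpace hp ρ j).carrier → Measure (nestedSpace hp ρ j).carrier →
      (nestedSpace hp ρ j).carrier → (nestedSpace hp ρ j).carrier → ℝ≥0∞}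

/-- The conditional coupling at time `t` fixes the law of the coordinates up to `t` given the past,
so the row and column conditions follow from the marginals of the couplings `f j P Q`. -/
theorem isBicausalDensity_condDensity (hρ : IsCompatible ρ)
    (hf : ∀ j, Measurable fun z : (Measure (nestedSpace hp ρ j).carrier ×
      Measure (nestedSpace hp ρ j).carrier) × (nestedSpace hp ρ j).carrier ×
        (nestedSpace hp ρ j).carrier => f j z.1.1 z.1.2 z.2.1 z.2.2)
    (hmarg : ∀ j, ∀ (P Q : Measure (nestedSpace hp ρ j).carrier) [IsProbabilityMeasure P]
      [IsProbabilityMeasure Q],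
      (∀ᵐ a ∂P, ∫⁻ b, f j P Q a b ∂Q = 1) ∧ (∀ᵐ b ∂Q, ∫⁻ a, f j P Q a b ∂P = 1)) :
    IsBicausalDensity μ ν (condDensity hp ρ μ ν f) where
  measurable t := by
    have hle : past n t ≤ past n (t + 1) := past_mono (Nat.le_succ t)
    have hle' : past n (n + 1 - (n - t)) ≤ past n (t + 1) := past_mono (by omega)
    have hZ := measurable_iterated' (μ := μ) hp hρ (n - t) (by omega)
    have hZ' := measurable_iterated' (μ := ν) hp hρ (n - t) (by omega)
    refine measurable_density_comp (hf (n - t)) ?_ ?_ ?_ ?_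
    · exact ((measurable_condLaw t hZ).mono hle le_rfl).comp
        (@measurable_fst _ _ (past n (t + 1)) (past n (t + 1)))
    · exact ((measurable_condLaw t hZ').mono hle le_rfl).comp
        (@measurable_snd _ _ (past n (t + 1)) (past n (t + 1)))
    · exact ((measurable_iterated hp hρ (n - t) (by omega)).mono hle' le_rfl).comp
        (@measurable_fst _ _ (past n (t + 1)) (past n (t + 1)))
    · exact ((measurable_iterated hp hρ (n - t) (by omega)).mono hle' le_rfl).comp
        (@measurable_snd _ _ (past n (t + 1)) (past n (t + 1)))
  row t := by
    have hZ := measurable_iterated' (μ := μ) hp hρ (n - t) (by omega)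
    have hZ' := measurable_iterated' (μ := ν) hp hρ (n - t) (by omega)
    exact ae_lintegral_mul_condDensity (past_le n t) (isCondLaw_condLaw t hZ)
      (isCondLaw_condLaw t hZ') hZ (hf (n - t)) fun P Q _ _ => (hmarg (n - t) P Q).1
  col t := by
    have hZ := measurable_iterated' (μ := μ) hp hρ (n - t) (by omega)
    have hZ' := measurable_iterated' (μ := ν) hp hρ (n - t) (by omega)
    have hsw : Measurable fun z : (Measure (nestedSpace hp ρ (n - t)).carrier ×
        Measure (nestedSpace hp ρ (n - t)).carrier) × (nestedSpace hp ρ (n - t)).carrier ×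
        (nestedSpace hp ρ (n - t)).carrier => f (n - t) z.1.2 z.1.1 z.2.2 z.2.1 :=
      (hf (n - t)).comp (measurable_swap.prodMap measurable_swap)
    exact ae_lintegral_mul_condDensity (f := fun P Q a b => f (n - t) Q P b a) (past_le n t)
      (isCondLaw_condLaw t hZ') (isCondLaw_condLaw t hZ) hZ' hsw
      fun P Q _ _ => (hmarg (n - t) Q P).2

/-- One step of the cost estimate: coupling the iterated conditional laws at time `t` conditionally
on the past costs at most the Wasserstein distance of the conditional laws, up to `ε`. -/
theorem lintegral_condDensity_le (hρ : IsCompatible ρ)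
    (hμ : ∫⁻ ω, pathDist p ρ n ω 0 ^ p ∂μ < ∞) (hν : ∫⁻ ω, pathDist p ρ n ω 0 ^ p ∂ν < ∞)
    {ε : ℝ≥0∞}
    (hf : ∀ j, Measurable fun z : (Measure (nestedSpace hp ρ j).carrier ×
      Measure (nestedSpace hp ρ j).carrier) × (nestedSpace hp ρ j).carrier ×
        (nestedSpace hp ρ j).carrier => f j z.1.1 z.1.2 z.2.1 z.2.2)
    (hH : IsBicausalDensity μ ν (condDensity hp ρ μ ν f))
    (hcost : ∀ j, ∀ (P Q : Measure (nestedSpace hp ρ j).carrier) [IsProbabilityMeasure P]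
      [IsProbabilityMeasure Q] (x₀ : (nestedSpace hp ρ j).carrier),
      ∫⁻ x, (nestedSpace hp ρ j).d x x₀ ^ p ∂P < ∞ → ∫⁻ x, (nestedSpace hp ρ j).d x x₀ ^ p ∂Q < ∞ →
      ∫⁻ a, ∫⁻ b, f j P Q a b * (nestedSpace hp ρ j).d a b ^ p ∂Q ∂P
        ≤ wasserstein p (nestedSpace hp ρ j).d P Q ^ p + ε) (t : ℕ) :
    ∫⁻ x, ∫⁻ y, partialDensity (condDensity hp ρ μ ν f) (t + 1) x y *
        (nestedSpace hp ρ (n - t)).d (iterated hp ρ μ (n - t) x) (iterated hp ρ ν (n - t) y) ^ p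
        ∂ν ∂μ
      ≤ ∫⁻ x, ∫⁻ y, partialDensity (condDensity hp ρ μ ν f) t x y *
        wasserstein p (nestedSpace hp ρ (n - t)).d (condLaw μ t (iterated hp ρ μ (n - t)) x)
          (condLaw ν t (iterated hp ρ ν (n - t)) y) ^ p ∂ν ∂μ + ε := by
  have h := isSepDist_nestedSpace hp hρ (n - t)
  have hZ := measurable_iterated' (μ := μ) hp hρ (n - t) (by omega)
  have hZ' := measurable_iterated' (μ := ν) hp hρ (n - t) (by omega)
  have hκ := isCondLaw_condLaw (μ := μ) t hZ
  have hκ' := isCondLaw_condLaw (μ := ν) t hZ'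
  have hc : Measurable (Function.uncurry fun a b => (nestedSpace hp ρ (n - t)).d a b ^ p) :=
    h.measurable.pow_const p
  have hmain := lintegral_lintegral_mul_condDensity (past_le n t) hκ hκ' hZ (hf (n - t)) hc
    (hH.measurable_partialDensity t)
  have hmoμ := ae_condLaw_moment h t hZ (lintegral_iterated_lt_top hp hρ hμ (n - t) (by omega))
  have hmoν := ae_condLaw_moment h t hZ' (lintegral_iterated_lt_top hp hρ hν (n - t) (by omega))
  have hGx : ∀ x, Measurable fun y => partialDensity (condDensity hp ρ μ ν f) t x y * ε := fun x =>
    ((hH.measurable_partialDensity' t).comp measurable_prodMk_left).mul_const ε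
  calc _ = _ := lintegral_congr fun x => lintegral_congr fun y => by
          rw [partialDensity_succ, mul_assoc]
          rfl
    _ = _ := hmain
    _ ≤ ∫⁻ x, (∫⁻ y, partialDensity (condDensity hp ρ μ ν f) t x y *
        wasserstein p (nestedSpace hp ρ (n - t)).d (condLaw μ t (iterated hp ρ μ (n - t)) x)
          (condLaw ν t (iterated hp ρ ν (n - t)) y) ^ p ∂ν + ε) ∂μ := by
      refine lintegral_mono_ae ?_
      filter_upwards [hmoμ, hH.ae_lintegral_partialDensity t] with x hx hx1
      have hGε : ∫⁻ y, partialDensity (condDensity hp ρ μ ν f) t x y * ε ∂ν = ε := by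
        have hG : Measurable (partialDensity (condDensity hp ρ μ ν f) t x) :=
          (hH.measurable_partialDensity' t).comp measurable_prodMk_left
        rw [lintegral_mul_const _ hG, hx1, one_mul]
      conv_rhs => rw [← hGε]
      rw [← lintegral_add_right _ (hGx x)]
      refine lintegral_mono_ae ?_
      filter_upwards [hmoν] with y hy
      have h1 := hκ.prob x
      have h2 := hκ'.prob y
      rw [← mul_add]
      exact mul_le_mul_right (hcost (n - t) _ _ _ hx hy) _
    _ = _ := by rw [lintegral_add_right _ measurable_const, lintegral_const, measure_univ, mul_one]

/-- The recursion of the distances on the nested spaces, integrated against a density. -/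
theorem lintegral_nestedSpace_succ (hρ : IsCompatible ρ)
    (hμ : ∫⁻ ω, pathDist p ρ n ω 0 ^ p ∂μ < ∞) (hν : ∫⁻ ω, pathDist p ρ n ω 0 ^ p ∂ν < ∞)
    {G : (Fin (n + 1) → ℝ) → (Fin (n + 1) → ℝ) → ℝ≥0∞} (hG : Measurable (Function.uncurry G))
    {t : ℕ} (ht : t < n) :
    ∫⁻ x, ∫⁻ y, G x y * (nestedSpace hp ρ (n - t)).d (iterated hp ρ μ (n - t) x)
        (iterated hp ρ ν (n - t) y) ^ p ∂ν ∂μ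
      = ∫⁻ x, ∫⁻ y, G x y * baseDist ρ (x ⟨t, by omega⟩) (y ⟨t, by omega⟩) ^ p ∂ν ∂μ
        + ∫⁻ x, ∫⁻ y, G x y * wasserstein p (nestedSpace hp ρ (n - (t + 1))).d
          (condLaw μ (t + 1) (iterated hp ρ μ (n - (t + 1))) x)
          (condLaw ν (t + 1) (iterated hp ρ ν (n - (t + 1))) y) ^ p ∂ν ∂μ := by
  obtain ⟨k, rfl⟩ : ∃ k, n = t + (k + 1) := ⟨n - t - 1, by omega⟩
  have h1 : t + (k + 1) - t = k + 1 := by omega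
  have h2 : t + (k + 1) - (t + 1) = k := by omega
  rw [h1, h2]
  have hae : ∀ᵐ x ∂μ, (tail (iterated hp ρ μ (k + 1) x)).toMeasure
      = condLaw μ (t + (k + 1) - k) (iterated hp ρ μ k) x :=
    ae_toMeasure_tail hρ (by omega) (lintegral_iterated_lt_top hp hρ hμ k (by omega))
  have hae' : ∀ᵐ y ∂ν, (tail (iterated hp ρ ν (k + 1) y)).toMeasure
      = condLaw ν (t + (k + 1) - k) (iterated hp ρ ν k) y :=
    ae_toMeasure_tail hρ (by omega) (lintegral_iterated_lt_top hp hρ hν k (by omega))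
  have h3 : t + (k + 1) - k = t + 1 := by omega
  rw [h3] at hae hae'
  have hb : Measurable (Function.uncurry fun x y : Fin (t + (k + 1) + 1) → ℝ =>
      G x y * baseDist ρ (x ⟨t, by omega⟩) (y ⟨t, by omega⟩) ^ p) :=
    hG.mul (((isSepDist_baseDist hρ).measurable_comp
      ((measurable_pi_apply _).comp measurable_fst)
      ((measurable_pi_apply _).comp measurable_snd)).pow_const p)
  have hbx : ∀ x : Fin (t + (k + 1) + 1) → ℝ, Measurable fun y : Fin (t + (k + 1) + 1) → ℝ =>
      G x y * baseDist ρ (x ⟨t, by omega⟩) (y ⟨t, by omega⟩) ^ p := fun x =>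
    hb.comp measurable_prodMk_left
  have hbi : Measurable fun x : Fin (t + (k + 1) + 1) → ℝ =>
      ∫⁻ y, G x y * baseDist ρ (x ⟨t, by omega⟩) (y ⟨t, by omega⟩) ^ p ∂ν :=
    hb.lintegral_prod_right
  rw [← lintegral_add_left hbi]
  refine lintegral_congr_ae ?_
  filter_upwards [hae] with x hx
  rw [← lintegral_add_left (hbx x)]
  refine lintegral_congr_ae ?_
  filter_upwards [hae'] with y hy
  rw [← mul_add]
  have hd : (nestedSpace hp ρ (k + 1)).d (iterated hp ρ μ (k + 1) x)
        (iterated hp ρ ν (k + 1) y) ^ p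
      = baseDist ρ (x ⟨t + (k + 1) - (k + 1), by omega⟩) (y ⟨t + (k + 1) - (k + 1), by omega⟩) ^ p
        + wasserstein p (nestedSpace hp ρ k).d (tail (iterated hp ρ μ (k + 1) x)).toMeasure
          (tail (iterated hp ρ ν (k + 1) y)).toMeasure ^ p := rpow_inv_rpow' hp _
  have hi : (⟨t + (k + 1) - (k + 1), by omega⟩ : Fin (t + (k + 1) + 1)) = ⟨t, by omega⟩ :=
    Fin.ext (by simp)
  rw [hd, hx, hy, hi]

/-- The product of the densities of `ε`-optimal couplings of the iterated conditional laws, given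
the past, defines a bicausal plan. Unrolling the recursion of the distances forward in time, its
cost exceeds the distance of `I[μ]` and `I[ν]` by at most `ε` at each time. -/
theorem nestedDist_rpow_le (hp : 1 ≤ p) (hρ : IsCompatible ρ) (μ ν : PathLaw p ρ n) {ε : ℝ≥0∞}
    (hε : ε ≠ 0) :
    nestedDist p ρ n μ ν ^ p
      ≤ nestedLawDist hp ρ n (iteratedLaw hp ρ n μ) (iteratedLaw hp ρ n ν) ^ p
        + (n + 1 : ℕ) * ε := by
  have hμ := PMoment.lintegral_lt_top (isSepDist_pathDist hp hρ n) hp μ 0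
  have hν := PMoment.lintegral_lt_top (isSepDist_pathDist hp hρ n) hp ν 0
  choose f hf hmarg hcost using fun j =>
    (isSepDist_nestedSpace hp hρ j).exists_density_selection hp hε
  have hH := isBicausalDensity_condDensity (μ := μ.toMeasure) (ν := ν.toMeasure) hρ hf hmarg
  let H := condDensity hp ρ μ.toMeasure ν.toMeasure f
  let γ := densityPlan μ.toMeasure ν.toMeasure H
  -- `R i` is the cost in the coordinate `i`, and `V t` the future cost expected at time `t`.
  let R : Fin (n + 1) → ℝ≥0∞ := fun i => ∫⁻ x, ∫⁻ y, partialDensity H (i.val + 1) x y *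
    baseDist ρ (x i) (y i) ^ p ∂ν.toMeasure ∂μ.toMeasure
  let V : ℕ → ℝ≥0∞ := fun t => ∫⁻ x, ∫⁻ y, partialDensity H t x y *
    wasserstein p (nestedSpace hp ρ (n - t)).d
      (condLaw μ.toMeasure t (iterated hp ρ μ.toMeasure (n - t)) x)
      (condLaw ν.toMeasure t (iterated hp ρ ν.toMeasure (n - t)) y) ^ p ∂ν.toMeasure ∂μ.toMeasure
  have hb : ∀ i, Measurable (Function.uncurry fun x y : Fin (n + 1) → ℝ =>
      baseDist ρ (x i) (y i) ^ p) := fun i =>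
    ((isSepDist_baseDist hρ).measurable_comp ((measurable_pi_apply i).comp measurable_fst)
      ((measurable_pi_apply i).comp measurable_snd)).pow_const p
  have hR : ∀ i, ∫⁻ z, baseDist ρ (z.1 i) (z.2 i) ^ p ∂γ = R i := fun i => by
    refine hH.lintegral_densityPlan (t := i.val + 1) i.2 (hb i) fun x => ?_
    have h1 : Measurable fun r : ℝ => baseDist ρ (x i) r ^ p :=
      ((isSepDist_baseDist hρ).measurable_comp measurable_const measurable_id).pow_const p
    exact h1.comp (measurable_past_eval (Nat.lt_succ_self _))
  have hstep : ∀ t (ht : t < n), R ⟨t, by omega⟩ + V (t + 1) ≤ V t + ε := fun t ht => by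
    refine le_trans (le_of_eq ?_)
      (lintegral_condDensity_le hρ hμ hν hf hH (fun j P Q _ _ => hcost j P Q) t)
    exact (lintegral_nestedSpace_succ hρ hμ hν (hH.measurable_partialDensity' (t + 1)) ht).symm
  have hlast : R ⟨n, by omega⟩ ≤ V n + ε := by
    refine le_trans (le_of_eq ?_)
      (lintegral_condDensity_le hρ hμ hν hf hH (fun j P Q _ _ => hcost j P Q) n)
    have h0 : ∀ j, j = 0 → ∀ x y : Fin (n + 1) → ℝ, baseDist ρ (x ⟨n, by omega⟩) (y ⟨n, by omega⟩)
        = (nestedSpace hp ρ j).d (iterated hp ρ μ.toMeasure j x)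
          (iterated hp ρ ν.toMeasure j y) := by
      rintro j rfl x y
      rfl
    exact lintegral_congr fun x => lintegral_congr fun y => by rw [h0 (n - n) (Nat.sub_self n) x y]
  have hV0 : V 0 = nestedLawDist hp ρ n (iteratedLaw hp ρ n μ) (iteratedLaw hp ρ n ν) ^ p := by
    have hZ := measurable_iterated' (μ := μ.toMeasure) hp hρ n le_rfl
    have hZ' := measurable_iterated' (μ := ν.toMeasure) hp hρ n le_rfl
    simp only [V, Nat.sub_zero, partialDensity, Finset.range_zero, Finset.prod_empty, one_mul,
      condLaw_zero hZ, condLaw_zero hZ', lintegral_const, measure_univ, mul_one]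
    rw [nestedLawDist, (iteratedLawWellDefined hp hρ μ).2.2, (iteratedLawWellDefined hp hρ ν).2.2]
  have hind : ∀ t (ht : t ≤ n),
      ∑ i ∈ Finset.univ.filter (fun i : Fin (n + 1) => i.val < t), R i + V t
        ≤ V 0 + (t : ℕ) * ε := by
    intro t ht
    induction t with
    | zero => simp
    | succ t ih =>
      have hs : Finset.univ.filter (fun i : Fin (n + 1) => i.val < t + 1)
          = insert ⟨t, by omega⟩ (Finset.univ.filter (fun i : Fin (n + 1) => i.val < t)) := by
        ext i
        simp only [Finset.mem_filter, Finset.mem_univ, true_and, Finset.mem_insert, Fin.ext_iff]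
        omega
      rw [hs, Finset.sum_insert (by simp)]
      calc R ⟨t, by omega⟩ + ∑ i ∈ Finset.univ.filter (fun i : Fin (n + 1) => i.val < t), R i
            + V (t + 1)
          = ∑ i ∈ Finset.univ.filter (fun i : Fin (n + 1) => i.val < t), R i
            + (R ⟨t, by omega⟩ + V (t + 1)) := by ring
        _ ≤ ∑ i ∈ Finset.univ.filter (fun i : Fin (n + 1) => i.val < t), R i + (V t + ε) :=
            add_le_add le_rfl (hstep t (by omega))
        _ = (∑ i ∈ Finset.univ.filter (fun i : Fin (n + 1) => i.val < t), R i + V t) + ε := by ring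
        _ ≤ V 0 + (t : ℕ) * ε + ε := add_le_add (ih (by omega)) le_rfl
        _ = V 0 + (t + 1 : ℕ) * ε := by push_cast; ring
  have htot : ∑ i, R i ≤ V 0 + (n + 1 : ℕ) * ε := by
    have hs : (Finset.univ : Finset (Fin (n + 1)))
        = insert ⟨n, by omega⟩ (Finset.univ.filter (fun i : Fin (n + 1) => i.val < n)) := by
      ext i
      simp only [Finset.mem_filter, Finset.mem_univ, true_and, Finset.mem_insert, Fin.ext_iff,
        true_iff]
      omega
    rw [hs, Finset.sum_insert (by simp)]
    calc R ⟨n, by omega⟩ + ∑ i ∈ Finset.univ.filter (fun i : Fin (n + 1) => i.val < n), R i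
        ≤ (V n + ε) + ∑ i ∈ Finset.univ.filter (fun i : Fin (n + 1) => i.val < n), R i :=
          add_le_add hlast le_rfl
      _ = (∑ i ∈ Finset.univ.filter (fun i : Fin (n + 1) => i.val < n), R i + V n) + ε := by ring
      _ ≤ V 0 + (n : ℕ) * ε + ε := add_le_add (hind n le_rfl) le_rfl
      _ = V 0 + (n + 1 : ℕ) * ε := by push_cast; ring
  calc nestedDist p ρ n μ ν ^ p
      ≤ ∫⁻ z, pathDist p ρ n z.1 z.2 ^ p ∂γ := by
        rw [nestedDist, rpow_inv_rpow' hp]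
        exact iInf₂_le γ hH.densityPlan_mem_bicausal
    _ = ∑ i, R i := by
        simp_rw [pathDist_rpow hp]
        refine (lintegral_finsetSum _ fun i _ => hb i).trans ?_
        exact Finset.sum_congr rfl fun i _ => hR i
    _ ≤ _ := by
        rw [← hV0]
        exact htot

/-- The map `I` preserves distances. -/
theorem nestedDist_eq (hp : 1 ≤ p) (hρ : IsCompatible ρ) (μ ν : PathLaw p ρ n) :
    nestedDist p ρ n μ ν
      = nestedLawDist hp ρ n (iteratedLaw hp ρ n μ) (iteratedLaw hp ρ n ν) := by
  refine le_antisymm (le_of_forall_rpow_le_add hp fun ε hε hε' => ?_)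
    (nestedLawDist_iteratedLaw_le hp hρ μ ν)
  have h0 : ((n + 1 : ℕ) : ℝ≥0∞) ≠ 0 := by simp
  have h1 : ((n + 1 : ℕ) : ℝ≥0∞) ≠ ∞ := ENNReal.natCast_ne_top _
  have h2 := nestedDist_rpow_le hp hρ μ ν (ε := ε / (n + 1 : ℕ)) (ENNReal.div_pos hε.ne' h1).ne'
  rwa [ENNReal.mul_div_cancel h0 h1] at h2

end Upper

/-! ### The nested distance as a metric -/

section Metric

variable {n : ℕ} {p : ℝ} {ρ : MetricSpace ℝ}

/-- Bicausal plans are couplings, so the nested distance dominates the Wasserstein distance. -/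
theorem eq_of_nestedDist_eq_zero (hp : 1 ≤ p) (hρ : IsCompatible ρ) {μ ν : PathLaw p ρ n}
    (h : nestedDist p ρ n μ ν = 0) : μ = ν := by
  have hp0 : 0 ≤ 1 / p := by positivity
  have hle : wasserstein p (pathDist p ρ n) μ.toMeasure ν.toMeasure ≤ nestedDist p ρ n μ ν := by
    refine ENNReal.rpow_le_rpow (le_iInf₂ fun γ hγ => ?_) hp0
    exact iInf₂_le γ hγ.1
  have hs := isSepDist_pathDist hp hρ n
  exact PMoment.ext (hs.eq_of_wasserstein_eq_zero hp (le_antisymm (hle.trans_eq h) zero_le))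

/-- The metric `W_{d_{(1:N)},p}` on `𝒫ᵖ(R_{1:N})`. -/
@[reducible] noncomputable def nestedLawMetric (hp : 1 ≤ p) (hρ : IsCompatible ρ) (n : ℕ) :
    MetricSpace (NestedLaw hp ρ n) :=
  @IsSepDist.metricSpace _ (@borel _ (metricTopology PMoment.dist)) _
    ((isSepDist_nestedSpace hp hρ n).isSepDist_pMoment hp)

/-- The metric `d_p^nd` on `𝒫ᵖ(ℝᴺ)`; all axioms but the separation of points are inherited from
the metric on `𝒫ᵖ(R_{1:N})`. -/
@[reducible] noncomputable def pathLawMetric (hp : 1 ≤ p) (hρ : IsCompatible ρ) (n : ℕ) :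
    MetricSpace (PathLaw p ρ n) :=
  let m := nestedLawMetric hp hρ n
  @EMetricSpace.toMetricSpace (PathLaw p ρ n)
    { edist := nestedDist p ρ n
      edist_self := fun μ => (nestedDist_eq hp hρ μ μ).trans
        (m.toPseudoMetricSpace.toPseudoEMetricSpace.edist_self _)
      edist_comm := fun μ ν => by
        rw [nestedDist_eq hp hρ μ ν, nestedDist_eq hp hρ ν μ]
        exact m.toPseudoMetricSpace.toPseudoEMetricSpace.edist_comm _ _
      edist_triangle := fun μ ν η => by
        rw [nestedDist_eq hp hρ μ η, nestedDist_eq hp hρ μ ν, nestedDist_eq hp hρ ν η]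
        exact m.toPseudoMetricSpace.toPseudoEMetricSpace.edist_triangle _ _ _
      eq_of_edist_eq_zero := eq_of_nestedDist_eq_zero hp hρ }
    fun μ ν => (nestedDist_eq hp hρ μ ν).trans_ne
      (edist_ne_top (iteratedLaw hp ρ n μ) (iteratedLaw hp ρ n ν))

end Metric

end NestedDistance

theorem mainTheorem2 (n : ℕ) (p : ℝ) (hp : 1 ≤ p) (ρ : MetricSpace ℝ)
    (hρ : NestedDistance.IsCompatible ρ) :
    (∀ μ : NestedDistance.PathLaw p ρ n, NestedDistance.IteratedLawWellDefined hp ρ n μ) ∧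
    ∃ (_ : MetricSpace (NestedDistance.PathLaw p ρ n))
      (_ : MetricSpace (NestedDistance.NestedLaw hp ρ n)),
      (∀ μ ν : NestedDistance.PathLaw p ρ n,
        edist μ ν = NestedDistance.nestedDist p ρ n μ ν) ∧
      (∀ P Q : NestedDistance.NestedLaw hp ρ n,
        edist P Q = NestedDistance.nestedLawDist hp ρ n P Q) ∧
      (@CompleteSpace ℝ ρ.toPseudoMetricSpace.toUniformSpace →
        CompleteSpace (NestedDistance.NestedLaw hp ρ n)) ∧
      TopologicalSpace.SeparableSpace (NestedDistance.NestedLaw hp ρ n) ∧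
      Isometry (NestedDistance.iteratedLaw hp ρ n) ∧
      TopologicalSpace.SeparableSpace (NestedDistance.PathLaw p ρ n) := by
  have hR := NestedDistance.isSepDist_nestedSpace hp hρ n
  have h := hR.isSepDist_pMoment hp
  let m₁ := NestedDistance.pathLawMetric hp hρ n
  let m₂ := NestedDistance.nestedLawMetric hp hρ n
  have hsep : TopologicalSpace.SeparableSpace (NestedDistance.NestedLaw hp ρ n) :=
    @NestedDistance.IsSepDist.separableSpace _
      (@borel _ (NestedDistance.metricTopology NestedDistance.PMoment.dist)) _ h
  have hiso : Isometry (NestedDistance.iteratedLaw hp ρ n) := fun μ ν =>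
    (NestedDistance.nestedDist_eq hp hρ μ ν).symm
  refine ⟨NestedDistance.iteratedLawWellDefined hp hρ, m₁, m₂, fun _ _ => rfl, fun _ _ => rfl,
    fun hc => @NestedDistance.IsSepDist.completeSpace _
      (@borel _ (NestedDistance.metricTopology NestedDistance.PMoment.dist)) _ h
      (hR.isCompleteDist_pMoment hp (NestedDistance.isCompleteDist_nestedSpace hp hρ hc n)),
    hsep, hiso, ?_⟩
  have := UniformSpace.secondCountable_of_separable (NestedDistance.NestedLaw hp ρ n)
  have := hiso.isEmbedding.secondCountableTopology
  infer_instance
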